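/- Notation. All parameters $a,b,b',c,c'$ are complex, $D=x\partial_x$, $D'=y\partial_y$, and all solution spaces are spaces of germs of holomorphic solutions at a point. $S_2(a,b,b',c,c';x,y)$ is the space of solutions of Appell's system $E_2$: $$\big(D(c-1+D)-x(a+D+D')(b+D)\big)z=0,\qquad \big(D'(c'-1+D')-y(a+D+D')(b'+D')\big)z=0 .$$ $S_1(a,b,b',c;x,y)$ is the space of solutions of Appell's system $E_1$: $P_1z=Q_1z=R_1z=0$ with $$P_1=x(1-x)\partial_{xx}+y(1-x)\partial_{xy}+(c-(a+b+1)x)\partial_x-by\partial_y-ab,$$ $$Q_1=y(1-y)\partial_{yy}+x(1-y)\partial_{yx}+(c-(a+b'+1)y)\partial_y-b'x\partial_x-ab',\qquad R_1=(x-y)\partial_{xy}-b'\partial_x+b\partial_y .$$ $S(a,b,c;t)$ is the space of solutions of the Gauss equation $\big(\vartheta(c-1+\vartheta)-t(a+\vartheta)(b+\vartheta)\big)u=0$, $\vartheta=t\,d/dt$. For functions $\varphi_1,\varphi_2,\tau$ of $(x,y)$, $S_1(\dots;\varphi_1,\varphi_2)$ and $S(\dots;\tau)$ denote the spaces of the composed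 functions. Theorem. Let $a,b,b'\in\mathbb C$, let $(x_0,y_0)\in\mathbb C^2$ satisfy $x_0(x_0-1)y_0(y_0-1)(x_0+y_0-1)\neq0$, and fix any branches of $(1-x)^b$ and $(1-y)^{b'}$ near $(x_0,y_0)$. Put $$X=\frac{-x}{1-x},\qquad Y=\frac{-y}{1-y},\qquad XY=\frac{xy}{(1-x)(1-y)} .$$ Then, for the spaces of germs at $(x_0,y_0)$: (i) One has the inclusions $$\begin{matrix}(1-y)^{b'}(1-x)^{b}S_2(a,b,b',a,a;x,y)&\supset&S_1(b,0,b',a;X,XY)\\ \cup&&\cup\\ S_1(b',b,0,a;XY,Y)&\supset&S(b,b',a;XY).\end{matrix}$$ (ii) If $a\ne1$, then $S_1(b,0,b',a;X,XY)\cap S_1(b',b,0,a;XY,Y)=S(b,b',a;XY)$. (iii) If $a\neq1$, $b'-a\notin\{-1,-2,-3,\dots\}$ and $b'\notin\{0,-1,-2,\dots\}$, then $(1-y)^{b'}(1-x)^bS_2(a,b,b',a,a;x,y)$ is spanned by $S(b,b',a;XY)$ and the two indefinite integrals $$f_1=\int_0^{X}s^{b'-a}(1-s)^{a-b-1}(XY-s)^{-b'}\,ds,\qquad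 f_2=(XY)^{1-a}\int_0^{X}s^{b'-1}(1-s)^{-b}(XY-s)^{a-b'-1}\,ds ,$$ for any choice of the branches of the powers and of the paths of integration. Here, for $(x,y)=(x_0,y_0)$, a path is a $C^1$ path from $0$ to $X$ that leaves $0$ with nonzero speed and does not meet $0$ again nor $1$, $XY$; for nearby $(x,y)$ it is rescaled so that it ends at $X$, and the branches are continued. An integral $\int_0^X s^{\alpha}h(s)\,ds$, with $h$ holomorphic at $0$, is an ordinary integral if $\operatorname{Re}\alpha>-1$; otherwise it denotes its Hadamard finite part at $s=0$ (the analytic continuation in $\alpha$), in which the divergent terms $h_ns^{\alpha+n}$ of the expansion at $0$ are integrated as $h_nX^{\alpha+n+1}/(\alpha+n+1)$. -/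

import Mathlib

open Filter Topology

noncomputable section

namespace AppellE2

/-! ### Differential operators in the variables `x = q.1`, `y = q.2` -/

/-- `∂/∂x`. -/
def dx (z : ℂ × ℂ → ℂ) : ℂ × ℂ → ℂ := fun q => deriv (fun x => z (x, q.2)) q.1

/-- `∂/∂y`. -/
def dy (z : ℂ × ℂ → ℂ) : ℂ × ℂ → ℂ := fun q => deriv (fun y => z (q.1, y)) q.2

/-- `D = x ∂/∂x`. -/
def eulerX (z : ℂ × ℂ → ℂ) : ℂ × ℂ → ℂ := fun q => q.1 * dx z q

/-- `D' = y ∂/∂y`. -/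
def eulerY (z : ℂ × ℂ → ℂ) : ℂ × ℂ → ℂ := fun q => q.2 * dy z q

/-- `P₂ = D (c - 1 + D) - x (a + D + D') (b + D)`. -/
def opP2 (a b c : ℂ) (z : ℂ × ℂ → ℂ) : ℂ × ℂ → ℂ := fun q =>
  eulerX ((c - 1) • z + eulerX z) q -
    q.1 * (a • (b • z + eulerX z) + eulerX (b • z + eulerX z) + eulerY (b • z + eulerX z)) q

/-- `Q₂ = D' (c' - 1 + D') - y (a + D + D') (b' + D')`. -/
def opQ2 (a b' c' : ℂ) (z : ℂ × ℂ → ℂ) : ℂ × ℂ → ℂ := fun q =>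
  eulerY ((c' - 1) • z + eulerY z) q -
    q.2 * (a • (b' • z + eulerY z) + eulerX (b' • z + eulerY z) + eulerY (b' • z + eulerY z)) q

/-- `P₁ = x(1-x) ∂ₓₓ + y(1-x) ∂ₓᵧ + (c - (a+b+1)x) ∂ₓ - b y ∂ᵧ - a b`. -/
def opP1 (a b c : ℂ) (z : ℂ × ℂ → ℂ) : ℂ × ℂ → ℂ := fun q =>
  q.1 * (1 - q.1) * dx (dx z) q + q.2 * (1 - q.1) * dx (dy z) q +
    (c - (a + b + 1) * q.1) * dx z q - b * q.2 * dy z q - a * b * z q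

/-- `Q₁ = y(1-y) ∂ᵧᵧ + x(1-y) ∂ᵧₓ + (c - (a+b'+1)y) ∂ᵧ - b' x ∂ₓ - a b'`. -/
def opQ1 (a b' c : ℂ) (z : ℂ × ℂ → ℂ) : ℂ × ℂ → ℂ := fun q =>
  q.2 * (1 - q.2) * dy (dy z) q + q.1 * (1 - q.2) * dy (dx z) q +
    (c - (a + b' + 1) * q.2) * dy z q - b' * q.1 * dx z q - a * b' * z q

/-- `R₁ = (x - y) ∂ₓᵧ - b' ∂ₓ + b ∂ᵧ`. -/
def opR1 (b b' : ℂ) (z : ℂ × ℂ → ℂ) : ℂ × ℂ → ℂ := fun q =>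
  (q.1 - q.2) * dx (dy z) q - b' * dx z q + b * dy z q

/-- `t d/dt` in one variable. -/
def euler (u : ℂ → ℂ) : ℂ → ℂ := fun t => t * deriv u t

/-- `P = D (c - 1 + D) - t (a + D) (b + D)`. -/
def opP (a b c : ℂ) (u : ℂ → ℂ) : ℂ → ℂ := fun t =>
  euler ((c - 1) • u + euler u) t - t * (a • (b • u + euler u) + euler (b • u + euler u)) t

/-! ### Local holomorphic solutions -/

/-- `z` is, near `p`, a holomorphic solution of Appell's system `E₂(a,b,b',c,c')`. -/
def IsSolE2 (a b b' c c' : ℂ) (z : ℂ × ℂ → ℂ) (p : ℂ × ℂ) : Prop :=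
  AnalyticAt ℂ z p ∧ ∀ᶠ q in 𝓝 p, opP2 a b c z q = 0 ∧ opQ2 a b' c' z q = 0

/-- `z` is, near `p`, a holomorphic solution of Appell's system `E₁(a,b,b',c)`. -/
def IsSolE1 (a b b' c : ℂ) (z : ℂ × ℂ → ℂ) (p : ℂ × ℂ) : Prop :=
  AnalyticAt ℂ z p ∧
    ∀ᶠ q in 𝓝 p, opP1 a b c z q = 0 ∧ opQ1 a b' c z q = 0 ∧ opR1 b b' z q = 0

/-- `u` is, near `t₀`, a holomorphic solution of the Gauss equation `E(a,b,c)`. -/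
def IsSolGauss (a b c : ℂ) (u : ℂ → ℂ) (t₀ : ℂ) : Prop :=
  AnalyticAt ℂ u t₀ ∧ ∀ᶠ t in 𝓝 t₀, opP a b c u t = 0

/-- The germs at `p` of `m · z`, with `z` a local solution of `E₂(a,b,b',c,c')` at `p`:
the space `m S₂(a,b,b',c,c';x,y)`. -/
def mulSolE2 (m : ℂ × ℂ → ℂ) (a b b' c c' : ℂ) (p : ℂ × ℂ) : Set (Germ (𝓝 p) ℂ) :=
  {g | ∃ z : ℂ × ℂ → ℂ, IsSolE2 a b b' c c' z p ∧ g = ((fun q => m q * z q : ℂ × ℂ → ℂ) : Germ (𝓝 p) ℂ)}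

/-- The germs at `p` of `(x,y) ↦ z(φ(x,y))`, with `z` a local solution of `E₁(a,b,b',c)` at
`φ(p)`: the space `S₁(a,b,b',c;φ₁(x,y),φ₂(x,y))`. -/
def solE1 (a b b' c : ℂ) (φ : ℂ × ℂ → ℂ × ℂ) (p : ℂ × ℂ) : Set (Germ (𝓝 p) ℂ) :=
  {g | ∃ z : ℂ × ℂ → ℂ, IsSolE1 a b b' c z (φ p) ∧
    g = ((fun q => z (φ q) : ℂ × ℂ → ℂ) : Germ (𝓝 p) ℂ)}

/-- The germs at `p` of `(x,y) ↦ u(τ(x,y))`, with `u` a local solution of `E(a,b,c)` at `τ(p)`: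
the space `S(a,b,c;τ(x,y))`. -/
def solGauss (a b c : ℂ) (τ : ℂ × ℂ → ℂ) (p : ℂ × ℂ) : Set (Germ (𝓝 p) ℂ) :=
  {g | ∃ u : ℂ → ℂ, IsSolGauss a b c u (τ p) ∧
    g = ((fun q => u (τ q) : ℂ × ℂ → ℂ) : Germ (𝓝 p) ℂ)}

/-! ### Coordinates -/

/-- `X = -x/(1-x)`. -/
def coordX (q : ℂ × ℂ) : ℂ := -q.1 / (1 - q.1)

/-- `Y = -y/(1-y)`. -/
def coordY (q : ℂ × ℂ) : ℂ := -q.2 / (1 - q.2)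

/-- `t = XY = xy/((1-x)(1-y))`. -/
def coordT (q : ℂ × ℂ) : ℂ := q.1 * q.2 / ((1 - q.1) * (1 - q.2))

/-! ### Branches of powers and the indefinite integrals -/

/-- The branch near `w₀` of the power `w ^ c` that is determined by a logarithm `ℓ` of `w₀`
(`exp ℓ = w₀`): near `w₀`, the function `ℓ + Log (w / w₀)` is the logarithm of `w` with value `ℓ`
at `w₀`. -/
def branchPow (w₀ ℓ c w : ℂ) : ℂ := Complex.exp (c * (ℓ + Complex.log (w / w₀)))

/-- A path of integration from `0` to `X₀` in the `s`-plane, avoiding `0` (after the start), `1` and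
`t₀`, together with continuous branches along it of `log s`, `log (1 - s)` and `log (t₀ - s)`.
The path is `C¹` and leaves `0` with nonzero speed. The points `0`, `1`, `t₀` are avoided because
the exponential has no zero. -/
structure BranchedPath (X₀ t₀ : ℂ) where
  path : ℝ → ℂ
  contDiff_path : ContDiff ℝ 1 path
  path_zero : path 0 = 0
  path_one : path 1 = X₀
  deriv_path_zero : deriv path 0 ≠ 0
  logS : ℝ → ℂ
  logOneSub : ℝ → ℂ
  logTSub : ℝ → ℂ
  continuousOn_logS : ContinuousOn logS (Set.Ioc 0 1)
  continuousOn_logOneSub : ContinuousOn logOneSub (Set.Icc 0 1)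
  continuousOn_logTSub : ContinuousOn logTSub (Set.Icc 0 1)
  exp_logS : ∀ r ∈ Set.Ioc (0 : ℝ) 1, Complex.exp (logS r) = path r
  exp_logOneSub : ∀ r ∈ Set.Icc (0 : ℝ) 1, Complex.exp (logOneSub r) = 1 - path r
  exp_logTSub : ∀ r ∈ Set.Icc (0 : ℝ) 1, Complex.exp (logTSub r) = t₀ - path r

namespace BranchedPath

variable {X₀ t₀ : ℂ} (w : BranchedPath X₀ t₀)

/-- For `X` near `X₀`: the path from `0` to `X` obtained by rescaling the given one. -/
def pathTo (X : ℂ) (r : ℝ) : ℂ := X / X₀ * w.path r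

/-- The branch of `s ^ α` along the path to `X`. -/
def powS (α X : ℂ) (r : ℝ) : ℂ := branchPow (w.path r) (w.logS r) α (w.pathTo X r)

/-- The branch of `(1 - s) ^ β (t - s) ^ δ` along the path to `X`, for `(X, t)` near `(X₀, t₀)`. -/
def powRest (β δ X t : ℂ) (r : ℝ) : ℂ :=
  branchPow (1 - w.path r) (w.logOneSub r) β (1 - w.pathTo X r) *
    branchPow (t₀ - w.path r) (w.logTSub r) δ (t - w.pathTo X r)

/-- The `n`-th Taylor coefficient at `s = 0` of the branch of `(1 - s) ^ β (t - s) ^ δ`. -/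
def coeff (β δ t : ℂ) (n : ℕ) : ℂ :=
  branchPow 1 (w.logOneSub 0) β 1 * branchPow t₀ (w.logTSub 0) δ t *
    ∑ j ∈ Finset.range (n + 1),
      (ascPochhammer ℂ (n - j)).eval (-β) / ((n - j).factorial : ℂ) *
        ((ascPochhammer ℂ j).eval (-δ) / (j.factorial : ℂ)) / t ^ j

/-- The number of Taylor terms to subtract at `s = 0`; it is `0` exactly if `-1 < re α`, that is,
if `s ^ α` is integrable at `0`. -/
def order (α : ℂ) : ℕ := ⌊-α.re⌋₊

/-- The branch, for `(X, t)` near `(X₀, t₀)`, of the indefinite integral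
`∫₀ˣ s ^ α (1 - s) ^ β (t - s) ^ δ ds` along the given path. If the integral diverges at `s = 0`
it is understood as its Hadamard finite part (its analytic continuation in `α`,
`α ≠ -1, -2, …`): the finitely many divergent terms `cₙ s ^ (α + n)` of the expansion of the
integrand at `0` are subtracted and integrated by `∫₀ˣ s ^ (α + n) ds = X ^ (α + n + 1) / (α + n + 1)`.
For `-1 < re α` there are no such terms, see `indefInt_eq`. -/
def indefInt (α β δ X t : ℂ) : ℂ :=
  (∫ r in (0 : ℝ)..1,
      w.powS α X r *
        (w.powRest β δ X t r -
          ∑ n ∈ Finset.range (order α), w.coeff β δ t n * w.pathTo X r ^ n) *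
        (X / X₀ * deriv w.path r)) +
    ∑ n ∈ Finset.range (order α),
      w.coeff β δ t n * branchPow X₀ (w.logS 1) (α + n + 1) X / (α + n + 1)

theorem indefInt_eq {α : ℂ} (hα : -1 < α.re) (β δ X t : ℂ) :
    w.indefInt α β δ X t =
      ∫ r in (0 : ℝ)..1, w.powS α X r * w.powRest β δ X t r * (X / X₀ * deriv w.path r) := by
  have h : order α = 0 := Nat.floor_eq_zero.2 (by linarith)
  simp [indefInt, h]

end BranchedPath

/-- `f₁ = ∫₀ˣ s^(b'-a) (1-s)^(a-b-1) (XY-s)^(-b') ds`, as a function of `(x,y)` near `p`. -/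
def f₁ (a b b' : ℂ) {p : ℂ × ℂ} (w : BranchedPath (coordX p) (coordT p)) : ℂ × ℂ → ℂ := fun q =>
  w.indefInt (b' - a) (a - b - 1) (-b') (coordX q) (coordT q)

/-- `f₂ = (XY)^(1-a) ∫₀ˣ s^(b'-1) (1-s)^(-b) (XY-s)^(a-b'-1) ds`, as a function of `(x,y)` near `p`;
the branch of the first factor is given by a logarithm `ℓ` of `XY` at `p`. -/
def f₂ (a b b' : ℂ) {p : ℂ × ℂ} (ℓ : ℂ) (w : BranchedPath (coordX p) (coordT p)) :
    ℂ × ℂ → ℂ := fun q =>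
  branchPow (coordT p) ℓ (1 - a) (coordT q) *
    w.indefInt (b' - 1) (-b) (a - b' - 1) (coordX q) (coordT q)

/-- The branch near `p` of `(1-x)^b (1-y)^b'` given by logarithms of `1-x` and `1-y` at `p`. -/
def factor (b b' : ℂ) (p : ℂ × ℂ) (ℓx ℓy : ℂ) : ℂ × ℂ → ℂ := fun q =>
  branchPow (1 - p.1) ℓx b (1 - q.1) * branchPow (1 - p.2) ℓy b' (1 - q.2)

end AppellE2

end

open AppellE2

/-!
After multiplication by `(1-x)^b (1-y)^b'`, the system `E₂(a,b,b',a,a)` becomes, in the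
coordinates `X`, `Y` and with the Euler operators `θ = X ∂/∂X` and `θ' = Y ∂/∂Y`,

  `θ (θ + a - 1) u = X (θ - θ') (θ + b) u + XY (θ' + b') (θ + b) u`

together with the equation obtained by exchanging the two variables. The Euler operators of the
variables `(X, XY)` are `θ - θ'` and `θ'`, so the two systems `E₁` and the Gauss equation are
systems of the same kind, and the inclusions are identities between differential operators
(`EulerFrame.SysE1.sysE2`, `EulerFrame.SysGauss.sysE1`). All of this takes place in the
differential ring `AnGerm p` of germs of analytic functions (`mem_mulSolE2_iff`,
`mem_solE1_mapXT_iff`, `mem_solE1_mapTY_iff`, `mem_solGauss_iff`).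

The function `v = (θ - θ') u` decides which solutions `u` come from the Gauss equation: it
vanishes if and only if `u` depends on `XY` only. A common solution of both systems `E₁` satisfies
`(θ + a - 1) v = X (θ + b) v` and `θ v = X (θ + b) v`, hence `(a - 1) v = 0`
(`EulerFrame.SysE1.sysGauss`). For a solution `u` of `E₂` the difference of the two equations is
of first order in `v`, and a second order equation for `v` along `X` factors into two equations of
first order. Therefore, if `a ≠ 1`, `v` is a linear combination of

  `v₁ = X^(1-a) (1-X)^(a-b-1) (1-Y)^(-b')` and `v₂ = Y^(1-a) (1-X)^(-b) (1-Y)^(a-b'-1)`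

(`EulerFrame.SysE2.exists_coeff`). For the integrals `f₁` and `f₂`, the operator `θ - θ'` is the
derivation `X ∂/∂X` at constant `XY`, that is, the derivative with respect to the endpoint; up to
constants it takes the values `v₁` and `v₂`. Once `f₁` and `f₂` are known to be solutions, a
combination of them can be subtracted from `u` such that `v` becomes `0`, which leaves a solution
of the Gauss equation (`span_eq_sysE2Submodule`).

That `f₁` is a solution follows from contiguity and integration by parts (`sysE2_pullXT_intGerm`);
`f₂` is `(XY)^(1-a)` times the integral `f₁` for the parameters `2 - a`, `b + 1 - a`,
`b' + 1 - a`. The divergent integrals are treated by `BranchedPath.indefInt_by_parts`, integration by parts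
for the finite part, which expresses the integral with exponent `α` by integrals with exponent
`α + 1`: the formulas for derivatives and the contiguity relations are proved for `-1 < re α` by
differentiation under the integral sign and carried over to all `α ≠ -1, -2, …` by induction.
Analyticity in `(X, t)` is Osgood's lemma (`analyticAt_of_separately`).
-/

noncomputable section

namespace AppellE2

/-! ### The algebra of the systems in logarithmic coordinates -/

/-- Two commuting derivations `θ`, `θ'` of a `ℂ`-algebra together with coordinates `X`, `Y`, for
which they are the Euler operators `θ = X ∂/∂X` and `θ' = Y ∂/∂Y`. -/
structure EulerFrame (A : Type*) [CommRing A] [Algebra ℂ A] where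
  θ : Derivation ℂ A A
  θ' : Derivation ℂ A A
  X : A
  Y : A
  comm : ∀ z, θ (θ' z) = θ' (θ z)
  θ_X : θ X = X
  θ_Y : θ Y = 0
  θ'_X : θ' X = 0
  θ'_Y : θ' Y = Y
  isUnit_X : IsUnit X
  isUnit_Y : IsUnit Y
  isUnit_one_sub_X : IsUnit (1 - X)
  isUnit_one_sub_Y : IsUnit (1 - Y)

namespace EulerFrame

variable {A : Type*} [CommRing A] [Algebra ℂ A] (E : EulerFrame A)

/-- The frame with the roles of the two coordinates exchanged. -/
def swap : EulerFrame A where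
  θ := E.θ'
  θ' := E.θ
  X := E.Y
  Y := E.X
  comm z := (E.comm z).symm
  θ_X := E.θ'_Y
  θ_Y := E.θ'_X
  θ'_X := E.θ_Y
  θ'_Y := E.θ_X
  isUnit_X := E.isUnit_Y
  isUnit_Y := E.isUnit_X
  isUnit_one_sub_X := E.isUnit_one_sub_Y
  isUnit_one_sub_Y := E.isUnit_one_sub_X

local notation "κ" => algebraMap ℂ _

/-- The first equation of the system `E₂(a,b,b',a,a)`, for the unknown multiplied by
`(1 - x) ^ b (1 - y) ^ b'`, in the coordinates `X`, `Y`: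
`θ (θ + a - 1) u = X (θ - θ') (θ + b) u + X Y (θ' + b') (θ + b) u`. -/
def EqE2 (a b b' : ℂ) (u : A) : Prop :=
  E.θ (E.θ u + (κ a - 1) * u) =
    E.X * (E.θ (E.θ u + κ b * u) - E.θ' (E.θ u + κ b * u)) +
      E.X * E.Y * (E.θ' (E.θ u + κ b * u) + κ b' * (E.θ u + κ b * u))

/-- The system `E₂(a,b,b',a,a)`, for the unknown multiplied by `(1 - x) ^ b (1 - y) ^ b'`, in the
coordinates `X`, `Y`. -/
def SysE2 (a b b' : ℂ) (u : A) : Prop := E.EqE2 a b b' u ∧ E.swap.EqE2 a b' b u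

/-- The system `E₁(b,0,b',a)` in the variables `(X, XY)`, written with the Euler operators of
`X` and `Y`. The Euler operators of the variables `(X, XY)` are `θ - θ'` and `θ'`. -/
def SysE1 (a b b' : ℂ) (u : A) : Prop :=
  E.θ (E.θ u - E.θ' u) + (κ a - 1) * (E.θ u - E.θ' u) =
      E.X * (E.θ (E.θ u - E.θ' u) + κ b * (E.θ u - E.θ' u)) ∧
    E.θ' (E.θ u + (κ a - 1) * u) =
      E.X * E.Y * (E.θ (E.θ' u + κ b' * u) + κ b * (E.θ' u + κ b' * u)) ∧
    E.θ' (E.θ u - E.θ' u) = E.Y * (E.θ' (E.θ u - E.θ' u) + κ b' * (E.θ u - E.θ' u))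

/-- The Gauss equation `E(b,b',a)` in the variable `XY`, together with the condition
`θ u = θ' u` that `u` depends on `XY` only. -/
def SysGauss (a b b' : ℂ) (u : A) : Prop :=
  E.θ u = E.θ' u ∧
    E.θ' (E.θ' u + (κ a - 1) * u) =
      E.X * E.Y * (E.θ' (E.θ' u + κ b' * u) + κ b * (E.θ' u + κ b' * u))

variable {E} {a b b' : ℂ} {u : A}

theorem SysE2.swap (h : E.SysE2 a b b' u) : E.swap.SysE2 a b' b u := ⟨h.2, h.1⟩

theorem SysE1.sysE2 (h : E.SysE1 a b b' u) : E.SysE2 a b b' u := by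
  obtain ⟨h1, h2, h3⟩ := h
  refine ⟨?_, ?_⟩
  · simp only [EqE2]
    simp only [Derivation.map_algebraMap, map_add, map_sub, Derivation.leibniz, smul_eq_mul, E.comm,
      Derivation.map_one_eq_zero] at *
    linear_combination h1 + h2
  · simp only [EqE2, EulerFrame.swap]
    simp only [Derivation.map_algebraMap, map_add, map_sub, Derivation.leibniz, smul_eq_mul, E.comm,
      Derivation.map_one_eq_zero] at *
    linear_combination h2 - h3

theorem SysGauss.sysE1 (h : E.SysGauss a b b' u) : E.SysE1 a b b' u := by
  obtain ⟨h1, h2⟩ := h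
  have h0 : E.θ u - E.θ' u = 0 := sub_eq_zero.2 h1
  refine ⟨by simp [h0], ?_, by simp [h0]⟩
  simp only [Derivation.map_algebraMap, map_add, map_sub, Derivation.leibniz, smul_eq_mul, E.comm,
    Derivation.map_one_eq_zero, h1] at *
  linear_combination h2

theorem SysGauss.swap (h : E.SysGauss a b b' u) : E.swap.SysGauss a b' b u := by
  obtain ⟨h1, h2⟩ := h
  refine ⟨h1.symm, ?_⟩
  simp only [EulerFrame.swap]
  have h3 := E.comm u
  simp only [Derivation.map_algebraMap, map_add, map_sub, Derivation.leibniz, smul_eq_mul, E.comm,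
    Derivation.map_one_eq_zero, h1] at *
  linear_combination h2

theorem SysE2.sysGauss (h : E.SysE2 a b b' u) (h1 : E.θ u = E.θ' u) : E.SysGauss a b b' u := by
  obtain ⟨-, h2⟩ := h
  refine ⟨h1, ?_⟩
  simp only [EqE2, EulerFrame.swap] at h2
  simp only [Derivation.map_algebraMap, map_add, map_sub, Derivation.leibniz, smul_eq_mul, E.comm,
    Derivation.map_one_eq_zero, h1] at *
  linear_combination h2

/-- For `v = (θ - θ') u` the first system gives `(θ + a - 1) v = X (θ + b) v` and the second one
`θ v = X (θ + b) v`, so that `(a - 1) v = 0`. -/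
theorem SysE1.sysGauss (ha : a ≠ 1) (h : E.SysE1 a b b' u) (h' : E.swap.SysE1 a b' b u) :
    E.SysGauss a b b' u := by
  refine h.sysE2.sysGauss ?_
  obtain ⟨h1, -, -⟩ := h
  obtain ⟨-, -, h3⟩ := h'
  simp only [EulerFrame.swap] at h3
  have hu : IsUnit (κ (a - 1) : A) := (isUnit_iff_ne_zero.2 (sub_ne_zero.2 ha)).map _
  rw [← sub_eq_zero, ← hu.mul_right_eq_zero]
  simp only [map_sub, map_one] at *
  linear_combination h1 + h3

/-- If `v = (θ - θ') u`, the difference of the two equations of the system. -/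
theorem SysE2.first_order (h : E.SysE2 a b b' u) {v : A} (hv : v = E.θ u - E.θ' u) :
    E.θ v + E.θ' v + (κ a - 1) * v = E.X * (E.θ v + κ b * v) + E.Y * (E.θ' v + κ b' * v) := by
  obtain ⟨h1, h2⟩ := h
  subst hv
  simp only [EqE2, EulerFrame.swap] at *
  simp only [Derivation.map_algebraMap, map_add, map_sub, Derivation.leibniz, smul_eq_mul, E.comm,
    Derivation.map_one_eq_zero] at *
  linear_combination h1 - h2

/-- The converse of `SysE2.first_order`: the difference of the two equations and the second one
imply the first one. -/
theorem SysE2.of_first_order (h : E.swap.EqE2 a b' b u) {v : A} (hv : v = E.θ u - E.θ' u)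
    (hfo : E.θ v + E.θ' v + (κ a - 1) * v =
      E.X * (E.θ v + κ b * v) + E.Y * (E.θ' v + κ b' * v)) : E.SysE2 a b b' u := by
  refine ⟨?_, h⟩
  subst hv
  simp only [EqE2, EulerFrame.swap] at *
  simp only [Derivation.map_algebraMap, map_add, map_sub, Derivation.leibniz, smul_eq_mul, E.comm,
    Derivation.map_one_eq_zero] at *
  linear_combination h + hfo

/-- Multiplication by a power `(XY) ^ (1 - a)` shifts the parameters of the system. -/
theorem EqE2.mul {m : A} (hm : E.θ m = κ (1 - a) * m) (hm' : E.θ' m = κ (1 - a) * m)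
    (h : E.EqE2 (2 - a) (b + 1 - a) (b' + 1 - a) u) : E.EqE2 a b b' (m * u) := by
  have h2 : (κ (2 : ℂ) : A) = 2 := map_ofNat _ 2
  have h3 : E.θ (2 : A) = 0 := by rw [← h2]; exact E.θ.map_algebraMap _
  simp only [EqE2] at h ⊢
  simp only [Derivation.map_algebraMap, map_add, map_sub, Derivation.leibniz, smul_eq_mul,
    Derivation.map_one_eq_zero, hm, hm', map_one, h2, h3] at h ⊢
  linear_combination m * h

theorem SysE2.mul {m : A} (hm : E.θ m = κ (1 - a) * m) (hm' : E.θ' m = κ (1 - a) * m)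
    (h : E.SysE2 (2 - a) (b + 1 - a) (b' + 1 - a) u) : E.SysE2 a b b' (m * u) :=
  ⟨EqE2.mul hm hm' h.1, EqE2.mul (E := E.swap) hm' hm h.2⟩

theorem EqE2.add_smul {v : A} (c : ℂ) (hu : E.EqE2 a b b' u) (hv : E.EqE2 a b b' v) :
    E.EqE2 a b b' (u + κ c * v) := by
  simp only [EqE2] at *
  simp only [Derivation.map_algebraMap, map_add, map_sub, Derivation.leibniz, smul_eq_mul,
    Derivation.map_one_eq_zero, map_zero] at *
  linear_combination hu + κ c * hv

theorem SysE2.add_smul {v : A} (c : ℂ) (hu : E.SysE2 a b b' u) (hv : E.SysE2 a b b' v) :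
    E.SysE2 a b b' (u + κ c * v) :=
  ⟨hu.1.add_smul c hv.1, hu.2.add_smul c hv.2⟩

theorem SysE2.zero : E.SysE2 a b b' 0 := by
  simp [SysE2, EqE2]

/-- With `D = (1 - X) θ`, the function `v = (θ - θ') u` satisfies
`(D - b X) (D - (1 - a) - b X) v = 0`. Applying `θ - θ'` to the first equation of the system gives
a second order equation for `v`, from which the derivative `θ' v` is eliminated by
`SysE2.first_order`. -/
theorem SysE2.second_order (h : E.SysE2 a b b' u) {v k : A} (hv : v = E.θ u - E.θ' u)
    (hk : k = (1 - E.X) * E.θ v - (1 - κ a + κ b * E.X) * v) :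
    (1 - E.X) * E.θ k = κ b * E.X * k := by
  have h1 := h.first_order hv
  have h2 := congrArg E.θ h1
  have h3 := congrArg (fun z => E.θ z - E.θ' z) h.1
  subst hk hv
  simp only [Derivation.map_algebraMap, map_add, map_sub, Derivation.leibniz, smul_eq_mul, E.comm,
    Derivation.map_one_eq_zero, map_zero, E.θ_X, E.θ_Y, E.θ'_X, E.θ'_Y] at *
  linear_combination h3 - E.X * h2 - E.X * κ b * h1

/-- `v = (θ - θ') u` is, up to the factor `1 - a`, a combination of `v₁` and `v₂`, which satisfy the
first order equations of the two systems `E₁`. The coefficients are killed by both derivations. -/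
theorem SysE2.exists_coeff (h : E.SysE2 a b b' u) {v₁ v₂ : A} (hu₁ : IsUnit v₁) (hu₂ : IsUnit v₂)
    (h₁ : (1 - E.X) * E.θ v₁ = (1 - κ a + κ b * E.X) * v₁)
    (h₁' : (1 - E.Y) * E.θ' v₁ = κ b' * E.Y * v₁)
    (h₂ : (1 - E.X) * E.θ v₂ = κ b * E.X * v₂)
    (h₂' : (1 - E.Y) * E.θ' v₂ = (1 - κ a + κ b' * E.Y) * v₂) :
    ∃ c₁ c₂ : A, (E.θ c₁ = 0 ∧ E.θ' c₁ = 0) ∧ (E.θ c₂ = 0 ∧ E.θ' c₂ = 0) ∧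
      (1 - κ a) * (E.θ u - E.θ' u) = c₁ * v₁ + c₂ * v₂ := by
  -- a quotient of two solutions of the same first order equations is constant
  have key : ∀ (w v P Q : A), IsUnit v → (1 - E.X) * E.θ w = P * w → (1 - E.X) * E.θ v = P * v →
      (1 - E.Y) * E.θ' w = Q * w → (1 - E.Y) * E.θ' v = Q * v →
      ∃ c, (E.θ c = 0 ∧ E.θ' c = 0) ∧ w = c * v := by
    rintro w _ P Q ⟨v, rfl⟩ hw hv hw' hv'
    set i : A := (↑v⁻¹ : A) with hi
    have hiv : i * v = 1 := v.inv_mul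
    refine ⟨w * i, ⟨?_, ?_⟩, by rw [mul_assoc, hiv, mul_one]⟩
    · have h0 := congrArg E.θ hiv
      simp only [Derivation.leibniz, smul_eq_mul, Derivation.map_one_eq_zero] at h0 ⊢
      rw [← E.isUnit_one_sub_X.mul_right_eq_zero, ← v.isUnit.mul_right_eq_zero]
      linear_combination w * (1 - E.X) * h0 + i * v * hw - i * w * hv
    · have h0 := congrArg E.θ' hiv
      simp only [Derivation.leibniz, smul_eq_mul, Derivation.map_one_eq_zero] at h0 ⊢
      rw [← E.isUnit_one_sub_Y.mul_right_eq_zero, ← v.isUnit.mul_right_eq_zero]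
      linear_combination w * (1 - E.Y) * h0 + i * v * hw' - i * w * hv'
  -- `k` satisfies the equations of `v₂`, and `k + (1 - a) v` those of `v₁`
  obtain ⟨v, hv⟩ : ∃ v, v = E.θ u - E.θ' u := ⟨_, rfl⟩
  obtain ⟨k, hk⟩ : ∃ k, k = (1 - E.X) * E.θ v - (1 - κ a + κ b * E.X) * v := ⟨_, rfl⟩
  have hfo := h.first_order hv
  have hso := h.second_order hv hk
  have hk' : k = -((1 - E.Y) * E.θ' v - κ b' * E.Y * v) := by
    rw [hk]; linear_combination hfo
  have hso' : (1 - E.Y) * E.θ' k = (1 - κ a + κ b' * E.Y) * k := by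
    have h4 := congrArg E.θ hk'
    have h5 := congrArg E.θ' hk
    simp only [Derivation.map_algebraMap, map_add, map_sub, Derivation.leibniz, smul_eq_mul, E.comm,
      Derivation.map_one_eq_zero, E.θ_Y, E.θ'_X, map_neg] at *
    linear_combination (1 - E.Y) * h5 + (1 - E.X) * h4 - hso
      - (κ b' * E.Y) * hk - (1 - κ a + κ b * E.X) * hk'
  obtain ⟨c₂, hc₂, hkc⟩ := key k v₂ _ _ hu₂ hso h₂ hso' h₂'
  have hl : (1 - E.X) * E.θ (k + (1 - κ a) * v) =
      (1 - κ a + κ b * E.X) * (k + (1 - κ a) * v) := by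
    simp only [Derivation.map_algebraMap, map_add, map_sub, Derivation.leibniz, smul_eq_mul,
      Derivation.map_one_eq_zero]
    linear_combination hso - (1 - κ a) * hk
  have hl' : (1 - E.Y) * E.θ' (k + (1 - κ a) * v) = κ b' * E.Y * (k + (1 - κ a) * v) := by
    simp only [Derivation.map_algebraMap, map_add, map_sub, Derivation.leibniz, smul_eq_mul,
      Derivation.map_one_eq_zero]
    linear_combination hso' + (1 - κ a) * hk'
  obtain ⟨c₁, hc₁, hlc⟩ := key _ v₁ _ _ hu₁ hl h₁ hl' h₁'
  refine ⟨c₁, -c₂, hc₁, ⟨by simp [hc₂.1], by simp [hc₂.2]⟩, ?_⟩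
  rw [← hv, neg_mul, ← hkc, ← hlc]
  ring

end EulerFrame

/-! ### The differential ring of germs of analytic functions -/

section Germs

variable {p : ℂ × ℂ}

theorem dx_eq_fderiv {z : ℂ × ℂ → ℂ} {q : ℂ × ℂ} (hz : DifferentiableAt ℂ z q) :
    dx z q = fderiv ℂ z q (1, 0) := by
  have h : HasDerivAt (fun x : ℂ => (x, q.2)) ((1 : ℂ), (0 : ℂ)) q.1 :=
    (hasDerivAt_id q.1).prodMk (hasDerivAt_const _ _)
  exact (hz.hasFDerivAt.comp_hasDerivAt q.1 h).deriv

theorem dy_eq_fderiv {z : ℂ × ℂ → ℂ} {q : ℂ × ℂ} (hz : DifferentiableAt ℂ z q) :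
    dy z q = fderiv ℂ z q (0, 1) := by
  have h : HasDerivAt (fun y : ℂ => (q.1, y)) ((0 : ℂ), (1 : ℂ)) q.2 :=
    (hasDerivAt_const _ _).prodMk (hasDerivAt_id q.2)
  exact (hz.hasFDerivAt.comp_hasDerivAt q.2 h).deriv

theorem dx_congr {f g : ℂ × ℂ → ℂ} (h : f =ᶠ[𝓝 p] g) : dx f =ᶠ[𝓝 p] dx g := by
  filter_upwards [h.eventually_nhds] with q hq
  have hc : ContinuousAt (fun x : ℂ => (x, q.2)) q.1 := by fun_prop
  exact EventuallyEq.deriv_eq (hc.eventually hq)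

theorem dy_congr {f g : ℂ × ℂ → ℂ} (h : f =ᶠ[𝓝 p] g) : dy f =ᶠ[𝓝 p] dy g := by
  filter_upwards [h.eventually_nhds] with q hq
  have hc : ContinuousAt (fun y : ℂ => (q.1, y)) q.2 := by fun_prop
  exact EventuallyEq.deriv_eq (hc.eventually hq)

theorem eventually_differentiableAt {z : ℂ × ℂ → ℂ} (hz : AnalyticAt ℂ z p) :
    ∀ᶠ q in 𝓝 p, DifferentiableAt ℂ z q :=
  hz.eventually_analyticAt.mono fun _ h => h.differentiableAt

theorem eventually_dx_eq {z : ℂ × ℂ → ℂ} (hz : AnalyticAt ℂ z p) :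
    dx z =ᶠ[𝓝 p] fun q => fderiv ℂ z q (1, 0) :=
  (eventually_differentiableAt hz).mono fun _ h => dx_eq_fderiv h

theorem eventually_dy_eq {z : ℂ × ℂ → ℂ} (hz : AnalyticAt ℂ z p) :
    dy z =ᶠ[𝓝 p] fun q => fderiv ℂ z q (0, 1) :=
  (eventually_differentiableAt hz).mono fun _ h => dy_eq_fderiv h

theorem analyticAt_dx {z : ℂ × ℂ → ℂ} (hz : AnalyticAt ℂ z p) : AnalyticAt ℂ (dx z) p :=
  (((ContinuousLinearMap.apply ℂ ℂ ((1, 0) : ℂ × ℂ)).analyticAt _).comp hz.fderiv).congr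
    (eventually_dx_eq hz).symm

theorem analyticAt_dy {z : ℂ × ℂ → ℂ} (hz : AnalyticAt ℂ z p) : AnalyticAt ℂ (dy z) p :=
  (((ContinuousLinearMap.apply ℂ ℂ ((0, 1) : ℂ × ℂ)).analyticAt _).comp hz.fderiv).congr
    (eventually_dy_eq hz).symm

theorem dx_dy_eq {z : ℂ × ℂ → ℂ} (hz : AnalyticAt ℂ z p) : dx (dy z) =ᶠ[𝓝 p] dy (dx z) := by
  have hx : ∀ v : ℂ × ℂ, ∀ᶠ q in 𝓝 p, ∀ w,
      fderiv ℂ (fun q => fderiv ℂ z q v) q w = fderiv ℂ (fderiv ℂ z) q w v := by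
    intro v
    filter_upwards [hz.fderiv.eventually_analyticAt] with q hq w
    exact congrArg (fun L : ℂ × ℂ →L[ℂ] ℂ => L w)
      (((ContinuousLinearMap.apply ℂ ℂ v).hasFDerivAt.comp q
        hq.differentiableAt.hasFDerivAt).fderiv)
  filter_upwards [dx_congr (eventually_dy_eq hz), dy_congr (eventually_dx_eq hz), hx (1, 0),
    hx (0, 1), hz.eventually_analyticAt,
    eventually_dx_eq (((ContinuousLinearMap.apply ℂ ℂ ((0, 1) : ℂ × ℂ)).analyticAt _).comp
      hz.fderiv),
    eventually_dy_eq (((ContinuousLinearMap.apply ℂ ℂ ((1, 0) : ℂ × ℂ)).analyticAt _).comp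
      hz.fderiv)] with q h1 h2 h3 h4 h5 h6 h7
  rw [h1, h2]
  refine h6.trans (Eq.trans ?_ h7.symm)
  refine (h4 _).trans (Eq.trans ?_ (h3 _).symm)
  exact (h5.contDiffAt (n := 2)).isSymmSndFDerivAt (by simp) _ _

/-- Germs of complex-valued functions form a `ℂ`-algebra. -/
@[reducible] def germAlgebra {α : Type*} (l : Filter α) : Algebra ℂ (Germ l ℂ) where
  algebraMap :=
    { toFun := fun c => ((fun _ => c : α → ℂ) : Germ l ℂ)
      map_one' := rfl
      map_mul' := fun _ _ => rfl
      map_zero' := rfl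
      map_add' := fun _ _ => rfl }
  commutes' _ _ := mul_comm _ _
  smul_def' c g := by
    induction g using Germ.inductionOn
    rfl

attribute [local instance] germAlgebra

/-- The algebra of germs at `p` of analytic functions. -/
def AnGerm (p : ℂ × ℂ) : Subalgebra ℂ (Germ (𝓝 p) ℂ) where
  carrier := {g | ∃ f : ℂ × ℂ → ℂ, AnalyticAt ℂ f p ∧ (f : Germ (𝓝 p) ℂ) = g}
  mul_mem' := by
    rintro _ _ ⟨f, hf, rfl⟩ ⟨g, hg, rfl⟩
    exact ⟨f * g, hf.mul hg, rfl⟩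
  add_mem' := by
    rintro _ _ ⟨f, hf, rfl⟩ ⟨g, hg, rfl⟩
    exact ⟨f + g, hf.add hg, rfl⟩
  algebraMap_mem' c := ⟨fun _ => c, analyticAt_const, rfl⟩

namespace AnGerm

/-- The germ of an analytic function. -/
def of (f : ℂ × ℂ → ℂ) (hf : AnalyticAt ℂ f p) : AnGerm p := ⟨(f : Germ (𝓝 p) ℂ), f, hf, rfl⟩

theorem isUnit_of {f : ℂ × ℂ → ℂ} {hf : AnalyticAt ℂ f p} (h : f p ≠ 0) : IsUnit (of f hf) := by
  refine IsUnit.of_mul_eq_one (of f⁻¹ (hf.inv h)) (Subtype.ext (Germ.coe_eq.2 ?_ :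
    ((f * f⁻¹ : ℂ × ℂ → ℂ) : Germ (𝓝 p) ℂ) = ((1 : ℂ × ℂ → ℂ) : Germ (𝓝 p) ℂ)))
  filter_upwards [hf.continuousAt.eventually_ne h] with q hq
  exact mul_inv_cancel₀ hq

/-- `∂/∂x` on germs. -/
def dxGerm (g : Germ (𝓝 p) ℂ) : Germ (𝓝 p) ℂ := Germ.map' dx (fun _ _ h => dx_congr h) g

/-- `∂/∂y` on germs. -/
def dyGerm (g : Germ (𝓝 p) ℂ) : Germ (𝓝 p) ℂ := Germ.map' dy (fun _ _ h => dy_congr h) g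

theorem dx_add {f g : ℂ × ℂ → ℂ} (hf : AnalyticAt ℂ f p) (hg : AnalyticAt ℂ g p) :
    dx (f + g) =ᶠ[𝓝 p] dx f + dx g := by
  filter_upwards [eventually_differentiableAt hf, eventually_differentiableAt hg] with q h1 h2
  simp [dx_eq_fderiv (h1.add h2), dx_eq_fderiv h1, dx_eq_fderiv h2, fderiv_add h1 h2]

theorem dy_add {f g : ℂ × ℂ → ℂ} (hf : AnalyticAt ℂ f p) (hg : AnalyticAt ℂ g p) :
    dy (f + g) =ᶠ[𝓝 p] dy f + dy g := by
  filter_upwards [eventually_differentiableAt hf, eventually_differentiableAt hg] with q h1 h2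
  simp [dy_eq_fderiv (h1.add h2), dy_eq_fderiv h1, dy_eq_fderiv h2, fderiv_add h1 h2]

theorem dx_mul {f g : ℂ × ℂ → ℂ} (hf : AnalyticAt ℂ f p) (hg : AnalyticAt ℂ g p) :
    dx (f * g) =ᶠ[𝓝 p] f * dx g + g * dx f := by
  filter_upwards [eventually_differentiableAt hf, eventually_differentiableAt hg] with q h1 h2
  simp [dx_eq_fderiv (h1.mul h2), dx_eq_fderiv h1, dx_eq_fderiv h2, fderiv_mul h1 h2]

theorem dy_mul {f g : ℂ × ℂ → ℂ} (hf : AnalyticAt ℂ f p) (hg : AnalyticAt ℂ g p) :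
    dy (f * g) =ᶠ[𝓝 p] f * dy g + g * dy f := by
  filter_upwards [eventually_differentiableAt hf, eventually_differentiableAt hg] with q h1 h2
  simp [dy_eq_fderiv (h1.mul h2), dy_eq_fderiv h1, dy_eq_fderiv h2, fderiv_mul h1 h2]

theorem dxGerm_mem (z : AnGerm p) : dxGerm (z : Germ (𝓝 p) ℂ) ∈ AnGerm p := by
  obtain ⟨_, f, hf, rfl⟩ := z
  exact ⟨dx f, analyticAt_dx hf, rfl⟩

theorem dyGerm_mem (z : AnGerm p) : dyGerm (z : Germ (𝓝 p) ℂ) ∈ AnGerm p := by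
  obtain ⟨_, f, hf, rfl⟩ := z
  exact ⟨dy f, analyticAt_dy hf, rfl⟩

theorem dx_const_smul (c : ℂ) (f : ℂ × ℂ → ℂ) : dx (c • f) = c • dx f := by
  ext q
  exact deriv_const_mul_field c

theorem dy_const_smul (c : ℂ) (f : ℂ × ℂ → ℂ) : dy (c • f) = c • dy f := by
  ext q
  exact deriv_const_mul_field c

variable (p) in
/-- `∂/∂x` as a derivation of the algebra of analytic germs. -/
def Dx : Derivation ℂ (AnGerm p) (AnGerm p) :=
  Derivation.mk'
    { toFun := fun z => ⟨dxGerm z, dxGerm_mem z⟩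
      map_add' := fun z w => by
        obtain ⟨_, f, hf, rfl⟩ := z
        obtain ⟨_, g, hg, rfl⟩ := w
        exact Subtype.ext (Germ.coe_eq.2 (dx_add hf hg))
      map_smul' := fun c z => by
        obtain ⟨_, f, hf, rfl⟩ := z
        exact Subtype.ext (Germ.coe_eq.2 (dx_const_smul c f).eventuallyEq) }
    fun z w => by
      obtain ⟨_, f, hf, rfl⟩ := z
      obtain ⟨_, g, hg, rfl⟩ := w
      exact Subtype.ext (Germ.coe_eq.2 (dx_mul hf hg))

variable (p) in
/-- `∂/∂y` as a derivation of the algebra of analytic germs. -/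
def Dy : Derivation ℂ (AnGerm p) (AnGerm p) :=
  Derivation.mk'
    { toFun := fun z => ⟨dyGerm z, dyGerm_mem z⟩
      map_add' := fun z w => by
        obtain ⟨_, f, hf, rfl⟩ := z
        obtain ⟨_, g, hg, rfl⟩ := w
        exact Subtype.ext (Germ.coe_eq.2 (dy_add hf hg))
      map_smul' := fun c z => by
        obtain ⟨_, f, hf, rfl⟩ := z
        exact Subtype.ext (Germ.coe_eq.2 (dy_const_smul c f).eventuallyEq) }
    fun z w => by
      obtain ⟨_, f, hf, rfl⟩ := z
      obtain ⟨_, g, hg, rfl⟩ := w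
      exact Subtype.ext (Germ.coe_eq.2 (dy_mul hf hg))

theorem Dx_Dy (z : AnGerm p) : Dx p (Dy p z) = Dy p (Dx p z) := by
  obtain ⟨_, f, hf, rfl⟩ := z
  exact Subtype.ext (Germ.coe_eq.2 (dx_dy_eq hf))

variable (p) in
/-- The germ of the coordinate `x`. -/
def x : AnGerm p := of Prod.fst analyticAt_fst

variable (p) in
/-- The germ of the coordinate `y`. -/
def y : AnGerm p := of Prod.snd analyticAt_snd

theorem Dx_x : Dx p (x p) = 1 :=
  Subtype.ext (Germ.coe_eq.2 (Eventually.of_forall fun q => deriv_id q.1 : dx Prod.fst =ᶠ[𝓝 p] 1))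

theorem Dy_x : Dy p (x p) = 0 :=
  Subtype.ext (Germ.coe_eq.2
    (Eventually.of_forall fun q => deriv_const q.2 q.1 : dy Prod.fst =ᶠ[𝓝 p] 0))

theorem Dx_y : Dx p (y p) = 0 :=
  Subtype.ext (Germ.coe_eq.2
    (Eventually.of_forall fun q => deriv_const q.1 q.2 : dx Prod.snd =ᶠ[𝓝 p] 0))

theorem Dy_y : Dy p (y p) = 1 :=
  Subtype.ext (Germ.coe_eq.2 (Eventually.of_forall fun q => deriv_id q.2 : dy Prod.snd =ᶠ[𝓝 p] 1))

theorem isUnit_x (h : p.1 ≠ 0) : IsUnit (x p) := isUnit_of h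

theorem isUnit_y (h : p.2 ≠ 0) : IsUnit (y p) := isUnit_of h

/-- A germ with vanishing partial derivatives is constant. -/
theorem eq_algebraMap_of_Dx_Dy {z : AnGerm p} (hx : Dx p z = 0) (hy : Dy p z = 0) :
    ∃ c : ℂ, z = algebraMap ℂ _ c := by
  obtain ⟨_, f, hf, rfl⟩ := z
  have hx' : dx f =ᶠ[𝓝 p] 0 := Germ.coe_eq.1 (congrArg Subtype.val hx)
  have hy' : dy f =ᶠ[𝓝 p] 0 := Germ.coe_eq.1 (congrArg Subtype.val hy)
  have h : ∀ᶠ q in 𝓝 p, DifferentiableAt ℂ f q ∧ fderiv ℂ f q = 0 := by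
    filter_upwards [hx', hy', eventually_differentiableAt hf] with q h1 h2 h3
    refine ⟨h3, ?_⟩
    rw [dx_eq_fderiv h3] at h1
    rw [dy_eq_fderiv h3] at h2
    ext
    · simpa using h1
    · simpa using h2
  obtain ⟨ε, hε, hb⟩ := Metric.eventually_nhds_iff_ball.1 h
  refine ⟨f p, Subtype.ext (Germ.coe_eq.2 ?_)⟩
  filter_upwards [Metric.ball_mem_nhds p hε] with q hq
  exact (convex_ball p ε).is_const_of_fderivWithin_eq_zero
    (fun r hr => (hb r hr).1.differentiableWithinAt)
    (fun r hr => by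
      rw [fderivWithin_of_isOpen Metric.isOpen_ball hr]; exact (hb r hr).2)
    hq (Metric.mem_ball_self hε)

/-- Composition of germs with an analytic map. -/
def pull {φ : ℂ × ℂ → ℂ × ℂ} (hφ : AnalyticAt ℂ φ p) : AnGerm (φ p) →ₐ[ℂ] AnGerm p where
  toFun z := ⟨(z : Germ (𝓝 (φ p)) ℂ).compTendsto φ hφ.continuousAt, by
    obtain ⟨_, f, hf, rfl⟩ := z
    exact ⟨f ∘ φ, hf.comp hφ, rfl⟩⟩
  map_one' := rfl
  map_zero' := rfl
  map_mul' z w := by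
    obtain ⟨_, f, hf, rfl⟩ := z
    obtain ⟨_, g, hg, rfl⟩ := w
    rfl
  map_add' z w := by
    obtain ⟨_, f, hf, rfl⟩ := z
    obtain ⟨_, g, hg, rfl⟩ := w
    rfl
  commutes' _ := rfl

section pull

variable {φ : ℂ × ℂ → ℂ × ℂ} (hφ : AnalyticAt ℂ φ p)

theorem Dx_pull (z : AnGerm (φ p)) :
    Dx p (pull hφ z) = pull hφ (Dx _ z) * Dx p (pull hφ (x _)) +
      pull hφ (Dy _ z) * Dx p (pull hφ (y _)) := by
  obtain ⟨_, f, hf, rfl⟩ := z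
  refine Subtype.ext (Germ.coe_eq.2 ?_ :
    ((dx (f ∘ φ) : ℂ × ℂ → ℂ) : Germ (𝓝 p) ℂ) =
      ((fun q => dx f (φ q) * dx (Prod.fst ∘ φ) q + dy f (φ q) * dx (Prod.snd ∘ φ) q :
        ℂ × ℂ → ℂ) : Germ (𝓝 p) ℂ))
  filter_upwards [hφ.eventually_analyticAt,
    hφ.continuousAt.eventually (eventually_differentiableAt hf)] with q h1 h2
  have h1 := h1.differentiableAt
  rw [dx_eq_fderiv (h2.comp q h1), dx_eq_fderiv h2, dy_eq_fderiv h2, fderiv_comp q h2 h1,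
    dx_eq_fderiv (differentiableAt_fst.comp q h1), dx_eq_fderiv (differentiableAt_snd.comp q h1),
    fderiv_comp q differentiableAt_fst h1, fderiv_comp q differentiableAt_snd h1, fderiv_fst,
    fderiv_snd]
  set v := fderiv ℂ φ q (1, 0) with hv
  have : v = v.1 • ((1, 0) : ℂ × ℂ) + v.2 • ((0, 1) : ℂ × ℂ) := by ext <;> simp
  simp only [ContinuousLinearMap.comp_apply, ← hv]
  conv_lhs => rw [this, map_add, map_smul, map_smul]
  simp only [smul_eq_mul, ContinuousLinearMap.coe_fst', ContinuousLinearMap.coe_snd']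
  ring

theorem Dy_pull (z : AnGerm (φ p)) :
    Dy p (pull hφ z) = pull hφ (Dx _ z) * Dy p (pull hφ (x _)) +
      pull hφ (Dy _ z) * Dy p (pull hφ (y _)) := by
  obtain ⟨_, f, hf, rfl⟩ := z
  refine Subtype.ext (Germ.coe_eq.2 ?_ :
    ((dy (f ∘ φ) : ℂ × ℂ → ℂ) : Germ (𝓝 p) ℂ) =
      ((fun q => dx f (φ q) * dy (Prod.fst ∘ φ) q + dy f (φ q) * dy (Prod.snd ∘ φ) q :
        ℂ × ℂ → ℂ) : Germ (𝓝 p) ℂ))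
  filter_upwards [hφ.eventually_analyticAt,
    hφ.continuousAt.eventually (eventually_differentiableAt hf)] with q h1 h2
  have h1 := h1.differentiableAt
  rw [dy_eq_fderiv (h2.comp q h1), dx_eq_fderiv h2, dy_eq_fderiv h2, fderiv_comp q h2 h1,
    dy_eq_fderiv (differentiableAt_fst.comp q h1), dy_eq_fderiv (differentiableAt_snd.comp q h1),
    fderiv_comp q differentiableAt_fst h1, fderiv_comp q differentiableAt_snd h1, fderiv_fst,
    fderiv_snd]
  set v := fderiv ℂ φ q (0, 1) with hv
  have : v = v.1 • ((1, 0) : ℂ × ℂ) + v.2 • ((0, 1) : ℂ × ℂ) := by ext <;> simp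
  simp only [ContinuousLinearMap.comp_apply, ← hv]
  conv_lhs => rw [this, map_add, map_smul, map_smul]
  simp only [smul_eq_mul, ContinuousLinearMap.coe_fst', ContinuousLinearMap.coe_snd']
  ring

/-- Composition with a local isomorphism is bijective on germs. -/
theorem pull_bijective {ψ : ℂ × ℂ → ℂ × ℂ} (hψ : AnalyticAt ℂ ψ (φ p)) (hp : ψ (φ p) = p)
    (h1 : ∀ᶠ q in 𝓝 p, ψ (φ q) = q) (h2 : ∀ᶠ r in 𝓝 (φ p), φ (ψ r) = r) :
    Function.Bijective (pull hφ) := by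
  constructor
  · rw [injective_iff_map_eq_zero]
    intro z hz
    obtain ⟨_, f, hf, rfl⟩ := z
    have h0 : f ∘ φ =ᶠ[𝓝 p] 0 := Germ.coe_eq.1 (congrArg Subtype.val hz)
    have hc : Tendsto ψ (𝓝 (φ p)) (𝓝 p) := by simpa [ContinuousAt, hp] using hψ.continuousAt
    refine Subtype.ext (Germ.coe_eq.2 ?_ : (f : Germ (𝓝 (φ p)) ℂ) = ((0 : ℂ × ℂ → ℂ) : Germ _ ℂ))
    filter_upwards [hc.eventually h0, h2] with r h3 h4
    simpa [h4] using h3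
  · intro z
    obtain ⟨_, f, hf, rfl⟩ := z
    refine ⟨of (f ∘ ψ) ((by rwa [hp] : AnalyticAt ℂ f (ψ (φ p))).comp hψ), ?_⟩
    refine Subtype.ext (Germ.coe_eq.2 ?_ :
      ((f ∘ ψ ∘ φ : ℂ × ℂ → ℂ) : Germ (𝓝 p) ℂ) = (f : Germ (𝓝 p) ℂ))
    filter_upwards [h1] with q hq
    simp [hq]

end pull

end AnGerm

end Germs

/-! ### The systems as conditions on germs -/

section Systems

local notation "κ" => algebraMap ℂ _

attribute [local instance] germAlgebra

open AnGerm

/-- Conjugation of the first operator of `E₂(a,b,b',a,a)` by the factor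
`n = (1-x)^(-b) (1-y)^(-b')`. Here `(1 - X) θ = x ∂/∂x` and `(1 - Y) θ' = y ∂/∂y`. -/
theorem EulerFrame.conj {A : Type*} [CommRing A] [Algebra ℂ A] (E : EulerFrame A) (a b b' : ℂ)
    {n x : A} (hn : (1 - E.X) * E.θ n = -(κ b * E.X * n))
    (hn' : (1 - E.Y) * E.θ' n = -(κ b' * E.Y * n)) (hx : x * (1 - E.X) = -E.X) (u : A) {w : A}
    (hw : w = κ b * (n * u) + (1 - E.X) * E.θ (n * u)) :
    (1 - E.X) * E.θ (κ (a - 1) * (n * u) + (1 - E.X) * E.θ (n * u)) -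
        x * (κ a * w + (1 - E.X) * E.θ w + (1 - E.Y) * E.θ' w) =
      n * (E.θ (E.θ u + (κ a - 1) * u) - (E.X * (E.θ (E.θ u + κ b * u) - E.θ' (E.θ u + κ b * u)) +
      E.X * E.Y * (E.θ' (E.θ u + κ b * u) + κ b' * (E.θ u + κ b * u)))) := by
  have h1 : ∀ g, (1 - E.X) * E.θ (n * g) = n * ((1 - E.X) * E.θ g - κ b * E.X * g) := by
    intro g
    rw [Derivation.leibniz, smul_eq_mul, smul_eq_mul]
    linear_combination g * hn
  have h2 : ∀ g, (1 - E.Y) * E.θ' (n * g) = n * ((1 - E.Y) * E.θ' g - κ b' * E.Y * g) := by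
    intro g
    rw [Derivation.leibniz, smul_eq_mul, smul_eq_mul]
    linear_combination g * hn'
  have hw' : w = n * ((1 - E.X) * (E.θ u + κ b * u)) := by
    rw [hw, h1]; ring
  have h3 : κ (a - 1) * (n * u) + (1 - E.X) * E.θ (n * u) =
      n * (κ (a - 1) * u + ((1 - E.X) * E.θ u - κ b * E.X * u)) := by
    rw [h1]; ring
  rw [h3, hw', h1, h1, h2]
  simp only [Derivation.map_algebraMap, map_add, map_sub, map_one, Derivation.leibniz, smul_eq_mul,
    Derivation.map_one_eq_zero, E.θ_X, E.θ'_X]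
  linear_combination (-n * (κ a * (E.θ u + κ b * u)
    + ((1 - E.X) * (E.θ (E.θ u) + κ b * E.θ u) - κ b * E.X * (E.θ u + κ b * u)
    - E.X * (E.θ u + κ b * u)) + (1 - E.Y) * (E.θ' (E.θ u) + κ b * E.θ' u)
    - κ b' * E.Y * (E.θ u + κ b * u))) * hx

theorem of_eq_zero {p : ℂ × ℂ} {f : ℂ × ℂ → ℂ} {hf : AnalyticAt ℂ f p} :
    of f hf = 0 ↔ ∀ᶠ q in 𝓝 p, f q = 0 :=
  Subtype.ext_iff.trans (Germ.coe_eq (g := (0 : ℂ × ℂ → ℂ)))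

theorem coe_eq_zero {p : ℂ × ℂ} {z : AnGerm p} {f : ℂ × ℂ → ℂ}
    (h : (z : Germ (𝓝 p) ℂ) = (f : Germ (𝓝 p) ℂ)) : z = 0 ↔ ∀ᶠ q in 𝓝 p, f q = 0 :=
  (Subtype.ext_iff.trans (by rw [h]; exact Germ.coe_eq (g := (0 : ℂ × ℂ → ℂ))))

/-- The conditions on the base point `p` that make `X` and `Y` local coordinates, different from
`0`. -/
structure IsRegularPoint (p : ℂ × ℂ) : Prop where
  x0 : p.1 ≠ 0
  x1 : p.1 ≠ 1
  y0 : p.2 ≠ 0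
  y1 : p.2 ≠ 1

variable {p : ℂ × ℂ}

theorem IsRegularPoint.eventually (hp : IsRegularPoint p) : ∀ᶠ q in 𝓝 p, IsRegularPoint q := by
  filter_upwards [continuous_fst.continuousAt.eventually_ne hp.x0,
    continuous_fst.continuousAt.eventually_ne hp.x1,
    continuous_snd.continuousAt.eventually_ne hp.y0,
    continuous_snd.continuousAt.eventually_ne hp.y1] with q h1 h2 h3 h4
  exact ⟨h1, h2, h3, h4⟩

theorem IsRegularPoint.x1' (hp : IsRegularPoint p) : 1 - p.1 ≠ 0 := sub_ne_zero.2 hp.x1.symm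

theorem IsRegularPoint.y1' (hp : IsRegularPoint p) : 1 - p.2 ≠ 0 := sub_ne_zero.2 hp.y1.symm

theorem analyticAt_coordX (hp : IsRegularPoint p) : AnalyticAt ℂ coordX p :=
  analyticAt_fst.neg.div (analyticAt_const.sub analyticAt_fst) hp.x1'

theorem analyticAt_coordY (hp : IsRegularPoint p) : AnalyticAt ℂ coordY p :=
  analyticAt_snd.neg.div (analyticAt_const.sub analyticAt_snd) hp.y1'

theorem analyticAt_coordT (hp : IsRegularPoint p) : AnalyticAt ℂ coordT p :=
  (analyticAt_fst.mul analyticAt_snd).div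
    ((analyticAt_const.sub analyticAt_fst).mul (analyticAt_const.sub analyticAt_snd))
    (mul_ne_zero hp.x1' hp.y1')

theorem coordX_ne_zero (hp : IsRegularPoint p) : coordX p ≠ 0 :=
  div_ne_zero (neg_ne_zero.2 hp.x0) hp.x1'

theorem coordY_ne_zero (hp : IsRegularPoint p) : coordY p ≠ 0 :=
  div_ne_zero (neg_ne_zero.2 hp.y0) hp.y1'

theorem coordX_mul_coordY (q : ℂ × ℂ) : coordX q * coordY q = coordT q := by
  simp only [coordX, coordY, coordT, div_mul_div_comm, neg_mul_neg]

theorem one_sub_coordX (hp : IsRegularPoint p) : 1 - coordX p = (1 - p.1)⁻¹ := by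
  have := hp.x1'
  rw [coordX]; field_simp; ring

theorem one_sub_coordY (hp : IsRegularPoint p) : 1 - coordY p = (1 - p.2)⁻¹ := by
  have := hp.y1'
  rw [coordY]; field_simp; ring

theorem coordT_ne_zero (hp : IsRegularPoint p) : coordT p ≠ 0 := by
  rw [← coordX_mul_coordY]; exact mul_ne_zero (coordX_ne_zero hp) (coordY_ne_zero hp)

theorem germX_mul (hp : IsRegularPoint p) :
    of coordX (analyticAt_coordX hp) * (1 - x p) = -x p := by
  refine Subtype.ext (Germ.coe_eq.2 ?_ :
    ((fun q => coordX q * (1 - q.1) : ℂ × ℂ → ℂ) : Germ (𝓝 p) ℂ) =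
      ((fun q => -q.1 : ℂ × ℂ → ℂ) : Germ (𝓝 p) ℂ))
  filter_upwards [hp.eventually] with q hq
  exact div_mul_cancel₀ _ hq.x1'

theorem germY_mul (hp : IsRegularPoint p) :
    of coordY (analyticAt_coordY hp) * (1 - y p) = -y p := by
  refine Subtype.ext (Germ.coe_eq.2 ?_ :
    ((fun q => coordY q * (1 - q.2) : ℂ × ℂ → ℂ) : Germ (𝓝 p) ℂ) =
      ((fun q => -q.2 : ℂ × ℂ → ℂ) : Germ (𝓝 p) ℂ))
  filter_upwards [hp.eventually] with q hq
  exact div_mul_cancel₀ _ hq.y1'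

theorem isUnit_one_sub_x (hp : IsRegularPoint p) : IsUnit (1 - x p) :=
  isUnit_of (hf := analyticAt_const.sub analyticAt_fst) hp.x1'

theorem isUnit_one_sub_y (hp : IsRegularPoint p) : IsUnit (1 - y p) :=
  isUnit_of (hf := analyticAt_const.sub analyticAt_snd) hp.y1'

/-- The coordinates `X = -x/(1-x)`, `Y = -y/(1-y)` and their Euler operators
`θ = x (1 - x) ∂/∂x`, `θ' = y (1 - y) ∂/∂y` on germs at `p`. -/
def frame (hp : IsRegularPoint p) : EulerFrame (AnGerm p) where
  θ := (x p * (1 - x p)) • Dx p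
  θ' := (y p * (1 - y p)) • Dy p
  X := of coordX (analyticAt_coordX hp)
  Y := of coordY (analyticAt_coordY hp)
  comm z := by
    simp only [Derivation.smul_apply, Derivation.leibniz, smul_eq_mul, map_sub, Dx_y, Dy_x, Dx_Dy,
      Derivation.map_one_eq_zero]
    ring
  θ_X := by
    have h1 := germX_mul hp
    have h := congrArg (Dx p) h1
    simp only [Derivation.smul_apply, Derivation.leibniz, smul_eq_mul, map_sub, Dx_x, map_neg,
      Derivation.map_one_eq_zero] at h ⊢
    linear_combination x p * h - h1
  θ_Y := by
    have h := congrArg (Dx p) (germY_mul hp)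
    simp only [Derivation.smul_apply, Derivation.leibniz, smul_eq_mul, map_sub, Dx_y, map_neg,
      Derivation.map_one_eq_zero] at h ⊢
    rw [← (isUnit_one_sub_y hp).mul_right_eq_zero]
    linear_combination x p * (1 - x p) * h
  θ'_X := by
    have h := congrArg (Dy p) (germX_mul hp)
    simp only [Derivation.smul_apply, Derivation.leibniz, smul_eq_mul, map_sub, Dy_x, map_neg,
      Derivation.map_one_eq_zero] at h ⊢
    rw [← (isUnit_one_sub_x hp).mul_right_eq_zero]
    linear_combination y p * (1 - y p) * h
  θ'_Y := by
    have h1 := germY_mul hp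
    have h := congrArg (Dy p) h1
    simp only [Derivation.smul_apply, Derivation.leibniz, smul_eq_mul, map_sub, Dy_y, map_neg,
      Derivation.map_one_eq_zero] at h ⊢
    linear_combination y p * h - h1
  isUnit_X := isUnit_of (coordX_ne_zero hp)
  isUnit_Y := isUnit_of (coordY_ne_zero hp)
  isUnit_one_sub_X := isUnit_of (hf := analyticAt_const.sub (analyticAt_coordX hp))
    ((one_sub_coordX hp).trans_ne (inv_ne_zero hp.x1'))
  isUnit_one_sub_Y := isUnit_of (hf := analyticAt_const.sub (analyticAt_coordY hp))
    ((one_sub_coordY hp).trans_ne (inv_ne_zero hp.y1'))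

theorem frame_θ (hp : IsRegularPoint p) (z : AnGerm p) :
    (frame hp).θ z = x p * (1 - x p) * Dx p z := rfl

theorem frame_θ' (hp : IsRegularPoint p) (z : AnGerm p) :
    (frame hp).θ' z = y p * (1 - y p) * Dy p z := rfl

theorem one_sub_X_mul_θ (hp : IsRegularPoint p) (z : AnGerm p) :
    (1 - (frame hp).X) * (frame hp).θ z = x p * Dx p z := by
  have h : (frame hp).X * (1 - x p) = -x p := germX_mul hp
  rw [frame_θ]
  linear_combination (-x p * Dx p z) * h

theorem one_sub_Y_mul_θ' (hp : IsRegularPoint p) (z : AnGerm p) :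
    (1 - (frame hp).Y) * (frame hp).θ' z = y p * Dy p z := by
  have h : (frame hp).Y * (1 - y p) = -y p := germY_mul hp
  rw [frame_θ']
  linear_combination (-y p * Dy p z) * h

theorem exists_eq_algebraMap_of_θ (hp : IsRegularPoint p) {z : AnGerm p} (h1 : (frame hp).θ z = 0)
    (h2 : (frame hp).θ' z = 0) : ∃ c : ℂ, z = κ c := by
  refine eq_algebraMap_of_Dx_Dy ?_ ?_
  · rwa [frame_θ, ((isUnit_x hp.x0).mul (isUnit_one_sub_x hp)).mul_right_eq_zero] at h1
  · rwa [frame_θ', ((isUnit_y hp.y0).mul (isUnit_one_sub_y hp)).mul_right_eq_zero] at h2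

/-! ### Branches of powers -/

theorem analyticAt_branchPow {w₀ : ℂ} (h : w₀ ≠ 0) (ℓ c : ℂ) {w : ℂ}
    (hw : w / w₀ ∈ Complex.slitPlane) : AnalyticAt ℂ (branchPow w₀ ℓ c) w := by
  have : AnalyticAt ℂ (fun w => w / w₀) w := analyticAt_id.div analyticAt_const h
  exact (analyticAt_const.mul (analyticAt_const.add (this.clog hw))).cexp

theorem branchPow_ne_zero (w₀ ℓ c w : ℂ) : branchPow w₀ ℓ c w ≠ 0 := Complex.exp_ne_zero _

theorem branchPow_add (w₀ ℓ c d w : ℂ) :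
    branchPow w₀ ℓ (c + d) w = branchPow w₀ ℓ c w * branchPow w₀ ℓ d w := by
  rw [branchPow, branchPow, branchPow, ← Complex.exp_add]; ring_nf

theorem branchPow_one {w₀ ℓ w : ℂ} (h : Complex.exp ℓ = w₀) (hw : w ≠ 0) :
    branchPow w₀ ℓ 1 w = w := by
  have h0 : w₀ ≠ 0 := h ▸ Complex.exp_ne_zero ℓ
  rw [branchPow, one_mul, Complex.exp_add, h, Complex.exp_log (div_ne_zero hw h0),
    mul_div_cancel₀ _ h0]

theorem branchPow_add_one {w₀ ℓ w : ℂ} (h : Complex.exp ℓ = w₀) (hw : w ≠ 0) (c : ℂ) :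
    branchPow w₀ ℓ (c + 1) w = branchPow w₀ ℓ c w * w := by
  rw [branchPow_add, branchPow_one h hw]

theorem hasDerivAt_branchPow {w₀ ℓ c w : ℂ} (h : Complex.exp ℓ = w₀)
    (hw : w / w₀ ∈ Complex.slitPlane) :
    HasDerivAt (branchPow w₀ ℓ c) (c * branchPow w₀ ℓ (c - 1) w) w := by
  have h0 : w₀ ≠ 0 := h ▸ Complex.exp_ne_zero ℓ
  have hw0 : w ≠ 0 := by
    rintro rfl
    simp at hw
  have h1 : HasDerivAt (fun w => w / w₀) (1 / w₀) w := (hasDerivAt_id w).div_const w₀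
  have h2 := (((h1.clog hw).const_add ℓ).const_mul c).cexp
  refine h2.congr_deriv ?_
  have h3 := branchPow_add_one h hw0 (c - 1)
  rw [sub_add_cancel] at h3
  change branchPow w₀ ℓ c w * _ = _
  rw [h3]
  field_simp

theorem div_self_mem_slitPlane {w₀ : ℂ} (h : w₀ ≠ 0) : w₀ / w₀ ∈ Complex.slitPlane := by
  rw [div_self h]; exact Complex.one_mem_slitPlane

/-! ### The system `E₂` -/

section E2

variable (b b' : ℂ) {ℓx ℓy : ℂ}

theorem analyticAt_factor (hp : IsRegularPoint p) (ℓx ℓy : ℂ) :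
    AnalyticAt ℂ (factor b b' p ℓx ℓy) p := by
  have h1 : AnalyticAt ℂ (fun q : ℂ × ℂ => branchPow (1 - p.1) ℓx b (1 - q.1)) p :=
    AnalyticAt.fun_comp (f := fun q : ℂ × ℂ => 1 - q.1)
      (analyticAt_branchPow hp.x1' ℓx b (div_self_mem_slitPlane hp.x1'))
      (analyticAt_const.sub analyticAt_fst)
  have h2 : AnalyticAt ℂ (fun q : ℂ × ℂ => branchPow (1 - p.2) ℓy b' (1 - q.2)) p :=
    AnalyticAt.fun_comp (f := fun q : ℂ × ℂ => 1 - q.2)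
      (analyticAt_branchPow hp.y1' ℓy b' (div_self_mem_slitPlane hp.y1'))
      (analyticAt_const.sub analyticAt_snd)
  exact h1.mul h2

theorem Dx_factor (hp : IsRegularPoint p) (hℓx : Complex.exp ℓx = 1 - p.1) :
    Dx p (of _ (analyticAt_factor b b' hp ℓx ℓy)) * (1 - x p) =
      -(κ b * of _ (analyticAt_factor b b' hp ℓx ℓy)) := by
  refine Subtype.ext (Germ.coe_eq.2 ?_ :
    ((fun q => dx (factor b b' p ℓx ℓy) q * (1 - q.1) : ℂ × ℂ → ℂ) : Germ (𝓝 p) ℂ) =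
      ((fun q => -(b * factor b b' p ℓx ℓy q) : ℂ × ℂ → ℂ) : Germ (𝓝 p) ℂ))
  have hc : ContinuousAt (fun q : ℂ × ℂ => (1 - q.1) / (1 - p.1)) p := by fun_prop
  filter_upwards [hp.eventually, hc.eventually_mem (Complex.isOpen_slitPlane.mem_nhds
    (div_self_mem_slitPlane hp.x1'))] with q hq h1
  have h2 : HasDerivAt (fun x : ℂ => 1 - x) (-1) q.1 := (hasDerivAt_id q.1).const_sub 1
  have h3 := ((hasDerivAt_branchPow (c := b) hℓx h1).comp q.1 h2).mul_const
    (branchPow (1 - p.2) ℓy b' (1 - q.2))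
  have h4 := branchPow_add_one hℓx hq.x1' (b - 1)
  rw [sub_add_cancel] at h4
  rw [show dx (factor b b' p ℓx ℓy) q = _ from h3.deriv, factor, h4]
  ring

theorem Dy_factor (hp : IsRegularPoint p) (hℓy : Complex.exp ℓy = 1 - p.2) :
    Dy p (of _ (analyticAt_factor b b' hp ℓx ℓy)) * (1 - y p) =
      -(κ b' * of _ (analyticAt_factor b b' hp ℓx ℓy)) := by
  refine Subtype.ext (Germ.coe_eq.2 ?_ :
    ((fun q => dy (factor b b' p ℓx ℓy) q * (1 - q.2) : ℂ × ℂ → ℂ) : Germ (𝓝 p) ℂ) =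
      ((fun q => -(b' * factor b b' p ℓx ℓy q) : ℂ × ℂ → ℂ) : Germ (𝓝 p) ℂ))
  have hc : ContinuousAt (fun q : ℂ × ℂ => (1 - q.2) / (1 - p.2)) p := by fun_prop
  filter_upwards [hp.eventually, hc.eventually_mem (Complex.isOpen_slitPlane.mem_nhds
    (div_self_mem_slitPlane hp.y1'))] with q hq h1
  have h2 : HasDerivAt (fun x : ℂ => 1 - x) (-1) q.2 := (hasDerivAt_id q.2).const_sub 1
  have h3 := ((hasDerivAt_branchPow (c := b') hℓy h1).comp q.2 h2).const_mul
    (branchPow (1 - p.1) ℓx b (1 - q.1))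
  have h4 := branchPow_add_one hℓy hq.y1' (b' - 1)
  rw [sub_add_cancel] at h4
  rw [show dy (factor b b' p ℓx ℓy) q = _ from h3.deriv, factor, h4]
  ring

theorem isSolE2_iff (a b b' c c' : ℂ) (f : ℂ × ℂ → ℂ) (hf : AnalyticAt ℂ f p) {z : AnGerm p}
    (hz : z = of f hf) :
    IsSolE2 a b b' c c' f p ↔
      x p * Dx p (κ (c - 1) * z + x p * Dx p z) -
          x p * (κ a * (κ b * z + x p * Dx p z) + x p * Dx p (κ b * z + x p * Dx p z) +
            y p * Dy p (κ b * z + x p * Dx p z)) = 0 ∧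
        y p * Dy p (κ (c' - 1) * z + y p * Dy p z) -
          y p * (κ a * (κ b' * z + y p * Dy p z) + x p * Dx p (κ b' * z + y p * Dy p z) +
            y p * Dy p (κ b' * z + y p * Dy p z)) = 0 := by
  subst hz
  rw [IsSolE2, eventually_and, and_iff_right hf]
  exact and_congr (coe_eq_zero (f := opP2 a b c f) rfl).symm
    (coe_eq_zero (f := opQ2 a b' c' f) rfl).symm

theorem mem_mulSolE2_iff (hp : IsRegularPoint p) (a : ℂ) (hℓx : Complex.exp ℓx = 1 - p.1)
    (hℓy : Complex.exp ℓy = 1 - p.2) {g : Germ (𝓝 p) ℂ} :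
    g ∈ mulSolE2 (factor b b' p ℓx ℓy) a b b' a a p ↔
      ∃ u : AnGerm p, (frame hp).SysE2 a b b' u ∧ (u : Germ (𝓝 p) ℂ) = g := by
  set E := frame hp with hE
  set m := of _ (analyticAt_factor b b' hp ℓx ℓy) with hm
  have hmu : IsUnit m :=
    isUnit_of (mul_ne_zero (branchPow_ne_zero _ _ _ _) (branchPow_ne_zero _ _ _ _))
  obtain ⟨n, hmn⟩ := hmu.exists_right_inv
  have hX : E.X * (1 - x p) = -x p := germX_mul hp
  have hY : E.Y * (1 - y p) = -y p := germY_mul hp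
  have hn : (1 - E.X) * E.θ n = -(κ b * E.X * n) := by
    have h1 := congrArg (Dx p) hmn
    have h2 := Dx_factor (ℓy := ℓy) b b' hp hℓx
    rw [← hm] at h2
    simp only [Derivation.leibniz, smul_eq_mul, Derivation.map_one_eq_zero] at h1
    rw [one_sub_X_mul_θ, ← sub_eq_zero, ← (isUnit_one_sub_x hp).mul_right_eq_zero,
      ← hmu.mul_right_eq_zero]
    linear_combination (1 - x p) * x p * h1 - x p * n * h2 + (κ b * n * m) * hX
  have hn' : (1 - E.Y) * E.θ' n = -(κ b' * E.Y * n) := by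
    have h1 := congrArg (Dy p) hmn
    have h2 := Dy_factor (ℓx := ℓx) b b' hp hℓy
    rw [← hm] at h2
    simp only [Derivation.leibniz, smul_eq_mul, Derivation.map_one_eq_zero] at h1
    rw [one_sub_Y_mul_θ', ← sub_eq_zero, ← (isUnit_one_sub_y hp).mul_right_eq_zero,
      ← hmu.mul_right_eq_zero]
    linear_combination (1 - y p) * y p * h1 - y p * n * h2 + (κ b' * n * m) * hY
  have hnu : IsUnit n := IsUnit.of_mul_eq_one m (by rw [mul_comm, hmn])
  -- the correspondence `z = n u`
  have key : ∀ u f (hf : AnalyticAt ℂ f p), n * u = of f hf →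
      (IsSolE2 a b b' a a f p ↔ E.SysE2 a b b' u) := by
    intro u f hf hu
    rw [isSolE2_iff a b b' a a f hf hu]
    have h1 := E.conj a b b' (x := x p) hn hn' (by linear_combination hX) u rfl
    have h2 := E.swap.conj a b' b (x := y p) hn' hn (by
      simp only [EulerFrame.swap]; linear_combination hY) u rfl
    refine and_congr ?_ ?_
    · rw [EulerFrame.EqE2, ← sub_eq_zero (a := E.θ _)]
      refine Iff.trans ?_ hnu.mul_right_eq_zero
      rw [← h1]
      simp only [hE, one_sub_X_mul_θ, one_sub_Y_mul_θ']
    · rw [EulerFrame.EqE2, ← sub_eq_zero (a := E.swap.θ _)]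
      refine Iff.trans ?_ hnu.mul_right_eq_zero
      rw [← h2]
      simp only [hE, EulerFrame.swap, one_sub_X_mul_θ, one_sub_Y_mul_θ']
      simp only [add_right_comm]
  constructor
  · rintro ⟨z, hz, rfl⟩
    refine ⟨m * of z hz.1, ?_, rfl⟩
    refine (key _ z hz.1 ?_).1 hz
    rw [← mul_assoc, mul_comm n, hmn, one_mul]
  · rintro ⟨u, hu, rfl⟩
    obtain ⟨f, hf, hfu⟩ : ∃ f, ∃ hf : AnalyticAt ℂ f p, n * u = of f hf := by
      obtain ⟨f, hf, h⟩ := (n * u).2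
      exact ⟨f, hf, Subtype.ext h.symm⟩
    refine ⟨f, (key u f hf hfu).2 hu, ?_⟩
    have : u = m * of f hf := by rw [← hfu, ← mul_assoc, hmn, one_mul]
    rw [this]; rfl

end E2

/-! ### The system `E₁` -/

theorem isSolE1_iff {r : ℂ × ℂ} (a b b' c : ℂ) (f : ℂ × ℂ → ℂ) (hf : AnalyticAt ℂ f r) :
    IsSolE1 a b b' c f r ↔
      x r * (1 - x r) * Dx r (Dx r (of f hf)) + y r * (1 - x r) * Dx r (Dy r (of f hf)) +
        (κ c - (κ a + κ b + 1) * x r) * Dx r (of f hf) - κ b * y r * Dy r (of f hf) -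
          κ a * κ b * of f hf = 0 ∧
      y r * (1 - y r) * Dy r (Dy r (of f hf)) + x r * (1 - y r) * Dy r (Dx r (of f hf)) +
        (κ c - (κ a + κ b' + 1) * y r) * Dy r (of f hf) - κ b' * x r * Dx r (of f hf) -
          κ a * κ b' * of f hf = 0 ∧
      (x r - y r) * Dx r (Dy r (of f hf)) - κ b' * Dx r (of f hf) + κ b * Dy r (of f hf) = 0 := by
  rw [IsSolE1, eventually_and, eventually_and, and_iff_right hf]
  exact and_congr (coe_eq_zero (f := opP1 a b c f) rfl).symm
    (and_congr (coe_eq_zero (f := opQ1 a b' c f) rfl).symm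
      (coe_eq_zero (f := opR1 b b' f) rfl).symm)

/-- The system `E₁(a,b,b',c)` in the variables `φ`, for a local isomorphism `φ`, in terms of the
Euler operators `e`, `f` of the components of `φ`. -/
theorem isSolE1_iff_pull {φ : ℂ × ℂ → ℂ × ℂ} (hφ : AnalyticAt ℂ φ p)
    (hinj : Function.Injective (pull hφ)) (h1 : (φ p).1 ≠ 0) (h2 : (φ p).2 ≠ 0)
    {e f : Derivation ℂ (AnGerm p) (AnGerm p)}
    (he : ∀ z, e (pull hφ z) = pull hφ (x _ * Dx _ z))
    (hf : ∀ z, f (pull hφ z) = pull hφ (y _ * Dy _ z))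
    (a b b' c : ℂ) (g : ℂ × ℂ → ℂ) (hg : AnalyticAt ℂ g (φ p)) {u φ₁ φ₂ : AnGerm p}
    (hu : u = pull hφ (of g hg)) (hφ₁ : φ₁ = pull hφ (x _)) (hφ₂ : φ₂ = pull hφ (y _)) :
    IsSolE1 a b b' c g (φ p) ↔
      e (e u + f u + (κ c - 1) * u) =
          φ₁ * (e (e u + κ b * u) + f (e u + κ b * u) + κ a * (e u + κ b * u)) ∧
        f (e u + f u + (κ c - 1) * u) =
          φ₂ * (e (f u + κ b' * u) + f (f u + κ b' * u) + κ a * (f u + κ b' * u)) ∧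
        (φ₁ - φ₂) * e (f u) - κ b' * φ₂ * e u + κ b * φ₁ * f u = 0 := by
  rw [isSolE1_iff a b b' c g hg]
  subst hu hφ₁ hφ₂
  set z := of g hg with hz
  have hk : ∀ c : ℂ, (κ c : AnGerm p) = pull hφ (κ c) := fun c => ((pull hφ).commutes c).symm
  have h10 : (1 : AnGerm p) = pull hφ 1 := (map_one _).symm
  simp only [hk, h10, he, hf, ← map_add, ← map_sub, ← map_mul]
  rw [← map_zero (pull hφ)]
  simp only [hinj.eq_iff]
  refine and_congr ?_ (and_congr ?_ ?_)
  · rw [← (isUnit_x h1).mul_right_eq_zero, ← sub_eq_zero (a := x (φ p) * Dx (φ p) _)]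
    refine Eq.congr_left ?_
    simp only [Derivation.map_algebraMap, map_add, map_sub, Derivation.leibniz, smul_eq_mul, Dx_Dy,
      Derivation.map_one_eq_zero, Dx_x, Dx_y, Dy_x, map_mul]
    ring
  · rw [← (isUnit_y h2).mul_right_eq_zero, ← sub_eq_zero (a := y (φ p) * Dy (φ p) _)]
    refine Eq.congr_left ?_
    simp only [Derivation.map_algebraMap, map_add, map_sub, Derivation.leibniz, smul_eq_mul, Dx_Dy,
      Derivation.map_one_eq_zero, Dx_y, Dy_x, Dy_y, map_mul]
    ring
  · rw [← ((isUnit_x h1).mul (isUnit_y h2)).mul_right_eq_zero]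
    refine Eq.congr_left ?_
    simp only [Derivation.leibniz, smul_eq_mul, Dx_y]
    ring

/-- The map `(x, y) ↦ (X, XY)`. -/
abbrev mapXT (q : ℂ × ℂ) : ℂ × ℂ := (coordX q, coordT q)

/-- The map `(x, y) ↦ (XY, Y)`. -/
abbrev mapTY (q : ℂ × ℂ) : ℂ × ℂ := (coordT q, coordY q)

theorem analyticAt_mapXT (hp : IsRegularPoint p) : AnalyticAt ℂ mapXT p :=
  (analyticAt_coordX hp).prod (analyticAt_coordT hp)

theorem analyticAt_mapTY (hp : IsRegularPoint p) : AnalyticAt ℂ mapTY p :=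
  (analyticAt_coordT hp).prod (analyticAt_coordY hp)

theorem coordX_div (hp : IsRegularPoint p) : coordX p / (coordX p - 1) = p.1 := by
  have h := one_sub_coordX hp
  have h1 := hp.x1'
  rw [show coordX p - 1 = -(1 - p.1)⁻¹ by rw [← h]; ring, coordX]
  field_simp

theorem coordY_div (hp : IsRegularPoint p) : coordY p / (coordY p - 1) = p.2 := by
  have h := one_sub_coordY hp
  have h1 := hp.y1'
  rw [show coordY p - 1 = -(1 - p.2)⁻¹ by rw [← h]; ring, coordY]
  field_simp

theorem coordX_div_sub_one {X : ℂ} (h : X ≠ 1) : -(X / (X - 1)) / (1 - X / (X - 1)) = X := by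
  have h1 : X - 1 ≠ 0 := sub_ne_zero.2 h
  have h2 : 1 - X / (X - 1) = -(X - 1)⁻¹ := by field_simp; ring
  rw [h2]; field_simp

theorem coordX_ne_one (hp : IsRegularPoint p) : coordX p ≠ 1 := fun h => by
  have := one_sub_coordX hp
  rw [h, sub_self] at this
  exact inv_ne_zero hp.x1' this.symm

theorem coordY_ne_one (hp : IsRegularPoint p) : coordY p ≠ 1 := fun h => by
  have := one_sub_coordY hp
  rw [h, sub_self] at this
  exact inv_ne_zero hp.y1' this.symm

theorem pull_mapXT_bijective (hp : IsRegularPoint p) :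
    Function.Bijective (pull (analyticAt_mapXT hp)) := by
  -- the inverse map `(X, XY) ↦ (x, y)`
  let ψ : ℂ × ℂ → ℂ × ℂ := fun r => (r.1 / (r.1 - 1), (r.2 / r.1) / (r.2 / r.1 - 1))
  have hψ : ∀ {q : ℂ × ℂ}, IsRegularPoint q → ψ (mapXT q) = q := by
    intro q hq
    have h : coordT q / coordX q = coordY q := by
      rw [← coordX_mul_coordY, mul_div_cancel_left₀ _ (coordX_ne_zero hq)]
    refine Prod.ext (coordX_div hq) ?_
    simp only [ψ, h]
    exact coordY_div hq
  have hY : (mapXT p).2 / (mapXT p).1 ≠ 1 := by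
    rw [mapXT, ← coordX_mul_coordY, mul_div_cancel_left₀ _ (coordX_ne_zero hp)]
    exact coordY_ne_one hp
  have hd : AnalyticAt ℂ (fun r : ℂ × ℂ => r.2 / r.1) (mapXT p) :=
    analyticAt_snd.div analyticAt_fst (coordX_ne_zero hp)
  refine pull_bijective (analyticAt_mapXT hp) (ψ := ψ) ?_ (hψ hp)
    (hp.eventually.mono fun q hq => hψ hq) ?_
  · exact (analyticAt_fst.div (analyticAt_fst.sub analyticAt_const)
      (sub_ne_zero.2 (coordX_ne_one hp))).prod
      (hd.div (hd.sub analyticAt_const) (sub_ne_zero.2 hY))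
  · filter_upwards [continuous_fst.continuousAt.eventually_ne (coordX_ne_zero hp),
      continuous_fst.continuousAt.eventually_ne (coordX_ne_one hp),
      hd.continuousAt.eventually_ne hY] with r h1 h2 h3
    refine Prod.ext (coordX_div_sub_one h2) ?_
    change coordT (ψ r) = r.2
    rw [← coordX_mul_coordY]
    have e1 : coordX (ψ r) = r.1 := coordX_div_sub_one h2
    have e2 : coordY (ψ r) = r.2 / r.1 := coordX_div_sub_one h3
    rw [e1, e2, mul_div_cancel₀ _ h1]

theorem pull_mapTY_bijective (hp : IsRegularPoint p) :
    Function.Bijective (pull (analyticAt_mapTY hp)) := by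
  -- the inverse map `(XY, Y) ↦ (x, y)`
  let ψ : ℂ × ℂ → ℂ × ℂ := fun r => ((r.1 / r.2) / (r.1 / r.2 - 1), r.2 / (r.2 - 1))
  have hψ : ∀ {q : ℂ × ℂ}, IsRegularPoint q → ψ (mapTY q) = q := by
    intro q hq
    have h : coordT q / coordY q = coordX q := by
      rw [← coordX_mul_coordY, mul_div_cancel_right₀ _ (coordY_ne_zero hq)]
    refine Prod.ext ?_ (coordY_div hq)
    simp only [ψ, h]
    exact coordX_div hq
  have hX : (mapTY p).1 / (mapTY p).2 ≠ 1 := by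
    rw [mapTY, ← coordX_mul_coordY, mul_div_cancel_right₀ _ (coordY_ne_zero hp)]
    exact coordX_ne_one hp
  have hd : AnalyticAt ℂ (fun r : ℂ × ℂ => r.1 / r.2) (mapTY p) :=
    analyticAt_fst.div analyticAt_snd (coordY_ne_zero hp)
  refine pull_bijective (analyticAt_mapTY hp) (ψ := ψ) ?_ (hψ hp)
    (hp.eventually.mono fun q hq => hψ hq) ?_
  · exact (hd.div (hd.sub analyticAt_const) (sub_ne_zero.2 hX)).prod
      (analyticAt_snd.div (analyticAt_snd.sub analyticAt_const)
        (sub_ne_zero.2 (coordY_ne_one hp)))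
  · filter_upwards [continuous_snd.continuousAt.eventually_ne (coordY_ne_zero hp),
      continuous_snd.continuousAt.eventually_ne (coordY_ne_one hp),
      hd.continuousAt.eventually_ne hX] with r h1 h2 h3
    refine Prod.ext ?_ (coordX_div_sub_one h2)
    change coordT (ψ r) = r.1
    rw [← coordX_mul_coordY]
    have e1 : coordX (ψ r) = r.1 / r.2 := coordX_div_sub_one h3
    have e2 : coordY (ψ r) = r.2 := coordX_div_sub_one h2
    rw [e1, e2, div_mul_cancel₀ _ h1]

theorem pull_x_mapXT (hp : IsRegularPoint p) :
    (frame hp).X = pull (analyticAt_mapXT hp) (x _) := rfl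

theorem pull_y_mapXT (hp : IsRegularPoint p) :
    (frame hp).X * (frame hp).Y = pull (analyticAt_mapXT hp) (y _) :=
  Subtype.ext (Germ.coe_eq.2 (Eventually.of_forall coordX_mul_coordY))

theorem pull_x_mapTY (hp : IsRegularPoint p) :
    (frame hp).X * (frame hp).Y = pull (analyticAt_mapTY hp) (x _) :=
  Subtype.ext (Germ.coe_eq.2 (Eventually.of_forall coordX_mul_coordY))

theorem pull_y_mapTY (hp : IsRegularPoint p) :
    (frame hp).Y = pull (analyticAt_mapTY hp) (y _) := rfl

theorem θ_pull (hp : IsRegularPoint p) {φ : ℂ × ℂ → ℂ × ℂ} (hφ : AnalyticAt ℂ φ p)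
    (z : AnGerm (φ p)) :
    (frame hp).θ (pull hφ z) = pull hφ (Dx _ z) * (frame hp).θ (pull hφ (x _)) +
      pull hφ (Dy _ z) * (frame hp).θ (pull hφ (y _)) := by
  simp only [frame_θ]
  rw [Dx_pull]; ring

theorem θ'_pull (hp : IsRegularPoint p) {φ : ℂ × ℂ → ℂ × ℂ} (hφ : AnalyticAt ℂ φ p)
    (z : AnGerm (φ p)) :
    (frame hp).θ' (pull hφ z) = pull hφ (Dx _ z) * (frame hp).θ' (pull hφ (x _)) +
      pull hφ (Dy _ z) * (frame hp).θ' (pull hφ (y _)) := by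
  simp only [frame_θ']
  rw [Dy_pull]; ring

/-- The Euler operators of the variables `(X, XY)` are `θ - θ'` and `θ'`. -/
theorem euler_mapXT (hp : IsRegularPoint p) (z : AnGerm (mapXT p)) :
    ((frame hp).θ - (frame hp).θ') (pull (analyticAt_mapXT hp) z) =
        pull (analyticAt_mapXT hp) (x _ * Dx _ z) ∧
      (frame hp).θ' (pull (analyticAt_mapXT hp) z) =
        pull (analyticAt_mapXT hp) (y _ * Dy _ z) := by
  set E := frame hp with hE
  rw [Derivation.sub_apply, hE, θ_pull, θ'_pull, map_mul, map_mul, ← pull_x_mapXT hp,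
    ← pull_y_mapXT hp, ← hE]
  simp only [Derivation.leibniz, smul_eq_mul, E.θ_X, E.θ_Y, E.θ'_X, E.θ'_Y]
  constructor <;> ring

/-- The Euler operators of the variables `(XY, Y)` are `θ` and `θ' - θ`. -/
theorem euler_mapTY (hp : IsRegularPoint p) (z : AnGerm (mapTY p)) :
    (frame hp).θ (pull (analyticAt_mapTY hp) z) =
        pull (analyticAt_mapTY hp) (x _ * Dx _ z) ∧
      ((frame hp).θ' - (frame hp).θ) (pull (analyticAt_mapTY hp) z) =
        pull (analyticAt_mapTY hp) (y _ * Dy _ z) := by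
  set E := frame hp with hE
  rw [Derivation.sub_apply, hE, θ_pull, θ'_pull, map_mul, map_mul, ← pull_x_mapTY hp,
    ← pull_y_mapTY hp, ← hE]
  simp only [Derivation.leibniz, smul_eq_mul, E.θ_X, E.θ_Y, E.θ'_X, E.θ'_Y]
  constructor <;> ring

/-- If `φ` is a local isomorphism, the germs of `E₁` in the variables `φ` are those germs `u` that
satisfy a condition `P` equivalent to the system. -/
theorem mem_solE1_of_iff {φ : ℂ × ℂ → ℂ × ℂ} (hφ : AnalyticAt ℂ φ p)
    (hbij : Function.Bijective (pull hφ)) {a b b' c : ℂ} {P : AnGerm p → Prop}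
    (hP : ∀ g (hg : AnalyticAt ℂ g (φ p)),
      IsSolE1 a b b' c g (φ p) ↔ P (pull hφ (of g hg))) {g : Germ (𝓝 p) ℂ} :
    g ∈ solE1 a b b' c φ p ↔ ∃ u : AnGerm p, P u ∧ (u : Germ (𝓝 p) ℂ) = g := by
  constructor
  · rintro ⟨z, hz, rfl⟩
    exact ⟨_, (hP z hz.1).1 hz, rfl⟩
  · rintro ⟨u, hu, rfl⟩
    obtain ⟨z, rfl⟩ := hbij.2 u
    obtain ⟨_, f, hf, rfl⟩ := z
    exact ⟨f, (hP f hf).2 hu, rfl⟩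

theorem mem_solE1_mapXT_iff (hp : IsRegularPoint p) (a b b' : ℂ) {g : Germ (𝓝 p) ℂ} :
    g ∈ solE1 b 0 b' a mapXT p ↔
      ∃ u : AnGerm p, (frame hp).SysE1 a b b' u ∧ (u : Germ (𝓝 p) ℂ) = g := by
  refine mem_solE1_of_iff (analyticAt_mapXT hp) (pull_mapXT_bijective hp) fun g hg => ?_
  rw [isSolE1_iff_pull (analyticAt_mapXT hp) (pull_mapXT_bijective hp).1 (coordX_ne_zero hp)
    (coordT_ne_zero hp) (fun z => (euler_mapXT hp z).1) (fun z => (euler_mapXT hp z).2) b 0 b' a g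
    hg rfl (pull_x_mapXT hp) (pull_y_mapXT hp)]
  set E := frame hp
  generalize pull (analyticAt_mapXT hp) (of g hg) = u
  refine and_congr ?_ (and_congr ?_ ?_)
  · rw [← sub_eq_zero, ← sub_eq_zero (a := E.θ _ + _)]
    refine Eq.congr_left ?_
    simp only [Derivation.map_algebraMap, map_add, map_sub, Derivation.leibniz, smul_eq_mul, E.comm,
      Derivation.map_one_eq_zero, Derivation.sub_apply, map_zero]
    ring
  · rw [← sub_eq_zero, ← sub_eq_zero (b := E.X * E.Y * (E.θ _ + _))]
    refine Eq.congr_left ?_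
    simp only [Derivation.map_algebraMap, map_add, map_sub, Derivation.leibniz, smul_eq_mul, E.comm,
      Derivation.map_one_eq_zero, Derivation.sub_apply]
    ring
  · rw [← sub_eq_zero (a := E.θ' (E.θ u - _))]
    refine Iff.trans ?_ E.isUnit_X.mul_right_eq_zero
    refine Eq.congr_left ?_
    simp only [map_sub, E.comm, Derivation.sub_apply, map_zero]
    ring

theorem mem_solE1_mapTY_iff (hp : IsRegularPoint p) (a b b' : ℂ) {g : Germ (𝓝 p) ℂ} :
    g ∈ solE1 b' b 0 a mapTY p ↔
      ∃ u : AnGerm p, (frame hp).swap.SysE1 a b' b u ∧ (u : Germ (𝓝 p) ℂ) = g := by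
  refine mem_solE1_of_iff (analyticAt_mapTY hp) (pull_mapTY_bijective hp) fun g hg => ?_
  rw [isSolE1_iff_pull (analyticAt_mapTY hp) (pull_mapTY_bijective hp).1 (coordT_ne_zero hp)
    (coordY_ne_zero hp) (fun z => (euler_mapTY hp z).1) (fun z => (euler_mapTY hp z).2) b' b 0 a g
    hg rfl (pull_x_mapTY hp) (pull_y_mapTY hp), and_left_comm]
  set E := frame hp
  generalize pull (analyticAt_mapTY hp) (of g hg) = u
  simp only [EulerFrame.SysE1, EulerFrame.swap]
  refine and_congr ?_ (and_congr ?_ ?_)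
  · rw [← sub_eq_zero, ← sub_eq_zero (a := E.θ' _ + _)]
    refine Eq.congr_left ?_
    simp only [Derivation.map_algebraMap, map_add, map_sub, Derivation.leibniz, smul_eq_mul, E.comm,
      Derivation.map_one_eq_zero, Derivation.sub_apply, map_zero]
    ring
  · rw [← sub_eq_zero, ← sub_eq_zero (b := E.Y * E.X * (E.θ' _ + _))]
    refine Eq.congr_left ?_
    simp only [Derivation.map_algebraMap, map_add, map_sub, Derivation.leibniz, smul_eq_mul, E.comm,
      Derivation.map_one_eq_zero, Derivation.sub_apply]
    ring
  · rw [← sub_eq_zero (a := E.θ (E.θ' u - _)), ← neg_eq_zero]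
    refine Iff.trans ?_ E.isUnit_Y.mul_right_eq_zero
    refine Eq.congr_left ?_
    simp only [map_sub, E.comm, Derivation.sub_apply, map_zero]
    ring

/-! ### The Gauss equation -/

theorem isSolGauss_iff_snd {r : ℂ × ℂ} (a b b' : ℂ) (u : ℂ → ℂ) (hu : AnalyticAt ℂ u r.2)
    {z : AnGerm r} (hz : z = of (fun q => u q.2) (hu.fun_comp analyticAt_snd)) :
    IsSolGauss b b' a u r.2 ↔
      y r * Dy r (κ (a - 1) * z + y r * Dy r z) -
        y r * (κ b * (κ b' * z + y r * Dy r z) + y r * Dy r (κ b' * z + y r * Dy r z)) = 0 := by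
  subst hz
  rw [IsSolGauss, and_iff_right hu]
  rw [coe_eq_zero (f := fun q => opP b b' a u q.2) rfl]
  refine ⟨fun h => continuous_snd.continuousAt.eventually h, fun h => ?_⟩
  have hc : ContinuousAt (fun t : ℂ => (r.1, t)) r.2 := by fun_prop
  exact hc.eventually h

theorem exists_eq_of_Dx_eq_zero {r : ℂ × ℂ} {z : AnGerm r} (h : Dx r z = 0) :
    ∃ (u : ℂ → ℂ) (hu : AnalyticAt ℂ u r.2),
      z = of (fun q => u q.2) (hu.fun_comp analyticAt_snd) := by
  obtain ⟨_, f, hf, rfl⟩ := z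
  have h' : ∀ᶠ q in 𝓝 r, dx f q = 0 := (of_eq_zero (hf := analyticAt_dx hf)).1 h
  have hc : AnalyticAt ℂ (fun t : ℂ => (r.1, t)) r.2 := analyticAt_const.prod analyticAt_id
  refine ⟨fun t => f (r.1, t), AnalyticAt.fun_comp (f := fun t : ℂ => (r.1, t)) hf hc,
    Subtype.ext (Germ.coe_eq.2 ?_)⟩
  obtain ⟨ε, hε, hb⟩ := Metric.eventually_nhds_iff_ball.1 (h'.and (eventually_differentiableAt hf))
  filter_upwards [Metric.ball_mem_nhds r hε] with q hq
  have hq' : q.1 ∈ Metric.ball r.1 ε ∧ q.2 ∈ Metric.ball r.2 ε := by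
    rw [← Set.mem_prod, ball_prod_same]; exact hq
  have hm : ∀ s ∈ Metric.ball r.1 ε, (s, q.2) ∈ Metric.ball r ε := by
    intro s hs
    have : (s, q.2) ∈ Metric.ball r.1 ε ×ˢ Metric.ball r.2 ε := ⟨hs, hq'.2⟩
    rwa [ball_prod_same] at this
  refine (convex_ball r.1 ε).is_const_of_fderivWithin_eq_zero (f := fun s => f (s, q.2)) (𝕜 := ℂ)
    ?_ ?_ hq'.1 (Metric.mem_ball_self hε)
  · intro s hs
    exact ((hb _ (hm s hs)).2.comp (f := fun s : ℂ => (s, q.2)) s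
      (by fun_prop)).differentiableWithinAt
  · intro s hs
    rw [fderivWithin_of_isOpen Metric.isOpen_ball hs]
    have h1 : deriv (fun s => f (s, q.2)) s = 0 := (hb _ (hm s hs)).1
    ext
    simpa using h1

theorem mem_solGauss_iff (hp : IsRegularPoint p) (a b b' : ℂ) {g : Germ (𝓝 p) ℂ} :
    g ∈ solGauss b b' a coordT p ↔
      ∃ u : AnGerm p, (frame hp).SysGauss a b b' u ∧ (u : Germ (𝓝 p) ℂ) = g := by
  set E := frame hp
  set Φ := pull (analyticAt_mapXT hp) with hΦ
  have key : ∀ z : AnGerm (mapXT p), E.SysGauss a b b' (Φ z) ↔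
      Dx _ z = 0 ∧ y _ * Dy _ (κ (a - 1) * z + y _ * Dy _ z) -
        y _ * (κ b * (κ b' * z + y _ * Dy _ z) + y _ * Dy _ (κ b' * z + y _ * Dy _ z)) = 0 := by
    intro z
    have hk : ∀ c : ℂ, (κ c : AnGerm p) = Φ (κ c) := fun c => (Φ.commutes c).symm
    have h10 : (1 : AnGerm p) = Φ 1 := (map_one _).symm
    have hf := fun z => (euler_mapXT hp z).2
    refine and_congr ?_ ?_
    · rw [← sub_eq_zero]
      rw [show E.θ (Φ z) - E.θ' (Φ z) = _ from (euler_mapXT hp z).1,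
        (injective_iff_map_eq_zero' _).1 (pull_mapXT_bijective hp).1,
        (isUnit_x (coordX_ne_zero hp)).mul_right_eq_zero]
    · rw [show E.X * E.Y = _ from pull_y_mapXT hp, hk, hk, hk, h10]
      simp only [E, Φ, hf, ← map_add, ← map_sub, ← map_mul]
      rw [(pull_mapXT_bijective hp).1.eq_iff, ← sub_eq_zero]
      refine Eq.congr_left ?_
      simp only [map_sub, map_one]
      ring_nf
  constructor
  · rintro ⟨u, hu, rfl⟩
    have hu' : AnalyticAt ℂ (fun q : ℂ × ℂ => u q.2) (mapXT p) :=
      AnalyticAt.fun_comp (f := Prod.snd) (x := mapXT p) hu.1 analyticAt_snd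
    refine ⟨Φ (of (p := mapXT p) (fun q => u q.2) hu'), (key _).2 ⟨?_, ?_⟩, rfl⟩
    · exact (of_eq_zero (hf := analyticAt_dx hu')).2
        (Eventually.of_forall fun q => deriv_const q.1 (u q.2))
    · exact (isSolGauss_iff_snd (r := mapXT p) a b b' u hu.1 rfl).1 hu
  · rintro ⟨v, hv, rfl⟩
    obtain ⟨z, rfl⟩ := (pull_mapXT_bijective hp).2 v
    obtain ⟨h1, h2⟩ := (key z).1 hv
    obtain ⟨u, hu, hz⟩ := exists_eq_of_Dx_eq_zero h1
    refine ⟨u, (isSolGauss_iff_snd a b b' u hu hz).2 h2, ?_⟩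
    rw [hz]; rfl

end Systems

/-! ### Separately holomorphic continuous functions -/

section Osgood

open MeasureTheory Metric
open scoped Real BoundedContinuousFunction

/-- The function `s ↦ ζ(σ s) - c` on the parameter space of a torus, where `ζ` parametrizes the
circle with centre `c` and radius `R`, as a unit of the algebra of bounded continuous functions. -/
def circleUnit (c : ℂ) {R : ℝ} (hR : 0 < R) (σ : C(ℝ × ℝ, ℝ)) : (ℝ × ℝ →ᵇ ℂ)ˣ where
  val := BoundedContinuousFunction.ofNormedAddCommGroup (fun s => circleMap c R (σ s) - c)
    (by fun_prop) R (fun s => by simp [circleMap, abs_of_pos hR])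
  inv := BoundedContinuousFunction.ofNormedAddCommGroup (fun s => (circleMap c R (σ s) - c)⁻¹)
    (by
      refine Continuous.inv₀ (by fun_prop) fun s => ?_
      rw [sub_ne_zero]; exact circleMap_ne_center hR.ne')
    R⁻¹ (fun s => by simp [circleMap, abs_of_pos hR])
  val_inv := by
    ext s
    exact mul_inv_cancel₀ (sub_ne_zero.2 (circleMap_ne_center hR.ne'))
  inv_val := by
    ext s
    exact inv_mul_cancel₀ (sub_ne_zero.2 (circleMap_ne_center hR.ne'))

/-- The Cauchy kernel `s ↦ 1 / (ζ(σ s) - x)` as an element of a Banach algebra, which depends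
analytically on `x`. -/
def cauchyKernel (c : ℂ) {R : ℝ} (hR : 0 < R) (σ : C(ℝ × ℝ, ℝ)) (x : ℂ) : ℝ × ℝ →ᵇ ℂ :=
  Ring.inverse ((circleUnit c hR σ : ℝ × ℝ →ᵇ ℂ) - (x - c) • (1 : ℝ × ℝ →ᵇ ℂ))

theorem analyticAt_cauchyKernel (c : ℂ) {R : ℝ} (hR : 0 < R) (σ : C(ℝ × ℝ, ℝ)) :
    AnalyticAt ℂ (cauchyKernel c hR σ) c := by
  have h : AnalyticAt ℂ (fun x : ℂ => (circleUnit c hR σ : ℝ × ℝ →ᵇ ℂ) -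
      (x - c) • (1 : ℝ × ℝ →ᵇ ℂ)) c :=
    analyticAt_const.sub ((analyticAt_id.sub analyticAt_const).smul analyticAt_const)
  refine AnalyticAt.comp (g := Ring.inverse) ?_ h
  have h2 := analyticAt_inverse (𝕜 := ℂ) (circleUnit c hR σ)
  simpa using h2

theorem eventually_cauchyKernel (c : ℂ) {R : ℝ} (hR : 0 < R) (σ : C(ℝ × ℝ, ℝ)) :
    ∀ᶠ x in 𝓝 c, ∀ s, cauchyKernel c hR σ x s = (circleMap c R (σ s) - x)⁻¹ := by
  have hc : ContinuousAt (fun x : ℂ => (circleUnit c hR σ : ℝ × ℝ →ᵇ ℂ) -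
      (x - c) • (1 : ℝ × ℝ →ᵇ ℂ)) c := by fun_prop
  have hu : ∀ᶠ x in 𝓝 c, IsUnit ((circleUnit c hR σ : ℝ × ℝ →ᵇ ℂ) -
      (x - c) • (1 : ℝ × ℝ →ᵇ ℂ)) := by
    refine hc.eventually_mem (Units.isOpen.mem_nhds ?_)
    simp
  filter_upwards [hu] with x hx s
  have h := congrArg (fun g : ℝ × ℝ →ᵇ ℂ => g s) (Ring.inverse_mul_cancel _ hx)
  have h' : cauchyKernel c hR σ x s * (circleMap c R (σ s) - c - (x - c) * 1) = 1 := h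
  rw [mul_one, sub_sub_sub_cancel_right] at h'
  exact eq_inv_of_mul_eq_one_left h'

/-- Integration against a continuous density over the square `[0, 2π]²`, as a continuous linear
functional. -/
def squareIntegral (F : ℝ × ℝ → ℂ) (hF : Continuous F) : (ℝ × ℝ →ᵇ ℂ) →L[ℂ] ℂ :=
  LinearMap.mkContinuous
    { toFun := fun g => ∫ s in Set.Icc (0 : ℝ) (2 * π) ×ˢ Set.Icc (0 : ℝ) (2 * π), F s * g s
      map_add' := fun g h => by
        have hi : ∀ g : ℝ × ℝ →ᵇ ℂ, IntegrableOn (fun s => F s * g s)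
            (Set.Icc (0 : ℝ) (2 * π) ×ˢ Set.Icc (0 : ℝ) (2 * π)) := fun g =>
          (hF.mul g.continuous).continuousOn.integrableOn_compact (isCompact_Icc.prod isCompact_Icc)
        simp only [BoundedContinuousFunction.add_apply, mul_add]
        exact integral_add (hi g) (hi h)
      map_smul' := fun c g => by
        simp only [BoundedContinuousFunction.smul_apply, smul_eq_mul, RingHom.id_apply,
          ← integral_const_mul]
        congr 1 with s
        ring }
    (∫ s in Set.Icc (0 : ℝ) (2 * π) ×ˢ Set.Icc (0 : ℝ) (2 * π), ‖F s‖)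
    (fun g => by
      rw [LinearMap.coe_mk, AddHom.coe_mk, ← integral_mul_const]
      refine norm_integral_le_of_norm_le ?_ (Eventually.of_forall fun s => ?_)
      · exact (hF.norm.mul continuous_const).continuousOn.integrableOn_compact
          (isCompact_Icc.prod isCompact_Icc)
      · rw [norm_mul]
        exact mul_le_mul_of_nonneg_left (g.norm_coe_le_norm s) (norm_nonneg _))

/-- Osgood's lemma: a continuous function of two complex variables that is holomorphic in each of
them is analytic. By Cauchy's formula on a torus it is the composition of a continuous linear
functional with the Cauchy kernel, an analytic map into a Banach algebra. -/
theorem analyticAt_of_separately {f : ℂ × ℂ → ℂ} {U : Set (ℂ × ℂ)} (hU : IsOpen U)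
    (hc : ContinuousOn f U) (hx : ∀ q ∈ U, DifferentiableAt ℂ (fun x => f (x, q.2)) q.1)
    (hy : ∀ q ∈ U, DifferentiableAt ℂ (fun y => f (q.1, y)) q.2) {p : ℂ × ℂ} (hp : p ∈ U) :
    AnalyticAt ℂ f p := by
  obtain ⟨R, hR, hsub⟩ := nhds_basis_closedBall.mem_iff.1 (hU.mem_nhds hp)
  have hmem : ∀ {x y : ℂ}, x ∈ closedBall p.1 R → y ∈ closedBall p.2 R → (x, y) ∈ U := by
    intro x y h1 h2
    refine hsub ?_
    have : (x, y) ∈ closedBall p.1 R ×ˢ closedBall p.2 R := ⟨h1, h2⟩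
    rwa [closedBall_prod_same] at this
  have hsph : ∀ (c : ℂ) (s : ℝ), circleMap c R s ∈ closedBall c R :=
    fun c s => circleMap_mem_closedBall c hR.le s
  set F : ℝ × ℝ → ℂ := fun s => f (circleMap p.1 R s.2, circleMap p.2 R s.1) *
    (deriv (circleMap p.1 R) s.2 * deriv (circleMap p.2 R) s.1) with hFdef
  have hF : Continuous F := by
    refine Continuous.mul ?_ ?_
    · exact hc.comp_continuous (by fun_prop) fun s => hmem (hsph _ _) (hsph _ _)
    · simp only [deriv_circleMap]
      fun_prop
  set c : ℂ := (2 * π * Complex.I)⁻¹ with hcdef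
  set Λ := squareIntegral F hF
  set G : ℂ × ℂ → ℂ := fun q => c * c * Λ (cauchyKernel p.1 hR ⟨Prod.snd, continuous_snd⟩ q.1 *
    cauchyKernel p.2 hR ⟨Prod.fst, continuous_fst⟩ q.2) with hG
  have hGa : AnalyticAt ℂ G p := by
    refine analyticAt_const.mul ((Λ.analyticAt _).comp (AnalyticAt.mul ?_ ?_))
    · exact (analyticAt_cauchyKernel p.1 hR _).comp analyticAt_fst
    · exact (analyticAt_cauchyKernel p.2 hR _).comp analyticAt_snd
  refine hGa.congr ?_
  have e1 := continuous_fst.continuousAt.eventually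
    (eventually_cauchyKernel p.1 hR ⟨Prod.snd, continuous_snd⟩)
  have e2 := continuous_snd.continuousAt.eventually
    (eventually_cauchyKernel p.2 hR ⟨Prod.fst, continuous_fst⟩)
  filter_upwards [e1, e2, continuous_fst.continuousAt.eventually_mem (ball_mem_nhds p.1 hR),
    continuous_snd.continuousAt.eventually_mem (ball_mem_nhds p.2 hR)] with q h1 h2 h3 h4
  have hpi : (2 * π * Complex.I : ℂ) ≠ 0 := by
    simp [Real.pi_ne_zero]
  have h2pi : (0 : ℝ) ≤ 2 * π := by positivity
  -- Cauchy's formula in each of the variables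
  have inner : ∀ y ∈ closedBall p.2 R,
      ∮ ζ in C(p.1, R), (ζ - q.1)⁻¹ • f (ζ, y) = (2 * π * Complex.I) • f (q.1, y) := by
    intro y hy'
    refine Complex.circleIntegral_sub_inv_smul_of_differentiable_on_off_countable
      (f := fun ζ => f (ζ, y)) Set.countable_empty h3 ?_ ?_
    · exact hc.comp (by fun_prop) fun x hx' => hmem hx' hy'
    · intro x hx'
      exact hx (x, y) (hmem (ball_subset_closedBall hx'.1) hy')
  have outer : ∮ η in C(p.2, R), (η - q.2)⁻¹ • f (q.1, η) = (2 * π * Complex.I) • f q := by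
    refine Complex.circleIntegral_sub_inv_smul_of_differentiable_on_off_countable
      (f := fun η => f (q.1, η)) Set.countable_empty h4 ?_ ?_
    · exact hc.comp (by fun_prop) fun y hy' => hmem (ball_subset_closedBall h3) hy'
    · intro y hy'
      exact hy (q.1, y) (hmem (ball_subset_closedBall h3) (ball_subset_closedBall hy'.1))
  have hΛ : Λ (cauchyKernel p.1 hR ⟨Prod.snd, continuous_snd⟩ q.1 *
      cauchyKernel p.2 hR ⟨Prod.fst, continuous_fst⟩ q.2) =
      (2 * π * Complex.I) * ((2 * π * Complex.I) * f q) := by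
    change ∫ s in Set.Icc (0 : ℝ) (2 * π) ×ˢ Set.Icc (0 : ℝ) (2 * π), F s * _ = _
    rw [Measure.volume_eq_prod, setIntegral_prod]
    · rw [← smul_eq_mul (2 * π * Complex.I) (f q), ← outer, circleIntegral_def_Icc,
        ← integral_const_mul]
      refine setIntegral_congr_fun measurableSet_Icc fun s _ => ?_
      have h5 := inner (circleMap p.2 R s) (hsph _ _)
      rw [circleIntegral_def_Icc] at h5
      simp only [smul_eq_mul] at h5 ⊢
      rw [mul_left_comm, mul_left_comm _ _ (f _), ← h5, ← integral_const_mul,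
        ← integral_const_mul]
      refine setIntegral_congr_fun measurableSet_Icc fun s' _ => ?_
      simp only [BoundedContinuousFunction.mul_apply, h1, h2, ContinuousMap.coe_mk, hFdef]
      ring
    · exact (hF.mul (BoundedContinuousFunction.continuous _)).continuousOn.integrableOn_compact
        (isCompact_Icc.prod isCompact_Icc)
  simp only [hG, hΛ, hcdef]
  field_simp

end Osgood

/-! ### Logarithms along the path of integration -/

/-- A continuous logarithm of a differentiable function is differentiable. -/
theorem hasDerivWithinAt_of_exp_eq {f g : ℝ → ℂ} {s : Set ℝ} {r : ℝ} {g' : ℂ} (hr : r ∈ s)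
    (hf : ContinuousWithinAt f s r) (he : ∀ r' ∈ s, Complex.exp (f r') = g r')
    (hg : HasDerivWithinAt g g' s r) : HasDerivWithinAt f (g' / g r) s r := by
  have h0 : g r ≠ 0 := he r hr ▸ Complex.exp_ne_zero _
  have h1 : HasDerivWithinAt (fun r' => g r' / g r) (g' / g r) s r := hg.div_const _
  have h2 : HasDerivWithinAt (fun r' => f r + Complex.log (g r' / g r))
      (g' / g r / (g r / g r)) s r :=
    (h1.clog_real (by rw [div_self h0]; exact Complex.one_mem_slitPlane)).const_add _
  rw [div_self h0, div_one] at h2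
  refine h2.congr_of_eventuallyEq ?_ (by simp [div_self h0])
  have h3 : ∀ᶠ r' in 𝓝[s] r, ‖f r' - f r‖ < Real.pi := by
    have h4 : Tendsto (fun r' => f r' - f r) (𝓝[s] r) (𝓝 0) := by
      have := Tendsto.sub_const hf (f r)
      rwa [sub_self] at this
    exact (tendsto_zero_iff_norm_tendsto_zero.1 h4).eventually (gt_mem_nhds Real.pi_pos)
  filter_upwards [h3, self_mem_nhdsWithin] with r' h4 h5
  have h6 := abs_lt.1 ((Complex.abs_im_le_norm _).trans_lt h4)
  rw [← he r' h5, ← he r hr, ← Complex.exp_sub, Complex.log_exp h6.1 h6.2.le]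
  ring

/-- `w ^ (c - 1) = w ^ c / w` for a branch of the power. -/
theorem branchPow_sub_one {w₀ ℓ w : ℂ} (h : Complex.exp ℓ = w₀) (hw : w ≠ 0) (c : ℂ) :
    branchPow w₀ ℓ (c - 1) w = branchPow w₀ ℓ c w / w := by
  have := branchPow_add_one h hw (c - 1)
  rw [sub_add_cancel] at this
  rw [this, mul_div_cancel_right₀ _ hw]

theorem ne_zero_of_div_mem_slitPlane {w w₀ : ℂ} (h : w / w₀ ∈ Complex.slitPlane) : w ≠ 0 := by
  rintro rfl
  simp at h

/-- The derivative of a power along a curve `g`, for the branches determined by logarithms of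
another curve `g₀`. -/
theorem hasDerivWithinAt_branchPow_curve {g₀ ℓ g : ℝ → ℂ} {s : Set ℝ} {r : ℝ} {g' c : ℂ}
    (hr : r ∈ s) (hℓ : ContinuousOn ℓ s) (he : ∀ r ∈ s, Complex.exp (ℓ r) = g₀ r)
    (hg₀ : ContinuousOn g₀ s) (hg : ContinuousOn g s)
    (hsl : ∀ r ∈ s, g r / g₀ r ∈ Complex.slitPlane) (hd : HasDerivWithinAt g g' s r) :
    HasDerivWithinAt (fun r => branchPow (g₀ r) (ℓ r) c (g r))
      (c * branchPow (g₀ r) (ℓ r) (c - 1) (g r) * g') s r := by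
  have h0 : ∀ r ∈ s, g₀ r ≠ 0 := fun r hr => he r hr ▸ Complex.exp_ne_zero _
  have h1 : ContinuousWithinAt (fun r => ℓ r + Complex.log (g r / g₀ r)) s r :=
    (hℓ r hr).add (((hg r hr).div (hg₀ r hr) (h0 r hr)).clog (hsl r hr))
  have h2 : ∀ r ∈ s, Complex.exp (ℓ r + Complex.log (g r / g₀ r)) = g r := by
    intro r hr
    have h3 := branchPow_one (he r hr) (ne_zero_of_div_mem_slitPlane (hsl r hr))
    rwa [branchPow, one_mul] at h3
  have h3 := ((hasDerivWithinAt_of_exp_eq hr h1 h2 hd).const_mul c).cexp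
  refine h3.congr_deriv ?_
  rw [branchPow_sub_one (he r hr) (ne_zero_of_div_mem_slitPlane (hsl r hr)), branchPow]
  ring

theorem continuousOn_branchPow_curve {S : Type*} [TopologicalSpace S] {g₀ ℓ g : S → ℂ} {s : Set S}
    {c : ℂ} (hℓ : ContinuousOn ℓ s) (he : ∀ r ∈ s, Complex.exp (ℓ r) = g₀ r)
    (hg₀ : ContinuousOn g₀ s) (hg : ContinuousOn g s)
    (hsl : ∀ r ∈ s, g r / g₀ r ∈ Complex.slitPlane) :
    ContinuousOn (fun r => branchPow (g₀ r) (ℓ r) c (g r)) s := by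
  have h0 : ∀ r ∈ s, g₀ r ≠ 0 := fun r hr => he r hr ▸ Complex.exp_ne_zero _
  exact (continuousOn_const.mul (hℓ.add ((hg.div hg₀ h0).clog hsl))).cexp

namespace BranchedPath

open Set

variable {X₀ t₀ : ℂ} (w : BranchedPath X₀ t₀)

theorem X₀_ne_zero {X₀ t₀ : ℂ} (w : BranchedPath X₀ t₀) : X₀ ≠ 0 := by
  rw [← w.path_one, ← w.exp_logS 1 (by simp)]; exact Complex.exp_ne_zero _

theorem path_ne_zero {r : ℝ} (hr : r ∈ Ioc (0 : ℝ) 1) : w.path r ≠ 0 := by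
  rw [← w.exp_logS r hr]; exact Complex.exp_ne_zero _

theorem one_sub_path_ne_zero {r : ℝ} (hr : r ∈ Icc (0 : ℝ) 1) : 1 - w.path r ≠ 0 := by
  rw [← w.exp_logOneSub r hr]; exact Complex.exp_ne_zero _

theorem t₀_sub_path_ne_zero {r : ℝ} (hr : r ∈ Icc (0 : ℝ) 1) : t₀ - w.path r ≠ 0 := by
  rw [← w.exp_logTSub r hr]; exact Complex.exp_ne_zero _

theorem continuous_path : Continuous w.path := w.contDiff_path.continuous

theorem hasDerivAt_path (r : ℝ) : HasDerivAt w.path (deriv w.path r) r :=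
  (w.contDiff_path.differentiable one_ne_zero r).hasDerivAt

theorem continuous_deriv_path : Continuous (deriv w.path) :=
  w.contDiff_path.continuous_deriv le_rfl

/-- Since the path leaves `0` with nonzero speed, `log s` differs from `log r` by a bounded
function. -/
theorem exists_logS_bound :
    ∃ C, ∀ r ∈ Ioc (0 : ℝ) 1, ‖w.logS r - (Real.log r : ℂ)‖ ≤ C := by
  set d := deriv w.path 0 with hd
  have hd0 : d ≠ 0 := w.deriv_path_zero
  have hslope : Tendsto (fun r : ℝ => w.path r / (r * d)) (𝓝[>] 0) (𝓝 1) := by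
    have h1 := (hasDerivAt_iff_tendsto_slope.1 (w.hasDerivAt_path 0)).mono_left
      (nhdsWithin_mono 0 (fun r (hr : (0 : ℝ) < r) => hr.ne'))
    have h2 := h1.div_const d
    rw [← hd, div_self hd0] at h2
    refine h2.congr fun r => ?_
    rw [slope_def_module, sub_zero, w.path_zero, sub_zero, Complex.real_smul, Complex.ofReal_inv]
    field_simp
  have hlog : Tendsto (fun r : ℝ => Complex.log (w.path r / (r * d))) (𝓝[>] 0) (𝓝 0) := by
    have := hslope.clog Complex.one_mem_slitPlane
    rwa [Complex.log_one] at this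
  obtain ⟨ε, hε, hεs⟩ : ∃ ε > (0 : ℝ), ∀ r ∈ Ioo 0 ε,
      (w.path r / (r * d) ∈ Complex.slitPlane ∧ ‖Complex.log (w.path r / (r * d))‖ < 1) ∧
        r < 1 := by
    have h1 := (hslope.eventually (Complex.isOpen_slitPlane.mem_nhds Complex.one_mem_slitPlane)).and
      ((tendsto_zero_iff_norm_tendsto_zero.1 hlog).eventually (gt_mem_nhds one_pos))
    have h2 := h1.and (nhdsWithin_le_nhds (gt_mem_nhds (zero_lt_one (α := ℝ))))
    obtain ⟨ε, hε, h⟩ := (mem_nhdsGT_iff_exists_Ioo_subset).1 h2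
    exact ⟨ε, hε, fun r hr => h hr⟩
  -- a continuous logarithm of the constant `d`, hence constant near `0`
  set g : ℝ → ℂ := fun r => w.logS r - Real.log r - Complex.log (w.path r / (r * d)) with hg
  have hlogc : ContinuousOn (fun r : ℝ => (Real.log r : ℂ)) (Ioi 0) :=
    Complex.continuous_ofReal.comp_continuousOn
      (Real.continuousOn_log.mono fun r (hr : 0 < r) => hr.ne')
  have hgc : ContinuousOn g (Ioo 0 ε) := by
    refine ((w.continuousOn_logS.mono fun r hr => ⟨hr.1, (hεs r hr).2.le⟩).sub
      (hlogc.mono fun r hr => hr.1)).sub ?_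
    refine ContinuousOn.clog (ContinuousOn.div w.continuous_path.continuousOn (by fun_prop) ?_) ?_
    · intro r hr
      exact mul_ne_zero (Complex.ofReal_ne_zero.2 hr.1.ne') hd0
    · exact fun r hr => (hεs r hr).1.1
  have hge : ∀ r ∈ Ioo 0 ε, Complex.exp (g r) = d := by
    intro r hr
    have h1 : r ∈ Ioc (0 : ℝ) 1 := ⟨hr.1, (hεs r hr).2.le⟩
    have h2 : (r : ℂ) ≠ 0 := Complex.ofReal_ne_zero.2 hr.1.ne'
    have h3 := w.path_ne_zero h1
    rw [hg]
    simp only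
    rw [Complex.exp_sub, Complex.exp_sub, w.exp_logS r h1, ← Complex.ofReal_exp,
      Real.exp_log hr.1, Complex.exp_log (div_ne_zero h3 (mul_ne_zero h2 hd0))]
    field_simp
  have hgd : ∀ r ∈ Ioo 0 ε, HasDerivAt g 0 r := by
    intro r hr
    have := hasDerivWithinAt_of_exp_eq hr (hgc r hr) hge (hasDerivWithinAt_const r _ d)
    rw [zero_div] at this
    exact this.hasDerivAt (Ioo_mem_nhds hr.1 hr.2)
  have hconst : ∀ r ∈ Ioo 0 ε, g r = g (ε / 2) := fun r hr =>
    isOpen_Ioo.is_const_of_deriv_eq_zero isPreconnected_Ioo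
      (fun r hr => (hgd r hr).differentiableAt.differentiableWithinAt)
      (fun r hr => (hgd r hr).deriv) hr ⟨by linarith, by linarith⟩
  obtain ⟨C, hC⟩ := (isCompact_Icc (a := ε / 2) (b := 1)).exists_bound_of_continuousOn
    (f := fun r : ℝ => w.logS r - (Real.log r : ℂ))
    ((w.continuousOn_logS.mono fun r hr => ⟨by linarith [hr.1], hr.2⟩).sub
      (hlogc.mono fun r hr => show 0 < r by linarith [hr.1]))
  refine ⟨max C (‖g (ε / 2)‖ + 1), fun r hr => ?_⟩
  rcases lt_or_ge r (ε / 2) with h | h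
  · have h1 : r ∈ Ioo 0 ε := ⟨hr.1, by linarith⟩
    have h2 : w.logS r - Real.log r = g (ε / 2) + Complex.log (w.path r / (r * d)) := by
      rw [← hconst r h1, hg]; ring
    rw [h2]
    exact ((norm_add_le _ _).trans (add_le_add_right (hεs r h1).1.2.le _)).trans (le_max_right _ _)
  · exact (hC r ⟨h, hr.2⟩).trans (le_max_left _ _)

theorem exists_norm_exp_logS_le (α : ℂ) :
    ∃ C, 0 ≤ C ∧ ∀ r ∈ Ioc (0 : ℝ) 1, ‖Complex.exp (α * w.logS r)‖ ≤ C * r ^ α.re := by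
  obtain ⟨C, hC⟩ := w.exists_logS_bound
  refine ⟨Real.exp (‖α‖ * C), (Real.exp_pos _).le, fun r hr => ?_⟩
  have h1 : α * w.logS r = α * (w.logS r - (Real.log r : ℂ)) + α * (Real.log r : ℂ) := by ring
  rw [h1, Complex.exp_add, norm_mul, Complex.norm_exp, Complex.norm_exp, Complex.re_mul_ofReal,
    Real.rpow_def_of_pos hr.1, mul_comm (Real.log r)]
  refine mul_le_mul_of_nonneg_right (Real.exp_le_exp.2 ?_) (Real.exp_pos _).le
  exact (Complex.re_le_norm _).trans ((norm_mul _ _).trans_le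
    (mul_le_mul_of_nonneg_left (hC r hr) (norm_nonneg _)))

/-! ### The integrand for nearby endpoints -/

/-- The pairs `(X, t)` near `(X₀, t₀)` for which all branches are given by the principal logarithm
of a quotient. -/
def domain : Set (ℂ × ℂ) :=
  interior {q | q.1 / X₀ ∈ Complex.slitPlane ∧ ∀ r ∈ Icc (0 : ℝ) 1,
    (1 - w.pathTo q.1 r) / (1 - w.path r) ∈ Complex.slitPlane ∧
    (q.2 - w.pathTo q.1 r) / (t₀ - w.path r) ∈ Complex.slitPlane}

theorem isOpen_domain : IsOpen w.domain := isOpen_interior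

theorem mem_domain_self : (X₀, t₀) ∈ w.domain := by
  rw [domain, mem_interior_iff_mem_nhds]
  have hX := w.X₀_ne_zero
  have hpath : w.pathTo X₀ = w.path := by
    ext r; rw [pathTo, div_self hX, one_mul]
  have h1 : ∀ᶠ q : ℂ × ℂ in 𝓝 (X₀, t₀), q.1 / X₀ ∈ Complex.slitPlane := by
    have hc : ContinuousAt (fun q : ℂ × ℂ => q.1 / X₀) (X₀, t₀) := by fun_prop
    exact hc.eventually_mem (Complex.isOpen_slitPlane.mem_nhds (div_self_mem_slitPlane hX))
  have h2 : ∀ᶠ q : ℂ × ℂ in 𝓝 (X₀, t₀), ∀ r ∈ Icc (0 : ℝ) 1,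
      (1 - w.pathTo q.1 r) / (1 - w.path r) ∈ Complex.slitPlane ∧
      (q.2 - w.pathTo q.1 r) / (t₀ - w.path r) ∈ Complex.slitPlane := by
    refine isCompact_Icc.eventually_forall_of_forall_eventually fun r hr => ?_
    have hp := w.continuous_path
    have hc1 : ContinuousAt (fun z : (ℂ × ℂ) × ℝ =>
        (1 - w.pathTo z.1.1 z.2) / (1 - w.path z.2)) ((X₀, t₀), r) := by
      refine ContinuousAt.div ?_ (by fun_prop) (w.one_sub_path_ne_zero hr)
      simp only [pathTo]; fun_prop
    have hc2 : ContinuousAt (fun z : (ℂ × ℂ) × ℝ =>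
        (z.1.2 - w.pathTo z.1.1 z.2) / (t₀ - w.path z.2)) ((X₀, t₀), r) := by
      refine ContinuousAt.div ?_ (by fun_prop) (w.t₀_sub_path_ne_zero hr)
      simp only [pathTo]; fun_prop
    refine (hc1.eventually_mem (Complex.isOpen_slitPlane.mem_nhds ?_)).and
      (hc2.eventually_mem (Complex.isOpen_slitPlane.mem_nhds ?_))
    · simp only [hpath]
      exact div_self_mem_slitPlane (w.one_sub_path_ne_zero hr)
    · simp only [hpath]
      exact div_self_mem_slitPlane (w.t₀_sub_path_ne_zero hr)
  exact h1.and h2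

variable {w} {q : ℂ × ℂ}

theorem div_X₀_mem (hq : q ∈ w.domain) : q.1 / X₀ ∈ Complex.slitPlane := (interior_subset hq).1

theorem one_sub_mem (hq : q ∈ w.domain) {r : ℝ} (hr : r ∈ Icc (0 : ℝ) 1) :
    (1 - w.pathTo q.1 r) / (1 - w.path r) ∈ Complex.slitPlane := ((interior_subset hq).2 r hr).1

theorem t_sub_mem (hq : q ∈ w.domain) {r : ℝ} (hr : r ∈ Icc (0 : ℝ) 1) :
    (q.2 - w.pathTo q.1 r) / (t₀ - w.path r) ∈ Complex.slitPlane :=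
  ((interior_subset hq).2 r hr).2

theorem fst_ne_zero (hq : q ∈ w.domain) : q.1 ≠ 0 := ne_zero_of_div_mem_slitPlane (div_X₀_mem hq)

theorem div_t₀_mem (hq : q ∈ w.domain) : q.2 / t₀ ∈ Complex.slitPlane := by
  have := t_sub_mem hq (r := 0) (by simp)
  rwa [pathTo, w.path_zero, mul_zero, sub_zero, sub_zero] at this

theorem snd_ne_zero (hq : q ∈ w.domain) : q.2 ≠ 0 := ne_zero_of_div_mem_slitPlane (div_t₀_mem hq)

theorem pathTo_one (X : ℂ) : w.pathTo X 1 = X := by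
  rw [pathTo, w.path_one, div_mul_cancel₀ _ w.X₀_ne_zero]

theorem pathTo_zero (X : ℂ) : w.pathTo X 0 = 0 := by
  rw [pathTo, w.path_zero, mul_zero]

theorem hasDerivAt_pathTo (X : ℂ) (r : ℝ) :
    HasDerivAt (w.pathTo X) (X / X₀ * deriv w.path r) r := (w.hasDerivAt_path r).const_mul _

theorem continuous_pathTo (X : ℂ) : Continuous (w.pathTo X) :=
  continuous_const.mul w.continuous_path

theorem pathTo_ne_zero (hq : q ∈ w.domain) {r : ℝ} (hr : r ∈ Ioc (0 : ℝ) 1) : w.pathTo q.1 r ≠ 0 :=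
  mul_ne_zero (div_ne_zero (fst_ne_zero hq) w.X₀_ne_zero) (w.path_ne_zero hr)

theorem powS_eq (α X : ℂ) {r : ℝ} (hr : r ∈ Ioc (0 : ℝ) 1) :
    w.powS α X r = Complex.exp (α * w.logS r) * Complex.exp (α * Complex.log (X / X₀)) := by
  rw [powS, branchPow, pathTo, mul_div_cancel_right₀ _ (w.path_ne_zero hr), mul_add,
    Complex.exp_add]

theorem powS_add_one (hq : q ∈ w.domain) (α : ℂ) {r : ℝ} (hr : r ∈ Ioc (0 : ℝ) 1) :
    w.powS (α + 1) q.1 r = w.powS α q.1 r * w.pathTo q.1 r :=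
  branchPow_add_one (w.exp_logS r hr) (pathTo_ne_zero hq hr) α

theorem hasDerivWithinAt_powS (hq : q ∈ w.domain) (α : ℂ) {r : ℝ} (hr : r ∈ Ioc (0 : ℝ) 1) :
    HasDerivWithinAt (w.powS (α + 1) q.1)
      ((α + 1) * w.powS α q.1 r * (q.1 / X₀ * deriv w.path r)) (Ioc 0 1) r := by
  have := hasDerivWithinAt_branchPow_curve (c := α + 1) hr w.continuousOn_logS w.exp_logS
    w.continuous_path.continuousOn (w.continuous_pathTo q.1).continuousOn
    (fun r hr => by
      rw [pathTo, mul_div_cancel_right₀ _ (w.path_ne_zero hr)]; exact div_X₀_mem hq)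
    (w.hasDerivAt_pathTo q.1 r).hasDerivWithinAt
  rwa [add_sub_cancel_right] at this

theorem exists_norm_powS_le (α : ℂ) :
    ∃ C, 0 ≤ C ∧ ∀ r ∈ Ioc (0 : ℝ) 1, ‖w.powS α q.1 r‖ ≤ C * r ^ α.re := by
  obtain ⟨C, h0, hC⟩ := w.exists_norm_exp_logS_le α
  refine ⟨C * ‖Complex.exp (α * Complex.log (q.1 / X₀))‖, by positivity, fun r hr => ?_⟩
  rw [powS_eq α _ hr, norm_mul, mul_right_comm]
  exact mul_le_mul_of_nonneg_right (hC r hr) (norm_nonneg _)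

theorem hasDerivWithinAt_powRest (hq : q ∈ w.domain) (β δ : ℂ) {r : ℝ} (hr : r ∈ Icc (0 : ℝ) 1) :
    HasDerivWithinAt (w.powRest β δ q.1 q.2)
      ((q.1 / X₀ * deriv w.path r) * -(β * w.powRest (β - 1) δ q.1 q.2 r +
        δ * w.powRest β (δ - 1) q.1 q.2 r)) (Icc 0 1) r := by
  have h1 := hasDerivWithinAt_branchPow_curve (c := β) hr w.continuousOn_logOneSub w.exp_logOneSub
    (by have := w.continuous_path; fun_prop)
    (by have := w.continuous_pathTo q.1; fun_prop) (fun r hr => one_sub_mem hq hr)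
    ((w.hasDerivAt_pathTo q.1 r).const_sub 1).hasDerivWithinAt
  have h2 := hasDerivWithinAt_branchPow_curve (c := δ) hr w.continuousOn_logTSub w.exp_logTSub
    (by have := w.continuous_path; fun_prop)
    (by have := w.continuous_pathTo q.1; fun_prop) (fun r hr => t_sub_mem hq hr)
    ((w.hasDerivAt_pathTo q.1 r).const_sub q.2).hasDerivWithinAt
  refine (h1.mul h2).congr_deriv ?_
  simp only [powRest]
  ring

theorem hasDerivAt_powRest_fst (hq : q ∈ w.domain) (β δ : ℂ) {r : ℝ} (hr : r ∈ Icc (0 : ℝ) 1) :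
    HasDerivAt (fun X => w.powRest β δ X q.2 r)
      ((w.path r / X₀) * -(β * w.powRest (β - 1) δ q.1 q.2 r +
        δ * w.powRest β (δ - 1) q.1 q.2 r)) q.1 := by
  have h0 : HasDerivAt (fun X => w.pathTo X r) (1 / X₀ * w.path r) q.1 :=
    ((hasDerivAt_id q.1).div_const X₀).mul_const _
  have h1 := (hasDerivAt_branchPow (c := β) (w.exp_logOneSub r hr) (one_sub_mem hq hr)).comp q.1
    (h0.const_sub 1)
  have h2 := (hasDerivAt_branchPow (c := δ) (w.exp_logTSub r hr) (t_sub_mem hq hr)).comp q.1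
    (h0.const_sub q.2)
  refine (h1.mul h2).congr_deriv ?_
  simp only [powRest, Function.comp]
  ring

theorem hasDerivAt_powRest_snd (hq : q ∈ w.domain) (β δ : ℂ) {r : ℝ} (hr : r ∈ Icc (0 : ℝ) 1) :
    HasDerivAt (fun t => w.powRest β δ q.1 t r) (δ * w.powRest β (δ - 1) q.1 q.2 r) q.2 := by
  have h2 := (hasDerivAt_branchPow (c := δ) (w.exp_logTSub r hr) (t_sub_mem hq hr)).comp q.2
    ((hasDerivAt_id q.2).sub_const (w.pathTo q.1 r))
  refine (h2.const_mul _).congr_deriv ?_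
  simp only [powRest]
  ring

theorem continuousOn_powRest (β δ : ℂ) :
    ContinuousOn (fun z : (ℂ × ℂ) × ℝ => w.powRest β δ z.1.1 z.1.2 z.2)
      (w.domain ×ˢ Icc (0 : ℝ) 1) := by
  have hp := w.continuous_path
  refine ContinuousOn.mul ?_ ?_
  · refine continuousOn_branchPow_curve (g₀ := fun z : (ℂ × ℂ) × ℝ => 1 - w.path z.2)
      (ℓ := fun z => w.logOneSub z.2) (g := fun z => 1 - w.pathTo z.1.1 z.2)
      (w.continuousOn_logOneSub.comp (by fun_prop) fun z hz => hz.2)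
      (fun z hz => w.exp_logOneSub _ hz.2) (by fun_prop) (by simp only [pathTo]; fun_prop)
      (fun z hz => one_sub_mem hz.1 hz.2)
  · refine continuousOn_branchPow_curve (g₀ := fun z : (ℂ × ℂ) × ℝ => t₀ - w.path z.2)
      (ℓ := fun z => w.logTSub z.2) (g := fun z => z.1.2 - w.pathTo z.1.1 z.2)
      (w.continuousOn_logTSub.comp (by fun_prop) fun z hz => hz.2)
      (fun z hz => w.exp_logTSub _ hz.2) (by fun_prop) (by simp only [pathTo]; fun_prop)
      (fun z hz => t_sub_mem hz.1 hz.2)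

theorem one_sub_pathTo_ne_zero (hq : q ∈ w.domain) {r : ℝ} (hr : r ∈ Icc (0 : ℝ) 1) : 1 - w.pathTo
    q.1 r ≠ 0 :=
  ne_zero_of_div_mem_slitPlane (one_sub_mem hq hr)

theorem t_sub_pathTo_ne_zero (hq : q ∈ w.domain) {r : ℝ} (hr : r ∈ Icc (0 : ℝ) 1) : q.2 - w.pathTo
    q.1 r ≠ 0 :=
  ne_zero_of_div_mem_slitPlane (t_sub_mem hq hr)

theorem powRest_add_one_left (hq : q ∈ w.domain) (β δ : ℂ) {r : ℝ} (hr : r ∈ Icc (0 : ℝ) 1) :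
    w.powRest (β + 1) δ q.1 q.2 r = (1 - w.pathTo q.1 r) * w.powRest β δ q.1 q.2 r := by
  rw [powRest, branchPow_add_one (w.exp_logOneSub r hr) (one_sub_pathTo_ne_zero hq hr), powRest]
  ring

theorem powRest_add_one_right (hq : q ∈ w.domain) (β δ : ℂ) {r : ℝ} (hr : r ∈ Icc (0 : ℝ) 1) :
    w.powRest β (δ + 1) q.1 q.2 r = (q.2 - w.pathTo q.1 r) * w.powRest β δ q.1 q.2 r := by
  rw [powRest, branchPow_add_one (w.exp_logTSub r hr) (t_sub_pathTo_ne_zero hq hr), powRest]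
  ring

theorem continuousOn_powRest_right (hq : q ∈ w.domain) (β δ : ℂ) :
    ContinuousOn (w.powRest β δ q.1 q.2) (Icc (0 : ℝ) 1) :=
  (w.continuousOn_powRest β δ).comp (f := fun r : ℝ => (q, r)) (by fun_prop) fun _ hr => ⟨hq, hr⟩

end BranchedPath

/-! ### Taylor expansion of the integrand at the start of the path -/

theorem ascPochhammer_div_factorial_succ (β : ℂ) (k : ℕ) :
    ((k + 1 : ℕ) : ℂ) * ((ascPochhammer ℂ (k + 1)).eval (-β) / ((k + 1).factorial : ℂ)) =
      -β * ((ascPochhammer ℂ k).eval (-(β - 1)) / (k.factorial : ℂ)) := by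
  have h1 : ((k + 1 : ℕ) : ℂ) ≠ 0 := Nat.cast_ne_zero.2 k.succ_ne_zero
  have h2 : (k.factorial : ℂ) ≠ 0 := Nat.cast_ne_zero.2 k.factorial_ne_zero
  rw [ascPochhammer_succ_left, Nat.factorial_succ, Nat.cast_mul]
  simp only [Polynomial.eval_mul, Polynomial.eval_X, Polynomial.eval_comp, Polynomial.eval_add,
    Polynomial.eval_one]
  rw [show -(β - 1) = -β + 1 by ring]
  field_simp

/-- The product rule for the coefficients of a product of power series. -/
theorem succ_mul_sum_antidiagonal (U V : ℕ → ℂ) (n : ℕ) :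
    ((n + 1 : ℕ) : ℂ) * ∑ ij ∈ Finset.HasAntidiagonal.antidiagonal (n + 1), U ij.1 * V ij.2 =
      (∑ ij ∈ Finset.HasAntidiagonal.antidiagonal n, ((ij.1 + 1 : ℕ) : ℂ) * U (ij.1 + 1) * V ij.2) +
        ∑ ij ∈ Finset.HasAntidiagonal.antidiagonal n,
          U ij.1 * (((ij.2 + 1 : ℕ) : ℂ) * V (ij.2 + 1)) := by
  have h : ((n + 1 : ℕ) : ℂ) * ∑ ij ∈ Finset.HasAntidiagonal.antidiagonal (n + 1), U ij.1 * V ij.2 =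
      (∑ ij ∈ Finset.HasAntidiagonal.antidiagonal (n + 1), (ij.1 : ℂ) * U ij.1 * V ij.2) +
        ∑ ij ∈ Finset.HasAntidiagonal.antidiagonal (n + 1), U ij.1 * ((ij.2 : ℂ) * V ij.2) := by
    rw [Finset.mul_sum, ← Finset.sum_add_distrib]
    refine Finset.sum_congr rfl fun ij hij => ?_
    rw [← Finset.HasAntidiagonal.mem_antidiagonal.1 hij]
    push_cast
    ring
  rw [h, Finset.Nat.sum_antidiagonal_succ (f := fun ij => (ij.1 : ℂ) * U ij.1 * V ij.2),
    Finset.Nat.sum_antidiagonal_succ' (f := fun ij => U ij.1 * ((ij.2 : ℂ) * V ij.2))]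
  simp

namespace BranchedPath

open Set

variable {X₀ t₀ : ℂ} {w : BranchedPath X₀ t₀}

/-- Comparing coefficients in `h' = -β h / (1 - s) - δ h / (t - s)`. -/
theorem coeff_succ (β δ : ℂ) {t : ℂ} (ht : t ≠ 0) (n : ℕ) :
    ((n + 1 : ℕ) : ℂ) * w.coeff β δ t (n + 1) =
      -(β * w.coeff (β - 1) δ t n + δ * w.coeff β (δ - 1) t n) := by
  set U : ℂ → ℕ → ℂ := fun β k => (ascPochhammer ℂ k).eval (-β) / (k.factorial : ℂ) with hU
  have hc : ∀ β δ n, w.coeff β δ t n =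
      branchPow 1 (w.logOneSub 0) β 1 * branchPow t₀ (w.logTSub 0) δ t *
        ∑ ij ∈ Finset.HasAntidiagonal.antidiagonal n, U β ij.1 * (U δ ij.2 / t ^ ij.2) := by
    intro β δ n
    rw [← Finset.Nat.sum_antidiagonal_swap,
      Finset.Nat.sum_antidiagonal_eq_sum_range_succ_mk, coeff]
    refine congrArg _ (Finset.sum_congr rfl fun j _ => ?_)
    simp only [hU, Prod.swap]
    ring
  have e1 : branchPow 1 (w.logOneSub 0) (β - 1) 1 = branchPow 1 (w.logOneSub 0) β 1 := by
    have h := w.exp_logOneSub 0 (by simp)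
    rw [w.path_zero, sub_zero] at h
    rw [branchPow_sub_one h one_ne_zero, div_one]
  have e2 : branchPow t₀ (w.logTSub 0) (δ - 1) t = branchPow t₀ (w.logTSub 0) δ t / t := by
    have h := w.exp_logTSub 0 (by simp)
    rw [w.path_zero, sub_zero] at h
    rw [branchPow_sub_one h ht]
  have e3 : ∀ β k, ((k + 1 : ℕ) : ℂ) * U β (k + 1) = -β * U (β - 1) k :=
    ascPochhammer_div_factorial_succ
  rw [hc, hc, hc, mul_left_comm, succ_mul_sum_antidiagonal (U β) (fun j => U δ j / t ^ j), e1, e2]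
  simp only [e3, ← mul_div_assoc]
  simp only [mul_add, Finset.mul_sum, ← Finset.sum_add_distrib, ← Finset.sum_neg_distrib]
  refine Finset.sum_congr rfl fun ij _ => ?_
  rw [pow_succ]
  field_simp
  ring

variable (w) in
/-- The remainder of the Taylor polynomial of `(1 - s) ^ β (t - s) ^ δ` of degree `< N` at `s = 0`,
along the path to `X`. -/
def remainder (β δ X t : ℂ) (N : ℕ) (r : ℝ) : ℂ :=
  w.powRest β δ X t r - ∑ n ∈ Finset.range N, w.coeff β δ t n * w.pathTo X r ^ n

theorem remainder_zero (β δ X t : ℂ) : w.remainder β δ X t 0 = w.powRest β δ X t := by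
  ext r; simp [remainder]

variable {q : ℂ × ℂ}

theorem hasDerivWithinAt_remainder (hq : q ∈ w.domain) (β δ : ℂ) (N : ℕ) {r : ℝ}
    (hr : r ∈ Icc (0 : ℝ) 1) :
    HasDerivWithinAt (w.remainder β δ q.1 q.2 N)
      ((q.1 / X₀ * deriv w.path r) * -(β * w.remainder (β - 1) δ q.1 q.2 (N - 1) r +
        δ * w.remainder β (δ - 1) q.1 q.2 (N - 1) r)) (Icc 0 1) r := by
  have h1 : HasDerivWithinAt
      (fun r => ∑ n ∈ Finset.range N, w.coeff β δ q.2 n * w.pathTo q.1 r ^ n)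
      (∑ n ∈ Finset.range N, w.coeff β δ q.2 n *
        (n * w.pathTo q.1 r ^ (n - 1) * (q.1 / X₀ * deriv w.path r))) (Icc 0 1) r :=
    HasDerivWithinAt.fun_sum fun n _ =>
      (((w.hasDerivAt_pathTo q.1 r).fun_pow n).hasDerivWithinAt).const_mul _
  refine ((hasDerivWithinAt_powRest hq β δ hr).sub h1).congr_deriv ?_
  have h2 : ∑ n ∈ Finset.range N, w.coeff β δ q.2 n *
        (n * w.pathTo q.1 r ^ (n - 1) * (q.1 / X₀ * deriv w.path r)) =
      (q.1 / X₀ * deriv w.path r) * -∑ n ∈ Finset.range (N - 1),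
        (β * w.coeff (β - 1) δ q.2 n + δ * w.coeff β (δ - 1) q.2 n) * w.pathTo q.1 r ^ n := by
    rcases N with _ | N
    · simp
    · rw [Finset.sum_range_succ', Nat.add_sub_cancel, ← Finset.sum_neg_distrib, Finset.mul_sum]
      simp only [Nat.cast_zero, zero_mul, mul_zero, add_zero]
      refine Finset.sum_congr rfl fun n _ => ?_
      have := coeff_succ (w := w) β δ (snd_ne_zero hq) n
      rw [Nat.add_sub_cancel]
      linear_combination (w.pathTo q.1 r ^ n * (q.1 / X₀ * deriv w.path r)) * this
  rw [h2]
  simp only [remainder, add_mul, Finset.sum_add_distrib, mul_assoc, ← Finset.mul_sum]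
  ring

/-- Taylor's theorem along the path, by induction on the order. -/
theorem exists_norm_remainder_le (hq : q ∈ w.domain) (N : ℕ) : ∀ β δ : ℂ,
    ∃ C, 0 ≤ C ∧ ∀ r ∈ Icc (0 : ℝ) 1, ‖w.remainder β δ q.1 q.2 N r‖ ≤ C * r ^ N := by
  induction N with
  | zero =>
    intro β δ
    obtain ⟨C, hC⟩ := isCompact_Icc.exists_bound_of_continuousOn (continuousOn_powRest_right hq β δ)
    refine ⟨C, (norm_nonneg _).trans (hC 0 (by simp)), fun r hr => ?_⟩
    rw [remainder_zero, pow_zero, mul_one]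
    exact hC r hr
  | succ N ih =>
    intro β δ
    obtain ⟨C₁, h₁, hC₁⟩ := ih (β - 1) δ
    obtain ⟨C₂, h₂, hC₂⟩ := ih β (δ - 1)
    obtain ⟨M, hM⟩ := (isCompact_Icc (a := (0 : ℝ)) (b := 1)).exists_bound_of_continuousOn
      (f := fun r => q.1 / X₀ * deriv w.path r)
      (continuous_const.mul w.continuous_deriv_path).continuousOn
    have hM0 : 0 ≤ M := (norm_nonneg _).trans (hM 0 (by simp))
    refine ⟨M * (‖β‖ * C₁ + ‖δ‖ * C₂), by positivity, fun r hr => ?_⟩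
    have h0 : w.remainder β δ q.1 q.2 (N + 1) 0 = 0 := by
      rw [remainder, Finset.sum_range_succ', pathTo_zero]
      simp [powRest, coeff, w.path_zero, pathTo_zero]
    have hsub : Icc 0 r ⊆ Icc (0 : ℝ) 1 := Icc_subset_Icc_right hr.2
    have := norm_image_sub_le_of_norm_deriv_le_segment' (a := 0) (b := r)
      (C := M * (‖β‖ * C₁ + ‖δ‖ * C₂) * r ^ N)
      (fun x hx => (hasDerivWithinAt_remainder hq β δ (N + 1) (hsub hx)).mono hsub) ?_ r
      ⟨hr.1, le_rfl⟩
    · rw [h0, sub_zero, sub_zero, mul_assoc, ← pow_succ] at this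
      exact this
    · intro x hx
      have hx1 : x ∈ Icc (0 : ℝ) 1 := hsub ⟨hx.1, hx.2.le⟩
      have hpow : x ^ N ≤ r ^ N := pow_le_pow_left₀ hx.1 hx.2.le N
      rw [norm_mul, norm_neg, Nat.add_sub_cancel, mul_assoc M]
      refine mul_le_mul (hM x hx1) ?_ (norm_nonneg _) hM0
      refine (norm_add_le _ _).trans ?_
      rw [norm_mul, norm_mul, add_mul, mul_assoc, mul_assoc]
      refine add_le_add (mul_le_mul_of_nonneg_left ?_ (norm_nonneg _))
        (mul_le_mul_of_nonneg_left ?_ (norm_nonneg _))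
      · exact (hC₁ x hx1).trans (mul_le_mul_of_nonneg_left hpow h₁)
      · exact (hC₂ x hx1).trans (mul_le_mul_of_nonneg_left hpow h₂)

theorem continuousOn_remainder (hq : q ∈ w.domain) (β δ : ℂ) (N : ℕ) :
    ContinuousOn (w.remainder β δ q.1 q.2 N) (Icc 0 1) :=
  fun _ hr => (hasDerivWithinAt_remainder hq β δ N hr).continuousWithinAt

/-! ### Integration by parts for the finite part -/

theorem exists_norm_powS_mul_remainder_le (hq : q ∈ w.domain) (α β δ : ℂ) (N : ℕ) :
    ∃ C, ∀ r ∈ Ioc (0 : ℝ) 1,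
      ‖w.powS α q.1 r * w.remainder β δ q.1 q.2 N r‖ ≤ C * r ^ (α.re + N) := by
  obtain ⟨C₁, h₁, hC₁⟩ := w.exists_norm_powS_le (q := q) α
  obtain ⟨C₂, h₂, hC₂⟩ := exists_norm_remainder_le hq N β δ
  refine ⟨C₁ * C₂, fun r hr => ?_⟩
  rw [norm_mul, Real.rpow_add hr.1, Real.rpow_natCast, mul_mul_mul_comm]
  exact mul_le_mul (hC₁ r hr) (hC₂ r ⟨hr.1.le, hr.2⟩) (norm_nonneg _)
    (mul_nonneg h₁ (Real.rpow_nonneg hr.1.le _))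

theorem continuousOn_powS (hq : q ∈ w.domain) (α : ℂ) :
    ContinuousOn (w.powS α q.1) (Ioc 0 1) := fun r hr => by
  have := (hasDerivWithinAt_powS hq (α - 1) hr).continuousWithinAt
  rwa [sub_add_cancel] at this

theorem intervalIntegrable_integrand (hq : q ∈ w.domain) (α β δ : ℂ) {N : ℕ} (h : -1 < α.re + N) :
    IntervalIntegrable (fun r => w.powS α q.1 r * w.remainder β δ q.1 q.2 N r *
      (q.1 / X₀ * deriv w.path r)) MeasureTheory.volume 0 1 := by
  obtain ⟨C, hC⟩ := exists_norm_powS_mul_remainder_le hq α β δ N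
  obtain ⟨M, hM⟩ := (isCompact_Icc (a := (0 : ℝ)) (b := 1)).exists_bound_of_continuousOn
    (f := fun r => q.1 / X₀ * deriv w.path r)
    (continuous_const.mul w.continuous_deriv_path).continuousOn
  refine IntervalIntegrable.mono_fun' (g := fun r => C * r ^ (α.re + N) * M)
    (((intervalIntegral.intervalIntegrable_rpow' h).const_mul C).mul_const M) ?_ ?_
  · rw [uIoc_of_le zero_le_one]
    refine ContinuousOn.aestronglyMeasurable (ContinuousOn.mul (ContinuousOn.mul
      (continuousOn_powS hq α) ((continuousOn_remainder hq β δ N).mono Ioc_subset_Icc_self))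
      (continuous_const.mul w.continuous_deriv_path).continuousOn) measurableSet_Ioc
  · rw [uIoc_of_le zero_le_one]
    refine (MeasureTheory.ae_restrict_iff' measurableSet_Ioc).2
      (Eventually.of_forall fun r hr => ?_)
    refine (norm_mul _ _).trans_le ?_
    exact mul_le_mul (hC r hr) (hM r ⟨hr.1.le, hr.2⟩) (norm_nonneg _)
      ((norm_nonneg _).trans (hC r hr))

/-- Integration by parts of the regularized integral. For the given `N` the boundary term at `0`
vanishes. -/
theorem integral_by_parts (hq : q ∈ w.domain) (α β δ : ℂ) {N : ℕ} (h : -1 < α.re + N) :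
    (α + 1) * (∫ r in (0 : ℝ)..1, w.powS α q.1 r * w.remainder β δ q.1 q.2 N r *
        (q.1 / X₀ * deriv w.path r)) =
      w.powS (α + 1) q.1 1 * w.remainder β δ q.1 q.2 N 1 +
        (β * (∫ r in (0 : ℝ)..1, w.powS (α + 1) q.1 r * w.remainder (β - 1) δ q.1 q.2 (N - 1) r *
          (q.1 / X₀ * deriv w.path r)) +
        δ * (∫ r in (0 : ℝ)..1, w.powS (α + 1) q.1 r * w.remainder β (δ - 1) q.1 q.2 (N - 1) r *
          (q.1 / X₀ * deriv w.path r))) := by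
  have h' : -1 < (α + 1).re + (N - 1 : ℕ) := by
    have h1 : (N : ℝ) ≤ (N - 1 : ℕ) + 1 := by exact_mod_cast Nat.le_succ_of_pred_le le_rfl
    rw [Complex.add_re, Complex.one_re]
    linarith
  have i1 := (intervalIntegrable_integrand hq α β δ h).const_mul (α + 1)
  have i2 := (intervalIntegrable_integrand hq (α + 1) (β - 1) δ h').const_mul β
  have i3 := (intervalIntegrable_integrand hq (α + 1) β (δ - 1) h').const_mul δ
  set Ψ : ℝ → ℂ := fun r => w.powS (α + 1) q.1 r * w.remainder β δ q.1 q.2 N r with hΨ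
  have hd : ∀ r ∈ Ioc (0 : ℝ) 1, HasDerivWithinAt Ψ
      ((α + 1) * (w.powS α q.1 r * w.remainder β δ q.1 q.2 N r * (q.1 / X₀ * deriv w.path r)) -
        (β * (w.powS (α + 1) q.1 r * w.remainder (β - 1) δ q.1 q.2 (N - 1) r *
          (q.1 / X₀ * deriv w.path r)) +
        δ * (w.powS (α + 1) q.1 r * w.remainder β (δ - 1) q.1 q.2 (N - 1) r *
          (q.1 / X₀ * deriv w.path r)))) (Ioc 0 1) r := by
    intro r hr
    refine ((hasDerivWithinAt_powS hq α hr).mul ((hasDerivWithinAt_remainder hq β δ N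
      (Ioc_subset_Icc_self hr)).mono Ioc_subset_Icc_self)).congr_deriv ?_
    ring
  -- the boundary value at `0` vanishes, since `Ψ` is of order `r ^ (re α + 1 + N)`
  have hlim0 : Tendsto Ψ (𝓝[>] 0) (𝓝 0) := by
    obtain ⟨C, hC⟩ := exists_norm_powS_mul_remainder_le hq (α + 1) β δ N
    have hpos : 0 < (α + 1).re + N := by
      rw [Complex.add_re, Complex.one_re]; linarith
    have h1 : Tendsto (fun r : ℝ => C * r ^ ((α + 1).re + N)) (𝓝[>] 0) (𝓝 0) := by
      have h2 : Tendsto (fun r : ℝ => C * r ^ ((α + 1).re + N)) (𝓝 0)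
          (𝓝 (C * 0 ^ ((α + 1).re + N))) :=
        (Real.continuousAt_rpow_const 0 _ (Or.inr hpos.le)).const_mul C
      rw [Real.zero_rpow hpos.ne', mul_zero] at h2
      exact h2.mono_left nhdsWithin_le_nhds
    refine squeeze_zero_norm' ?_ h1
    filter_upwards [Ioc_mem_nhdsGT (zero_lt_one (α := ℝ))] with r hr
    exact hC r hr
  have hlim1 : Tendsto Ψ (𝓝[<] 1) (𝓝 (Ψ 1)) := by
    have h1 := (hd 1 (by simp)).continuousWithinAt
    refine h1.mono_left ?_
    rw [← nhdsWithin_Ioo_eq_nhdsLT (zero_lt_one (α := ℝ))]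
    exact nhdsWithin_mono 1 Ioo_subset_Ioc_self
  have key := intervalIntegral.integral_eq_sub_of_hasDerivAt_of_tendsto (zero_lt_one (α := ℝ))
    (fun r hr => (hd r (Ioo_subset_Ioc_self hr)).hasDerivAt (Ioc_mem_nhds hr.1 hr.2))
    (i1.sub (i2.add i3)) hlim0 hlim1
  rw [intervalIntegral.integral_sub i1 (i2.add i3), intervalIntegral.integral_add i2 i3,
    intervalIntegral.integral_const_mul, intervalIntegral.integral_const_mul,
    intervalIntegral.integral_const_mul, sub_zero] at key
  linear_combination key

theorem indefInt_eq_remainder (α β δ X t : ℂ) :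
    w.indefInt α β δ X t =
      (∫ r in (0 : ℝ)..1, w.powS α X r * w.remainder β δ X t (order α) r *
        (X / X₀ * deriv w.path r)) +
      ∑ n ∈ Finset.range (order α),
        w.coeff β δ t n * w.powS (α + n + 1) X 1 / (α + n + 1) := by
  simp only [indefInt, remainder, powS, w.path_one, w.pathTo_one]

theorem order_add_one (α : ℂ) : order (α + 1) = order α - 1 := by
  rw [order, order, ← Nat.floor_sub_one, Complex.add_re, Complex.one_re]
  congr 1; ring

theorem neg_one_lt_re_add_order (α : ℂ) : -1 < α.re + order α := by
  have := Nat.lt_floor_add_one (-α.re)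
  rw [order]; linarith

/-- The boundary term of the integration by parts: the branch of `X ^ α (1 - X) ^ β (t - X) ^ δ`. -/
def endValue (w : BranchedPath X₀ t₀) (α β δ X t : ℂ) : ℂ :=
  w.powS α X 1 * w.powRest β δ X t 1

/-- Integration by parts for the finite part of the integral. It relates the exponents `α` and
`α + 1`, and hence reduces all statements on finite parts to convergent integrals. -/
theorem indefInt_by_parts (hq : q ∈ w.domain) {α : ℂ} (hα : ∀ n : ℕ, α + n + 1 ≠ 0) (β δ : ℂ) :
    (α + 1) * w.indefInt α β δ q.1 q.2 = w.endValue (α + 1) β δ q.1 q.2 +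
      (β * w.indefInt (α + 1) (β - 1) δ q.1 q.2 + δ * w.indefInt (α + 1) β (δ - 1) q.1 q.2) := by
  have hS : ∀ n : ℕ, w.powS (α + n + 1) q.1 1 = w.powS (α + 1) q.1 1 * q.1 ^ n := by
    intro n
    induction n with
    | zero => simp
    | succ n ih =>
      rw [pow_succ, ← mul_assoc, ← ih, show α + ((n + 1 : ℕ) : ℂ) + 1 = α + n + 1 + 1 by
        push_cast; ring, powS_add_one hq _ (by simp), pathTo_one]
  have hsum : (α + 1) * ∑ n ∈ Finset.range (order α),
        w.coeff β δ q.2 n * w.powS (α + n + 1) q.1 1 / (α + n + 1) -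
      w.powS (α + 1) q.1 1 * ∑ n ∈ Finset.range (order α), w.coeff β δ q.2 n * q.1 ^ n =
      ∑ n ∈ Finset.range (order α - 1),
        (β * w.coeff (β - 1) δ q.2 n + δ * w.coeff β (δ - 1) q.2 n) *
          w.powS (α + 1 + n + 1) q.1 1 / (α + 1 + n + 1) := by
    rw [Finset.mul_sum, Finset.mul_sum, ← Finset.sum_sub_distrib]
    have h1 : ∀ n ∈ Finset.range (order α),
        (α + 1) * (w.coeff β δ q.2 n * w.powS (α + n + 1) q.1 1 / (α + n + 1)) -
          w.powS (α + 1) q.1 1 * (w.coeff β δ q.2 n * q.1 ^ n) =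
        -((n : ℂ) * w.coeff β δ q.2 n) * w.powS (α + n + 1) q.1 1 / (α + n + 1) := by
      intro n _
      have := hα n
      rw [hS]
      field_simp
      ring
    rw [Finset.sum_congr rfl h1]
    rcases order α with _ | N
    · simp
    · rw [Finset.sum_range_succ', Nat.add_sub_cancel]
      simp only [Nat.cast_zero, zero_mul, neg_zero, zero_div, add_zero]
      refine Finset.sum_congr rfl fun n _ => ?_
      rw [coeff_succ β δ (snd_ne_zero hq) n, neg_neg]
      rw [show α + ((n + 1 : ℕ) : ℂ) + 1 = α + 1 + n + 1 by push_cast; ring]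
  have hparts := integral_by_parts hq α β δ (neg_one_lt_re_add_order α)
  have hrem : w.remainder β δ q.1 q.2 (order α) 1 = w.powRest β δ q.1 q.2 1 -
      ∑ n ∈ Finset.range (order α), w.coeff β δ q.2 n * q.1 ^ n := by
    rw [remainder, pathTo_one]
  have hsplit : ∑ n ∈ Finset.range (order α - 1),
        (β * w.coeff (β - 1) δ q.2 n + δ * w.coeff β (δ - 1) q.2 n) *
          w.powS (α + 1 + n + 1) q.1 1 / (α + 1 + n + 1) =
      β * ∑ n ∈ Finset.range (order α - 1),
          w.coeff (β - 1) δ q.2 n * w.powS (α + 1 + n + 1) q.1 1 / (α + 1 + n + 1) +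
        δ * ∑ n ∈ Finset.range (order α - 1),
          w.coeff β (δ - 1) q.2 n * w.powS (α + 1 + n + 1) q.1 1 / (α + 1 + n + 1) := by
    rw [Finset.mul_sum, Finset.mul_sum, ← Finset.sum_add_distrib]
    refine Finset.sum_congr rfl fun n _ => ?_
    ring
  rw [hrem] at hparts
  rw [hsplit] at hsum
  rw [indefInt_eq_remainder, indefInt_eq_remainder, indefInt_eq_remainder, order_add_one, endValue]
  linear_combination hparts + hsum

end BranchedPath

/-! ### Differentiation of the integrals -/

section Parametric

open MeasureTheory Set

/-- Differentiation under the integral sign, for a weight `g` that is only integrable and a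
continuously differentiable family `h`. -/
theorem hasDerivAt_integral_mul {g : ℝ → ℂ} {h h' : ℂ → ℝ → ℂ} {V : Set ℂ} (hV : IsOpen V)
    (hg : IntervalIntegrable g volume 0 1)
    (hc : ContinuousOn (fun z : ℂ × ℝ => h z.1 z.2) (V ×ˢ Icc (0 : ℝ) 1))
    (hc' : ContinuousOn (fun z : ℂ × ℝ => h' z.1 z.2) (V ×ˢ Icc (0 : ℝ) 1))
    (hd : ∀ x ∈ V, ∀ r ∈ Icc (0 : ℝ) 1, HasDerivAt (fun x => h x r) (h' x r) x)
    {x₀ : ℂ} (hx₀ : x₀ ∈ V) :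
    HasDerivAt (fun x => ∫ r in (0 : ℝ)..1, g r * h x r) (∫ r in (0 : ℝ)..1, g r * h' x₀ r) x₀ := by
  obtain ⟨ε, hε, hsub⟩ := Metric.nhds_basis_closedBall.mem_iff.1 (hV.mem_nhds hx₀)
  obtain ⟨C, hC⟩ := ((isCompact_closedBall x₀ ε).prod
    (isCompact_Icc (a := (0 : ℝ)) (b := 1))).exists_bound_of_continuousOn
    (hc'.mono (prod_mono hsub subset_rfl))
  have hgm : AEStronglyMeasurable g (volume.restrict (uIoc 0 1)) := by
    rw [uIoc_of_le zero_le_one]; exact hg.1.aestronglyMeasurable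
  have hcont : ∀ {k : ℂ → ℝ → ℂ}, ContinuousOn (fun z : ℂ × ℝ => k z.1 z.2) (V ×ˢ Icc (0 : ℝ) 1) →
      ∀ x ∈ V, ContinuousOn (k x) (Icc 0 1) := fun hk x hx =>
    hk.comp (f := fun r : ℝ => (x, r)) (by fun_prop) fun r hr => ⟨hx, hr⟩
  have hmeas : ∀ {k : ℂ → ℝ → ℂ}, ContinuousOn (fun z : ℂ × ℝ => k z.1 z.2) (V ×ˢ Icc (0 : ℝ) 1) →
      ∀ x ∈ V, AEStronglyMeasurable (fun r => g r * k x r) (volume.restrict (uIoc 0 1)) := by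
    intro k hk x hx
    refine hgm.mul ?_
    rw [uIoc_of_le zero_le_one]
    exact ((hcont hk x hx).mono Ioc_subset_Icc_self).aestronglyMeasurable measurableSet_Ioc
  refine (intervalIntegral.hasDerivAt_integral_of_dominated_loc_of_deriv_le
    (s := Metric.closedBall x₀ ε) (F' := fun x r => g r * h' x r) (bound := fun r => ‖g r‖ * C)
    (Metric.closedBall_mem_nhds x₀ hε) ?_ ?_ (hmeas hc' x₀ hx₀) ?_ ?_ ?_).2
  · filter_upwards [hV.mem_nhds hx₀] with x hx
    exact hmeas hc x hx
  · refine hg.mul_continuousOn ?_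
    rw [uIcc_of_le zero_le_one]
    exact hcont hc x₀ hx₀
  · refine Eventually.of_forall fun r hr x hx => ?_
    rw [uIoc_of_le zero_le_one] at hr
    refine (norm_mul _ _).trans_le (mul_le_mul_of_nonneg_left ?_ (norm_nonneg _))
    exact hC (x, r) ⟨hx, Ioc_subset_Icc_self hr⟩
  · exact hg.norm.mul_const C
  · refine Eventually.of_forall fun r hr x hx => ?_
    rw [uIoc_of_le zero_le_one] at hr
    exact (hd x (hsub hx) r (Ioc_subset_Icc_self hr)).const_mul _

theorem continuousOn_integral_mul {S : Type*} [TopologicalSpace S] [FirstCountableTopology S]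
    [LocallyCompactSpace S] {g : ℝ → ℂ} {h : S → ℝ → ℂ} {V : Set S} (hV : IsOpen V)
    (hg : IntervalIntegrable g volume 0 1)
    (hc : ContinuousOn (fun z : S × ℝ => h z.1 z.2) (V ×ˢ Icc (0 : ℝ) 1)) :
    ContinuousOn (fun x => ∫ r in (0 : ℝ)..1, g r * h x r) V := by
  intro x₀ hx₀
  refine ContinuousAt.continuousWithinAt ?_
  obtain ⟨K, hK, hKV, hKc⟩ := local_compact_nhds (hV.mem_nhds hx₀)
  obtain ⟨C, hC⟩ := (hKc.prod
    (isCompact_Icc (a := (0 : ℝ)) (b := 1))).exists_bound_of_continuousOn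
    (hc.mono (prod_mono hKV subset_rfl))
  have hgm : AEStronglyMeasurable g (volume.restrict (uIoc 0 1)) := by
    rw [uIoc_of_le zero_le_one]; exact hg.1.aestronglyMeasurable
  refine intervalIntegral.continuousAt_of_dominated_interval (bound := fun r => ‖g r‖ * C)
    ?_ ?_ (hg.norm.mul_const C) ?_
  · filter_upwards [hV.mem_nhds hx₀] with x hx
    refine hgm.mul ?_
    rw [uIoc_of_le zero_le_one]
    exact (hc.comp (f := fun r : ℝ => (x, r)) (by fun_prop)
      fun r hr => ⟨hx, Ioc_subset_Icc_self hr⟩).aestronglyMeasurable measurableSet_Ioc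
  · filter_upwards [hK] with x hx
    refine Eventually.of_forall fun r hr => ?_
    rw [uIoc_of_le zero_le_one] at hr
    refine (norm_mul _ _).trans_le (mul_le_mul_of_nonneg_left ?_ (norm_nonneg _))
    exact hC (x, r) ⟨hx, Ioc_subset_Icc_self hr⟩
  · refine Eventually.of_forall fun r hr => ?_
    rw [uIoc_of_le zero_le_one] at hr
    refine continuousAt_const.mul ?_
    exact (hc.comp (f := fun x : S => (x, r)) (by fun_prop)
      fun x hx => ⟨hx, Ioc_subset_Icc_self hr⟩).continuousAt (hV.mem_nhds hx₀)

end Parametric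

namespace BranchedPath

open Set MeasureTheory

variable {X₀ t₀ : ℂ} {w : BranchedPath X₀ t₀}

/-! For `-1 < re α` the integral is `X ^ (α + 1)` times the integral of `powRest` against the fixed
integrable weight `s ^ α ds` on the path to `X₀`. -/

variable (w) in
/-- The weight `s ^ α ds`, pulled back along the path. -/
def weight (α : ℂ) (r : ℝ) : ℂ := Complex.exp (α * w.logS r) * deriv w.path r

theorem intervalIntegrable_weight {α : ℂ} (hα : -1 < α.re) :
    IntervalIntegrable (w.weight α) volume 0 1 := by
  obtain ⟨C, h0, hC⟩ := w.exists_norm_exp_logS_le α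
  obtain ⟨M, hM⟩ := (isCompact_Icc (a := (0 : ℝ)) (b := 1)).exists_bound_of_continuousOn
    w.continuous_deriv_path.continuousOn
  refine IntervalIntegrable.mono_fun' (g := fun r => C * r ^ α.re * M)
    (((intervalIntegral.intervalIntegrable_rpow' hα).const_mul C).mul_const M) ?_ ?_
  · rw [uIoc_of_le zero_le_one]
    exact ((continuousOn_const.mul w.continuousOn_logS).cexp.mul
      w.continuous_deriv_path.continuousOn).aestronglyMeasurable measurableSet_Ioc
  · rw [uIoc_of_le zero_le_one]
    refine (ae_restrict_iff' measurableSet_Ioc).2 (Eventually.of_forall fun r hr => ?_)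
    exact (norm_mul _ _).trans_le (mul_le_mul (hC r hr) (hM r ⟨hr.1.le, hr.2⟩) (norm_nonneg _)
      ((norm_nonneg _).trans (hC r hr)))

theorem indefInt_eq_weight {α : ℂ} (hα : -1 < α.re) (β δ X t : ℂ) :
    w.indefInt α β δ X t = (Complex.exp (α * Complex.log (X / X₀)) * (X / X₀)) *
      ∫ r in (0 : ℝ)..1, w.weight α r * w.powRest β δ X t r := by
  rw [w.indefInt_eq hα, ← intervalIntegral.integral_const_mul]
  refine intervalIntegral.integral_congr_ae (Eventually.of_forall fun r hr => ?_)
  rw [uIoc_of_le zero_le_one] at hr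
  rw [powS_eq α _ hr, weight]
  ring

theorem continuousOn_indefInt_of_re {α : ℂ} (hα : -1 < α.re) (β δ : ℂ) :
    ContinuousOn (fun q : ℂ × ℂ => w.indefInt α β δ q.1 q.2) w.domain := by
  simp only [indefInt_eq_weight hα]
  have h0 : ContinuousOn (fun q : ℂ × ℂ => q.1 / X₀) w.domain := by fun_prop
  refine ContinuousOn.mul (ContinuousOn.mul (ContinuousOn.cexp (continuousOn_const.mul
    (h0.clog fun q hq => div_X₀_mem hq))) h0) ?_
  exact continuousOn_integral_mul w.isOpen_domain (intervalIntegrable_weight hα)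
    (w.continuousOn_powRest β δ)

variable {q : ℂ × ℂ}

theorem exp_add_one_mul_log (hq : q ∈ w.domain) (α : ℂ) :
    Complex.exp ((α + 1) * Complex.log (q.1 / X₀)) =
      Complex.exp (α * Complex.log (q.1 / X₀)) * (q.1 / X₀) := by
  rw [add_mul, one_mul, Complex.exp_add,
    Complex.exp_log (div_ne_zero (fst_ne_zero hq) w.X₀_ne_zero)]

theorem intervalIntegrable_weight_mul (hq : q ∈ w.domain) {α : ℂ} (hα : -1 < α.re) (β δ : ℂ) :
    IntervalIntegrable (fun r => w.weight α r * w.powRest β δ q.1 q.2 r) volume 0 1 := by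
  refine (intervalIntegrable_weight hα).mul_continuousOn ?_
  rw [uIcc_of_le zero_le_one]
  exact continuousOn_powRest_right hq β δ

theorem hasDerivAt_indefInt_snd_of_re (hq : q ∈ w.domain) {α : ℂ} (hα : -1 < α.re) (β δ : ℂ) :
    HasDerivAt (fun t => w.indefInt α β δ q.1 t) (δ * w.indefInt α β (δ - 1) q.1 q.2) q.2 := by
  simp only [indefInt_eq_weight hα]
  have hV : IsOpen {t : ℂ | (q.1, t) ∈ w.domain} :=
    w.isOpen_domain.preimage (f := fun t : ℂ => (q.1, t)) (by fun_prop)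
  have key := hasDerivAt_integral_mul (h := fun t r => w.powRest β δ q.1 t r)
    (h' := fun t r => δ * w.powRest β (δ - 1) q.1 t r) hV (intervalIntegrable_weight (w := w) hα)
    ((w.continuousOn_powRest β δ).comp (f := fun z : ℂ × ℝ => ((q.1, z.1), z.2)) (by fun_prop)
      fun z hz => ⟨hz.1, hz.2⟩)
    (continuousOn_const.mul ((w.continuousOn_powRest β (δ - 1)).comp
      (f := fun z : ℂ × ℝ => ((q.1, z.1), z.2)) (by fun_prop) fun z hz => ⟨hz.1, hz.2⟩))
    (fun t ht r hr => hasDerivAt_powRest_snd ht β δ hr) (x₀ := q.2) hq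
  refine (key.const_mul _).congr_deriv ?_
  simp only [mul_left_comm _ δ, intervalIntegral.integral_const_mul]

/-- The derivative with respect to the endpoint. Differentiation of the rescaled path produces an
integral that `indefInt_by_parts` evaluates. -/
theorem hasDerivAt_indefInt_fst_of_re (hq : q ∈ w.domain) {α : ℂ} (hα : -1 < α.re) (β δ : ℂ) :
    HasDerivAt (fun X => w.indefInt α β δ X q.2) (w.endValue (α + 1) β δ q.1 q.2 / q.1) q.1 := by
  have hα' : -1 < (α + 1).re := by rw [Complex.add_re, Complex.one_re]; linarith
  have hαn : ∀ n : ℕ, α + n + 1 ≠ 0 := fun n h => by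
    have := congrArg Complex.re h
    simp only [Complex.add_re, Complex.natCast_re, Complex.one_re, Complex.zero_re] at this
    have hn : (0 : ℝ) ≤ n := n.cast_nonneg
    linarith
  have hX := w.X₀_ne_zero
  have hq1 := fst_ne_zero hq
  have hparts := indefInt_by_parts hq hαn β δ
  simp only [indefInt_eq_weight hα, indefInt_eq_weight hα'] at hparts ⊢
  have hV : IsOpen {X : ℂ | (X, q.2) ∈ w.domain} :=
    w.isOpen_domain.preimage (f := fun X : ℂ => (X, q.2)) (by fun_prop)
  have hcomp : ∀ β δ, ContinuousOn (fun z : ℂ × ℝ => w.powRest β δ z.1 q.2 z.2)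
      ({X : ℂ | (X, q.2) ∈ w.domain} ×ˢ Icc (0 : ℝ) 1) := fun β δ =>
    (w.continuousOn_powRest β δ).comp (f := fun z : ℂ × ℝ => ((z.1, q.2), z.2)) (by fun_prop)
      fun z hz => ⟨hz.1, hz.2⟩
  have key := hasDerivAt_integral_mul (h := fun X r => w.powRest β δ X q.2 r)
    (h' := fun X r => (w.path r / X₀) * -(β * w.powRest (β - 1) δ X q.2 r +
        δ * w.powRest β (δ - 1) X q.2 r)) hV (intervalIntegrable_weight (w := w) hα) (hcomp β δ)
    (by
      have h1 := hcomp (β - 1) δ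
      have h2 := hcomp β (δ - 1)
      have h3 := w.continuous_path
      fun_prop)
    (fun X hX r hr => hasDerivAt_powRest_fst hX β δ hr) (x₀ := q.1) hq
  -- `s ^ α` times the factor `s` of the derivative is the weight with exponent `α + 1`
  have hint : ∫ r in (0 : ℝ)..1, w.weight α r * ((w.path r / X₀) *
        -(β * w.powRest (β - 1) δ q.1 q.2 r + δ * w.powRest β (δ - 1) q.1 q.2 r)) =
      -(X₀⁻¹ * (β * (∫ r in (0 : ℝ)..1, w.weight (α + 1) r * w.powRest (β - 1) δ q.1 q.2 r) +
        δ * ∫ r in (0 : ℝ)..1, w.weight (α + 1) r * w.powRest β (δ - 1) q.1 q.2 r)) := by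
    rw [← intervalIntegral.integral_const_mul, ← intervalIntegral.integral_const_mul,
      ← intervalIntegral.integral_add
        ((intervalIntegrable_weight_mul hq hα' (β - 1) δ).const_mul β)
        ((intervalIntegrable_weight_mul hq hα' β (δ - 1)).const_mul δ),
      ← intervalIntegral.integral_const_mul, ← intervalIntegral.integral_neg]
    refine intervalIntegral.integral_congr_ae (Eventually.of_forall fun r hr => ?_)
    rw [uIoc_of_le zero_le_one] at hr
    rw [weight, weight, add_mul, one_mul, Complex.exp_add, w.exp_logS r hr]
    ring
  rw [hint] at key
  have hlog : HasDerivAt (fun X => Complex.exp (α * Complex.log (X / X₀)) * (X / X₀))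
      ((α + 1) * (Complex.exp (α * Complex.log (q.1 / X₀)) * (1 / X₀))) q.1 := by
    have h1 : HasDerivAt (fun X : ℂ => X / X₀) (1 / X₀) q.1 := (hasDerivAt_id _).div_const _
    refine ((((h1.clog (div_X₀_mem hq)).const_mul α).cexp).mul h1).congr_deriv ?_
    field_simp
  refine (hlog.mul key).congr_deriv ?_
  rw [eq_div_iff hq1]
  rw [exp_add_one_mul_log hq] at hparts
  linear_combination hparts

theorem indefInt_add_one_middle_of_re (hq : q ∈ w.domain) {α : ℂ} (hα : -1 < α.re) (β δ : ℂ) :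
    w.indefInt α (β + 1) δ q.1 q.2 = w.indefInt α β δ q.1 q.2 - w.indefInt (α + 1) β δ q.1 q.2 := by
  have hα' : -1 < (α + 1).re := by rw [Complex.add_re, Complex.one_re]; linarith
  have key : ∫ r in (0 : ℝ)..1, w.weight α r * w.powRest (β + 1) δ q.1 q.2 r =
      (∫ r in (0 : ℝ)..1, w.weight α r * w.powRest β δ q.1 q.2 r) -
        q.1 / X₀ * ∫ r in (0 : ℝ)..1, w.weight (α + 1) r * w.powRest β δ q.1 q.2 r := by
    rw [← intervalIntegral.integral_const_mul, ← intervalIntegral.integral_sub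
      (intervalIntegrable_weight_mul hq hα β δ)
      ((intervalIntegrable_weight_mul hq hα' β δ).const_mul _)]
    refine intervalIntegral.integral_congr_ae (Eventually.of_forall fun r hr => ?_)
    rw [uIoc_of_le zero_le_one] at hr
    rw [powRest_add_one_left hq β δ (Ioc_subset_Icc_self hr), weight, weight, add_mul α, one_mul,
      Complex.exp_add, w.exp_logS r hr, pathTo]
    ring
  rw [indefInt_eq_weight hα, indefInt_eq_weight hα, indefInt_eq_weight hα',
    exp_add_one_mul_log hq, key]
  ring

theorem indefInt_add_one_right_of_re (hq : q ∈ w.domain) {α : ℂ} (hα : -1 < α.re) (β δ : ℂ) :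
    w.indefInt α β (δ + 1) q.1 q.2 =
      q.2 * w.indefInt α β δ q.1 q.2 - w.indefInt (α + 1) β δ q.1 q.2 := by
  have hα' : -1 < (α + 1).re := by rw [Complex.add_re, Complex.one_re]; linarith
  have key : ∫ r in (0 : ℝ)..1, w.weight α r * w.powRest β (δ + 1) q.1 q.2 r =
      q.2 * (∫ r in (0 : ℝ)..1, w.weight α r * w.powRest β δ q.1 q.2 r) -
        q.1 / X₀ * ∫ r in (0 : ℝ)..1, w.weight (α + 1) r * w.powRest β δ q.1 q.2 r := by
    rw [← intervalIntegral.integral_const_mul, ← intervalIntegral.integral_const_mul,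
      ← intervalIntegral.integral_sub
      ((intervalIntegrable_weight_mul hq hα β δ).const_mul _)
      ((intervalIntegrable_weight_mul hq hα' β δ).const_mul _)]
    refine intervalIntegral.integral_congr_ae (Eventually.of_forall fun r hr => ?_)
    rw [uIoc_of_le zero_le_one] at hr
    rw [powRest_add_one_right hq β δ (Ioc_subset_Icc_self hr), weight, weight, add_mul α, one_mul,
      Complex.exp_add, w.exp_logS r hr, pathTo]
    ring
  rw [indefInt_eq_weight hα, indefInt_eq_weight hα, indefInt_eq_weight hα',
    exp_add_one_mul_log hq, key]
  ring

/-! ### Extension to the finite parts -/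

/-- Induction on the number of divergent terms: a property of the exponent holds for all
`α ≠ -1, -2, …` if it holds for `-1 < re α` and passes from `α + 1` to `α`. -/
theorem exponent_induction {P : ℂ → Prop} (h0 : ∀ α : ℂ, -1 < α.re → P α)
    (h1 : ∀ α : ℂ, (∀ n : ℕ, α + n + 1 ≠ 0) → P (α + 1) → P α) {α : ℂ}
    (hα : ∀ n : ℕ, α + n + 1 ≠ 0) : P α := by
  have key : ∀ (N : ℕ) (α : ℂ), -1 < α.re + N → (∀ n : ℕ, α + n + 1 ≠ 0) → P α := by
    intro N
    induction N with
    | zero => exact fun α h _ => h0 α (by simpa using h)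
    | succ N ih =>
      refine fun α h hα => h1 α hα (ih (α + 1) ?_ fun n => ?_)
      · push_cast at h
        rw [Complex.add_re, Complex.one_re]
        linarith
      · have := hα (n + 1)
        push_cast at this
        rwa [add_right_comm α 1, add_assoc α (n : ℂ) 1]
  exact key (order α) α (neg_one_lt_re_add_order α) hα

theorem add_one_exponent {α : ℂ} (hα : ∀ n : ℕ, α + n + 1 ≠ 0) (n : ℕ) : α + 1 + n + 1 ≠ 0 := by
  have := hα (n + 1)
  push_cast at this
  rwa [add_right_comm α 1, add_assoc α (n : ℂ) 1]

theorem endValue_add_one_left (hq : q ∈ w.domain) (α β δ : ℂ) :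
    w.endValue (α + 1) β δ q.1 q.2 = q.1 * w.endValue α β δ q.1 q.2 := by
  rw [endValue, powS_add_one hq α (by simp), pathTo_one, endValue]; ring

theorem endValue_add_one_middle (hq : q ∈ w.domain) (α β δ : ℂ) :
    w.endValue α (β + 1) δ q.1 q.2 = (1 - q.1) * w.endValue α β δ q.1 q.2 := by
  rw [endValue, powRest_add_one_left hq β δ (by simp), pathTo_one, endValue]; ring

theorem endValue_add_one_right (hq : q ∈ w.domain) (α β δ : ℂ) :
    w.endValue α β (δ + 1) q.1 q.2 = (q.2 - q.1) * w.endValue α β δ q.1 q.2 := by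
  rw [endValue, powRest_add_one_right hq β δ (by simp), pathTo_one, endValue]; ring

theorem hasDerivAt_endValue_fst (hq : q ∈ w.domain) (α β δ : ℂ) :
    HasDerivAt (fun X => w.endValue α β δ X q.2)
      (α * w.endValue (α - 1) β δ q.1 q.2 - (β * w.endValue α (β - 1) δ q.1 q.2 +
        δ * w.endValue α β (δ - 1) q.1 q.2)) q.1 := by
  have hX : q.1 / w.path 1 ∈ Complex.slitPlane := by
    rw [w.path_one]; exact div_X₀_mem hq
  have h1 : HasDerivAt (fun X => w.powS α X 1) (α * w.powS (α - 1) q.1 1) q.1 := by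
    have := hasDerivAt_branchPow (c := α) (w.exp_logS 1 (by simp)) hX
    simpa only [powS, pathTo_one] using this
  have h2 := hasDerivAt_powRest_fst hq β δ (r := 1) (by simp)
  rw [w.path_one, div_self w.X₀_ne_zero] at h2
  refine (h1.mul h2).congr_deriv ?_
  simp only [endValue]
  ring

theorem hasDerivAt_endValue_snd (hq : q ∈ w.domain) (α β δ : ℂ) :
    HasDerivAt (fun t => w.endValue α β δ q.1 t) (δ * w.endValue α β (δ - 1) q.1 q.2) q.2 := by
  refine ((hasDerivAt_powRest_snd hq β δ (r := 1) (by simp)).const_mul _).congr_deriv ?_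
  simp only [endValue]
  ring

theorem endValue_ne_zero (α β δ X t : ℂ) : w.endValue α β δ X t ≠ 0 :=
  mul_ne_zero (branchPow_ne_zero _ _ _ _)
    (mul_ne_zero (branchPow_ne_zero _ _ _ _) (branchPow_ne_zero _ _ _ _))

theorem continuousOn_endValue (α β δ : ℂ) :
    ContinuousOn (fun q : ℂ × ℂ => w.endValue α β δ q.1 q.2) w.domain := by
  refine ContinuousOn.mul ?_ ((w.continuousOn_powRest β δ).comp (f := fun q : ℂ × ℂ => (q, (1 : ℝ)))
    (by fun_prop) fun q hq => ⟨hq, by simp⟩)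
  refine continuousOn_branchPow_curve (g₀ := fun _ : ℂ × ℂ => w.path 1) (ℓ := fun _ => w.logS 1)
    (g := fun q => w.pathTo q.1 1) continuousOn_const (fun _ _ => w.exp_logS 1 (by simp))
    continuousOn_const ?_ ?_
  · simp only [pathTo_one]; fun_prop
  · intro q hq
    rw [pathTo_one, w.path_one]
    exact div_X₀_mem hq

theorem continuousOn_indefInt {α : ℂ} (hα : ∀ n : ℕ, α + n + 1 ≠ 0) : ∀ β δ : ℂ,
    ContinuousOn (fun q : ℂ × ℂ => w.indefInt α β δ q.1 q.2) w.domain := by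
  refine exponent_induction (P := fun α => ∀ β δ : ℂ,
    ContinuousOn (fun q : ℂ × ℂ => w.indefInt α β δ q.1 q.2) w.domain)
    (fun α hα => continuousOn_indefInt_of_re hα) (fun α hα ih β δ => ?_) hα
  have h0 : α + 1 ≠ 0 := by simpa using hα 0
  have h1 : ContinuousOn (fun q : ℂ × ℂ => (w.endValue (α + 1) β δ q.1 q.2 +
      (β * w.indefInt (α + 1) (β - 1) δ q.1 q.2 + δ * w.indefInt (α + 1) β (δ - 1) q.1 q.2)) /
      (α + 1)) w.domain :=
    ((continuousOn_endValue _ _ _).add ((continuousOn_const.mul (ih _ _)).add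
      (continuousOn_const.mul (ih _ _)))).div_const _
  refine h1.congr fun q hq => ?_
  rw [eq_div_iff h0, ← indefInt_by_parts hq hα β δ, mul_comm]

theorem hasDerivAt_indefInt_snd {α : ℂ} (hα : ∀ n : ℕ, α + n + 1 ≠ 0) : ∀ (β δ : ℂ),
    ∀ q ∈ w.domain,
    HasDerivAt (fun t => w.indefInt α β δ q.1 t) (δ * w.indefInt α β (δ - 1) q.1 q.2) q.2 := by
  refine exponent_induction (P := fun α => ∀ β δ : ℂ, ∀ q ∈ w.domain,
    HasDerivAt (fun t => w.indefInt α β δ q.1 t) (δ * w.indefInt α β (δ - 1) q.1 q.2) q.2)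
    (fun α hα β δ q hq => hasDerivAt_indefInt_snd_of_re hq hα β δ) (fun α hα ih β δ q hq => ?_) hα
  have h0 : α + 1 ≠ 0 := by simpa using hα 0
  have h1 := (((hasDerivAt_endValue_snd hq (α + 1) β δ).add
    (((ih (β - 1) δ q hq).const_mul β).add ((ih β (δ - 1) q hq).const_mul δ)))).div_const (α + 1)
  have hV : ∀ᶠ t in 𝓝 q.2, (q.1, t) ∈ w.domain :=
    (show ContinuousAt (fun t : ℂ => (q.1, t)) q.2 by fun_prop).eventually_mem
      (w.isOpen_domain.mem_nhds hq)
  refine (h1.congr_of_eventuallyEq (hV.mono fun t ht => ?_)).congr_deriv ?_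
  · exact (eq_div_iff h0).2 ((mul_comm _ _).trans (indefInt_by_parts ht hα β δ))
  · rw [div_eq_iff h0]
    have h2 := indefInt_by_parts hq hα β (δ - 1)
    linear_combination -δ * h2

theorem hasDerivAt_indefInt_fst {α : ℂ} (hα : ∀ n : ℕ, α + n + 1 ≠ 0) : ∀ (β δ : ℂ),
    ∀ q ∈ w.domain,
    HasDerivAt (fun X => w.indefInt α β δ X q.2) (w.endValue (α + 1) β δ q.1 q.2 / q.1) q.1 := by
  refine exponent_induction (P := fun α => ∀ β δ : ℂ, ∀ q ∈ w.domain,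
    HasDerivAt (fun X => w.indefInt α β δ X q.2) (w.endValue (α + 1) β δ q.1 q.2 / q.1) q.1)
    (fun α hα β δ q hq => hasDerivAt_indefInt_fst_of_re hq hα β δ) (fun α hα ih β δ q hq => ?_) hα
  have h0 : α + 1 ≠ 0 := by simpa using hα 0
  have h1 := (((hasDerivAt_endValue_fst hq (α + 1) β δ).add
    (((ih (β - 1) δ q hq).const_mul β).add ((ih β (δ - 1) q hq).const_mul δ)))).div_const (α + 1)
  have hV : ∀ᶠ X in 𝓝 q.1, (X, q.2) ∈ w.domain :=
    (show ContinuousAt (fun X : ℂ => (X, q.2)) q.1 by fun_prop).eventually_mem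
      (w.isOpen_domain.mem_nhds hq)
  refine (h1.congr_of_eventuallyEq (hV.mono fun X hX => ?_)).congr_deriv ?_
  · exact (eq_div_iff h0).2 ((mul_comm _ _).trans (indefInt_by_parts hX hα β δ))
  · have hq1 := fst_ne_zero hq
    rw [endValue_add_one_left hq (α + 1), endValue_add_one_left hq (α + 1), add_sub_cancel_right,
      endValue_add_one_left hq α β δ]
    field_simp
    ring

theorem indefInt_add_one_middle {α : ℂ} (hα : ∀ n : ℕ, α + n + 1 ≠ 0) : ∀ (β δ : ℂ),
    ∀ q ∈ w.domain, w.indefInt α (β + 1) δ q.1 q.2 =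
      w.indefInt α β δ q.1 q.2 - w.indefInt (α + 1) β δ q.1 q.2 := by
  refine exponent_induction (P := fun α => ∀ β δ : ℂ, ∀ q ∈ w.domain,
    w.indefInt α (β + 1) δ q.1 q.2 = w.indefInt α β δ q.1 q.2 - w.indefInt (α + 1) β δ q.1 q.2)
    (fun α hα β δ q hq => indefInt_add_one_middle_of_re hq hα β δ)
    (fun α hα ih β δ q hq => ?_) hα
  have h0 : α + 1 ≠ 0 := by simpa using hα 0
  have h1 := indefInt_by_parts hq hα (β + 1) δ
  have h2 := indefInt_by_parts hq hα β δ
  have h3 := indefInt_by_parts hq (add_one_exponent hα) β δ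
  have h4 := ih (β - 1) δ q hq
  have h5 := ih β (δ - 1) q hq
  have h6 := endValue_add_one_middle hq (α + 1) β δ
  have h7 := endValue_add_one_left hq (α + 1) β δ
  rw [add_sub_cancel_right] at h1
  rw [sub_add_cancel] at h4
  refine mul_left_cancel₀ h0 ?_
  linear_combination h1 - h2 + h3 + h6 + h7 + β * h4 + δ * h5

theorem indefInt_add_one_right {α : ℂ} (hα : ∀ n : ℕ, α + n + 1 ≠ 0) : ∀ (β δ : ℂ),
    ∀ q ∈ w.domain, w.indefInt α β (δ + 1) q.1 q.2 =
      q.2 * w.indefInt α β δ q.1 q.2 - w.indefInt (α + 1) β δ q.1 q.2 := by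
  refine exponent_induction (P := fun α => ∀ β δ : ℂ, ∀ q ∈ w.domain,
    w.indefInt α β (δ + 1) q.1 q.2 =
      q.2 * w.indefInt α β δ q.1 q.2 - w.indefInt (α + 1) β δ q.1 q.2)
    (fun α hα β δ q hq => indefInt_add_one_right_of_re hq hα β δ)
    (fun α hα ih β δ q hq => ?_) hα
  have h0 : α + 1 ≠ 0 := by simpa using hα 0
  have h1 := indefInt_by_parts hq hα β (δ + 1)
  have h2 := indefInt_by_parts hq hα β δ
  have h3 := indefInt_by_parts hq (add_one_exponent hα) β δ
  have h4 := ih (β - 1) δ q hq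
  have h5 := ih β (δ - 1) q hq
  have h6 := endValue_add_one_right hq (α + 1) β δ
  have h7 := endValue_add_one_left hq (α + 1) β δ
  rw [add_sub_cancel_right] at h1
  rw [sub_add_cancel] at h5
  refine mul_left_cancel₀ h0 ?_
  linear_combination h1 - q.2 * h2 + h3 + h6 + h7 + β * h4 + δ * h5

theorem analyticAt_indefInt (hq : q ∈ w.domain) {α : ℂ} (hα : ∀ n : ℕ, α + n + 1 ≠ 0) (β δ : ℂ) :
    AnalyticAt ℂ (fun q : ℂ × ℂ => w.indefInt α β δ q.1 q.2) q :=
  analyticAt_of_separately w.isOpen_domain (continuousOn_indefInt hα β δ)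
    (fun q hq => (hasDerivAt_indefInt_fst hα β δ q hq).differentiableAt)
    (fun q hq => (hasDerivAt_indefInt_snd hα β δ q hq).differentiableAt) hq

theorem analyticAt_endValue (hq : q ∈ w.domain) (α β δ : ℂ) :
    AnalyticAt ℂ (fun q : ℂ × ℂ => w.endValue α β δ q.1 q.2) q :=
  analyticAt_of_separately w.isOpen_domain (continuousOn_endValue α β δ)
    (fun _ hq => (hasDerivAt_endValue_fst hq α β δ).differentiableAt)
    (fun _ hq => (hasDerivAt_endValue_snd hq α β δ).differentiableAt) hq

end BranchedPath

/-! ### The germs of the integrals -/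

section IntegralGerms

local notation "κ" => algebraMap ℂ _

attribute [local instance] germAlgebra

open AnGerm

namespace BranchedPath

variable {X₀ t₀ : ℂ} (w : BranchedPath X₀ t₀)

/-- The germ of `indefInt α β δ` at `(X₀, t₀)`. -/
def intGerm {α : ℂ} (hα : ∀ n : ℕ, α + n + 1 ≠ 0) (β δ : ℂ) : AnGerm (X₀, t₀) :=
  of (fun q => w.indefInt α β δ q.1 q.2) (analyticAt_indefInt w.mem_domain_self hα β δ)

/-- The germ of `endValue α β δ`, the function `X ^ α (1 - X) ^ β (t - X) ^ δ`, at `(X₀, t₀)`. -/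
def endGerm (α β δ : ℂ) : AnGerm (X₀, t₀) :=
  of (fun q => w.endValue α β δ q.1 q.2) (analyticAt_endValue w.mem_domain_self α β δ)

theorem eventually_mem_domain : ∀ᶠ q in 𝓝 (X₀, t₀), q ∈ w.domain :=
  w.isOpen_domain.mem_nhds w.mem_domain_self

/-- Identities between analytic functions on `domain` are identities between germs. -/
theorem germ_eq {g h : AnGerm (X₀, t₀)} {f₁ f₂ : ℂ × ℂ → ℂ}
    (hg : (g : Germ (𝓝 (X₀, t₀)) ℂ) = (f₁ : Germ (𝓝 (X₀, t₀)) ℂ))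
    (hh : (h : Germ (𝓝 (X₀, t₀)) ℂ) = (f₂ : Germ (𝓝 (X₀, t₀)) ℂ))
    (H : ∀ q ∈ w.domain, f₁ q = f₂ q) : g = h :=
  Subtype.ext (hg.trans ((Germ.coe_eq.2 (w.eventually_mem_domain.mono H)).trans hh.symm))

theorem isUnit_endGerm (α β δ : ℂ) : IsUnit (w.endGerm α β δ) :=
  isUnit_of (endValue_ne_zero α β δ _ _)

section

variable {α : ℂ} (hα : ∀ n : ℕ, α + n + 1 ≠ 0) (β δ : ℂ)

/-- The derivative of the integral with respect to its endpoint is the integrand. -/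
theorem x_mul_Dx_intGerm : x _ * Dx _ (w.intGerm hα β δ) = w.endGerm (α + 1) β δ :=
  w.germ_eq (f₁ := fun q => q.1 * deriv (fun X => w.indefInt α β δ X q.2) q.1)
    (f₂ := fun q => w.endValue (α + 1) β δ q.1 q.2) rfl rfl fun q hq => by
      rw [(hasDerivAt_indefInt_fst hα β δ q hq).deriv, mul_div_cancel₀ _ (fst_ne_zero hq)]

theorem Dy_intGerm : Dy _ (w.intGerm hα β δ) = κ δ * w.intGerm hα β (δ - 1) :=
  w.germ_eq (f₁ := fun q => deriv (fun t => w.indefInt α β δ q.1 t) q.2)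
    (f₂ := fun q => δ * w.indefInt α β (δ - 1) q.1 q.2) rfl rfl fun q hq =>
      (hasDerivAt_indefInt_snd hα β δ q hq).deriv

theorem intGerm_add_one_middle : w.intGerm hα (β + 1) δ =
    w.intGerm hα β δ - w.intGerm (add_one_exponent hα) β δ :=
  w.germ_eq rfl rfl (indefInt_add_one_middle hα β δ)

theorem intGerm_add_one_right : w.intGerm hα β (δ + 1) =
    y _ * w.intGerm hα β δ - w.intGerm (add_one_exponent hα) β δ :=
  w.germ_eq rfl rfl (indefInt_add_one_right hα β δ)

theorem intGerm_by_parts : κ (α + 1) * w.intGerm hα β δ = w.endGerm (α + 1) β δ +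
    (κ β * w.intGerm (add_one_exponent hα) (β - 1) δ +
      κ δ * w.intGerm (add_one_exponent hα) β (δ - 1)) :=
  w.germ_eq rfl rfl fun _ hq => indefInt_by_parts hq hα β δ

end

variable (α β δ : ℂ)

theorem endGerm_add_one_left : w.endGerm (α + 1) β δ = x _ * w.endGerm α β δ :=
  w.germ_eq rfl rfl fun _ hq => endValue_add_one_left hq α β δ

theorem endGerm_add_one_middle : w.endGerm α (β + 1) δ = (1 - x _) * w.endGerm α β δ :=
  w.germ_eq rfl rfl fun _ hq => endValue_add_one_middle hq α β δ

theorem endGerm_add_one_right : w.endGerm α β (δ + 1) = (y _ - x _) * w.endGerm α β δ :=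
  w.germ_eq rfl rfl fun _ hq => endValue_add_one_right hq α β δ

theorem Dx_endGerm : Dx _ (w.endGerm α β δ) = κ α * w.endGerm (α - 1) β δ -
    (κ β * w.endGerm α (β - 1) δ + κ δ * w.endGerm α β (δ - 1)) :=
  w.germ_eq (f₁ := fun q => deriv (fun X => w.endValue α β δ X q.2) q.1)
    (f₂ := fun q => α * w.endValue (α - 1) β δ q.1 q.2 -
      (β * w.endValue α (β - 1) δ q.1 q.2 + δ * w.endValue α β (δ - 1) q.1 q.2)) rfl rfl
    fun _ hq => (hasDerivAt_endValue_fst hq α β δ).deriv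

theorem Dy_endGerm : Dy _ (w.endGerm α β δ) = κ δ * w.endGerm α β (δ - 1) :=
  w.germ_eq (f₁ := fun q => deriv (fun t => w.endValue α β δ q.1 t) q.2)
    (f₂ := fun q => δ * w.endValue α β (δ - 1) q.1 q.2) rfl rfl
    fun _ hq => (hasDerivAt_endValue_snd hq α β δ).deriv

end BranchedPath

open BranchedPath

variable {p : ℂ × ℂ} (hp : IsRegularPoint p)

/-- Composition with `(x, y) ↦ (X, XY)`. -/
def pullXT : AnGerm (coordX p, coordT p) →ₐ[ℂ] AnGerm p := pull (analyticAt_mapXT hp)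

theorem pullXT_x : pullXT hp (x _) = (frame hp).X := rfl

theorem pullXT_y : pullXT hp (y _) = (frame hp).X * (frame hp).Y := (pull_y_mapXT hp).symm

theorem pullXT_algebraMap (c : ℂ) : pullXT hp (κ c) = κ c := (pullXT hp).commutes c

theorem θ_pullXT (z : AnGerm (coordX p, coordT p)) :
    (frame hp).θ (pullXT hp z) = (frame hp).θ' (pullXT hp z) + pullXT hp (x _ * Dx _ z) :=
  sub_eq_iff_eq_add'.1 (euler_mapXT hp z).1

theorem θ'_pullXT (z : AnGerm (coordX p, coordT p)) :
    (frame hp).θ' (pullXT hp z) = pullXT hp (y _ * Dy _ z) := (euler_mapXT hp z).2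

/-- The germ at `p` of the branch of `(XY) ^ c` given by a logarithm `ℓ` of `XY` at `p`. -/
def powGerm (ℓ c : ℂ) : AnGerm p :=
  of (fun q => branchPow (coordT p) ℓ c (coordT q))
    (AnalyticAt.fun_comp (analyticAt_branchPow (coordT_ne_zero hp) ℓ c
        (div_self_mem_slitPlane (coordT_ne_zero hp))) (analyticAt_coordT hp))

theorem isUnit_powGerm (ℓ c : ℂ) : IsUnit (powGerm hp ℓ c) := isUnit_of (branchPow_ne_zero _ _ _ _)

theorem y_mul_Dy_of_snd {r : ℂ × ℂ} {f f' : ℂ → ℂ}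
    (hf : AnalyticAt ℂ (fun q : ℂ × ℂ => f q.2) r) {c : ℂ}
    (h : ∀ᶠ t in 𝓝 r.2, HasDerivAt f (f' t) t ∧ t * f' t = c * f t) :
    y r * Dy r (of _ hf) = κ c * of _ hf := by
  refine Subtype.ext (Germ.coe_eq.2 ?_ :
    ((fun q => q.2 * deriv f q.2 : ℂ × ℂ → ℂ) : Germ (𝓝 r) ℂ) =
      ((fun q => c * f q.2 : ℂ × ℂ → ℂ) : Germ (𝓝 r) ℂ))
  filter_upwards [continuous_snd.continuousAt.eventually h] with q hq
  rw [hq.1.deriv, hq.2]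

theorem x_mul_Dx_of_snd {r : ℂ × ℂ} {f : ℂ → ℂ} (hf : AnalyticAt ℂ (fun q : ℂ × ℂ => f q.2) r) :
    x r * Dx r (of _ hf) = 0 := by
  have h : Dx r (of _ hf) = 0 :=
    (of_eq_zero (hf := analyticAt_dx hf)).2 (Eventually.of_forall fun q => deriv_const q.1 (f q.2))
  rw [h, mul_zero]

theorem θ_powGerm {ℓ : ℂ} (hℓ : Complex.exp ℓ = coordT p) (c : ℂ) :
    (frame hp).θ (powGerm hp ℓ c) = κ c * powGerm hp ℓ c ∧
      (frame hp).θ' (powGerm hp ℓ c) = κ c * powGerm hp ℓ c := by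
  have h0 := coordT_ne_zero hp
  have hf : AnalyticAt ℂ (fun q : ℂ × ℂ => branchPow (coordT p) ℓ c q.2) (coordX p, coordT p) :=
    AnalyticAt.fun_comp (analyticAt_branchPow h0 ℓ c (div_self_mem_slitPlane h0)) analyticAt_snd
  have hc : ContinuousAt (fun t : ℂ => t / coordT p) (coordT p) := by fun_prop
  have hy := y_mul_Dy_of_snd hf (c := c) (f' := fun t => c * branchPow (coordT p) ℓ (c - 1) t) (by
    filter_upwards [hc.eventually_mem (Complex.isOpen_slitPlane.mem_nhds
      (div_self_mem_slitPlane h0)), continuousAt_id.eventually_ne h0] with t h1 h2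
    refine ⟨hasDerivAt_branchPow hℓ h1, ?_⟩
    have h3 := branchPow_add_one hℓ (w := t) h2 (c - 1)
    rw [sub_add_cancel] at h3
    rw [h3]; ring)
  have hx := x_mul_Dx_of_snd hf
  have hpow : powGerm hp ℓ c = pullXT hp (of _ hf) := rfl
  rw [hpow, θ_pullXT, θ'_pullXT, hx, hy, map_zero, add_zero, map_mul, pullXT_algebraMap]
  exact ⟨rfl, rfl⟩

variable {hp} {w : BranchedPath (coordX p) (coordT p)}

/-- The function `X ^ (b'-a+1) (1-X) ^ (a-b-1) (XY-X) ^ (-b')` is, up to a constant factor, a branch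
of `X ^ (1-a) (1-X) ^ (a-b-1) (1-Y) ^ (-b')`, which explains its logarithmic derivatives. -/
theorem θ_pullXT_endGerm {a b b' α β δ : ℂ} (hα : α = b' - a) (hβ : β = a - b - 1)
    (hδ : δ = -b') :
    (1 - (frame hp).X) * (frame hp).θ (pullXT hp (w.endGerm (α + 1) β δ)) =
        (1 - κ a + κ b * (frame hp).X) * pullXT hp (w.endGerm (α + 1) β δ) ∧
      (1 - (frame hp).Y) * (frame hp).θ' (pullXT hp (w.endGerm (α + 1) β δ)) =
        κ b' * (frame hp).Y * pullXT hp (w.endGerm (α + 1) β δ) := by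
  -- all terms are multiples of `X ^ α (1-X) ^ (β-1) (XY-X) ^ (δ-1)`
  have h3 := w.endGerm_add_one_right (α + 1) β (δ - 1)
  have h4 := w.endGerm_add_one_right α β (δ - 1)
  have h5 := w.endGerm_add_one_right (α + 1) (β - 1) (δ - 1)
  have h6 := w.endGerm_add_one_middle α (β - 1) (δ - 1)
  have h7 := w.endGerm_add_one_middle (α + 1) (β - 1) (δ - 1)
  have h8 := w.endGerm_add_one_left α (β - 1) (δ - 1)
  rw [sub_add_cancel] at h3 h4 h5 h6 h7
  rw [θ_pullXT, θ'_pullXT, Dx_endGerm, Dy_endGerm, add_sub_cancel_right, h3, h4, h5, h6, h7, h8]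
  subst hα hβ hδ
  simp only [map_add, map_sub, map_neg, map_one, map_mul, pullXT_x, pullXT_y, pullXT_algebraMap]
  constructor <;> ring

/-- The integral `∫₀ˣ s^(b'-a) (1-s)^(a-b-1) (XY-s)^(-b') ds` is a solution. The second equation
follows from the contiguity relations and an integration by parts, and the integrand at the endpoint
satisfies the first order equation, so that the first equation holds as well. -/
theorem sysE2_pullXT_intGerm {a b b' α β δ : ℂ} (h : ∀ n : ℕ, α + n + 1 ≠ 0) (hα : α = b' - a)
    (hβ : β = a - b - 1) (hδ : δ = -b') :
    (frame hp).SysE2 a b b' (pullXT hp (w.intGerm h β δ)) := by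
  obtain ⟨hv₁, hv₂⟩ := θ_pullXT_endGerm (hp := hp) (w := w) hα hβ hδ
  have hv := θ_pullXT hp (w.intGerm h β δ)
  rw [x_mul_Dx_intGerm] at hv
  refine EulerFrame.SysE2.of_first_order ?_ (sub_eq_iff_eq_add'.2 hv).symm
    (by linear_combination hv₁ + hv₂)
  have h' := add_one_exponent h
  have i1 := θ'_pullXT hp (w.intGerm h β δ)
  have i2 := θ'_pullXT hp (w.intGerm h β (δ - 1))
  have i3 := θ'_pullXT hp (w.intGerm h' β (δ - 1))
  have c1 := congrArg (pullXT hp) (w.intGerm_add_one_right h β (δ - 1))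
  have c2 := congrArg (pullXT hp) (w.intGerm_add_one_right h β (δ - 1 - 1))
  have c3 := congrArg (pullXT hp) (w.intGerm_add_one_right h' β (δ - 1 - 1))
  have c4 := w.intGerm_add_one_middle h β (δ - 1)
  have c5 := w.intGerm_add_one_middle h' β (δ - 1 - 1)
  have c6 := w.intGerm_by_parts h (β + 1) (δ - 1)
  have e1 := θ'_pullXT hp (w.endGerm (α + 1) β δ)
  have e2 := congrArg (pullXT hp) (w.endGerm_add_one_right (α + 1) β (δ - 1))
  have e3 := w.endGerm_add_one_middle (α + 1) β (δ - 1)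
  rw [sub_add_cancel] at c1 c2 c3 e2
  rw [add_sub_cancel_right, c4, c5, e3] at c6
  replace c6 := congrArg (pullXT hp) c6
  rw [Dy_intGerm] at i1 i2 i3
  rw [Dy_endGerm] at e1
  clear hv₁ hv₂ c4 c5 e3
  simp only [map_mul, map_add, map_sub, map_one, pullXT_x, pullXT_y, pullXT_algebraMap] at *
  generalize frame hp = E at *
  generalize pullXT hp (w.intGerm h β δ) = u at *
  generalize pullXT hp (w.intGerm h β (δ - 1)) = u₁ at *
  generalize pullXT hp (w.intGerm h β (δ - 1 - 1)) = u₂ at *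
  generalize pullXT hp (w.intGerm h' β (δ - 1)) = z₁ at *
  generalize pullXT hp (w.intGerm h' β (δ - 1 - 1)) = z₂ at *
  generalize pullXT hp (w.intGerm (add_one_exponent h') β (δ - 1 - 1)) = y₂ at *
  generalize pullXT hp (w.endGerm (α + 1) β δ) = v at *
  generalize pullXT hp (w.endGerm (α + 1) β (δ - 1)) = v₁ at *
  have hb : (κ δ : AnGerm p) = -κ b' := by rw [hδ, map_neg]
  -- `(θ' + b') u = -b' z₁` and `(θ' + b') v = -b' X v₁`
  have hw : E.θ' u + κ b' * u = -(κ b' * z₁) := by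
    rw [i1, hb, c1]; ring
  have hw' : E.θ' v + κ b' * v = -(κ b' * (E.X * v₁)) := by
    rw [e1, hb, e2]; ring
  have hw'' : E.θ (E.θ' u + κ b' * u) = E.θ' (E.θ' u + κ b' * u) + (E.θ' v + κ b' * v) := by
    have hcomm : E.θ (E.θ' u) = E.θ' (E.θ' u) + E.θ' v := by rw [E.comm, hv, map_add]
    simp only [Derivation.map_algebraMap, map_add, Derivation.leibniz, smul_eq_mul, hcomm, hv]
    ring
  have hlhs : E.θ' (E.θ' u + (κ a - 1) * u) = E.X * E.Y * (κ δ * (u₁ +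
      E.X * E.Y * ((κ δ - 1) * u₂))) + (κ a - 1) * (E.X * E.Y * (κ δ * u₁)) := by
    simp only [Derivation.map_algebraMap, map_add, map_sub, Derivation.leibniz, smul_eq_mul,
      Derivation.map_one_eq_zero, i1, i2, E.θ'_X, E.θ'_Y]
    ring
  have hrhs : E.θ' (E.θ' u + κ b' * u) = -(κ b' * (E.X * E.Y * ((κ δ - 1) * z₂))) := by
    rw [hw, map_neg, Derivation.leibniz, Derivation.map_algebraMap, i3]
    simp
  simp only [EulerFrame.EqE2, EulerFrame.swap]
  rw [hw'', hrhs, hlhs, hw, hw', hb]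
  subst hδ hα hβ
  simp only [map_sub, map_neg, map_one] at c6
  linear_combination (-(κ b' * E.X * E.Y)) * ((κ b' + 1) * (c2 - c3) - c6)

end IntegralGerms

/-! ### The solution space of `E₂` -/

section Span

local notation "κ" => algebraMap ℂ _

attribute [local instance] germAlgebra

open AnGerm BranchedPath

variable {p : ℂ × ℂ}

theorem coe_add_algebraMap_mul (u v : AnGerm p) (c : ℂ) :
    ((u + κ c * v : AnGerm p) : Germ (𝓝 p) ℂ) = (u : Germ (𝓝 p) ℂ) + c • (v : Germ (𝓝 p) ℂ) := by
  obtain ⟨_, f, hf, rfl⟩ := u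
  obtain ⟨_, g, hg, rfl⟩ := v
  rfl

/-- The integral `f₁` is a solution, and `v = (θ - θ') f₁` satisfies the first order equations of
`X ^ (1-a) (1-X) ^ (a-b-1) (1-Y) ^ (-b')`. -/
theorem exists_germ_f₁ (hp : IsRegularPoint p) {a b b' : ℂ} (h : ∀ n : ℕ, b' - a + n + 1 ≠ 0)
    (w : BranchedPath (coordX p) (coordT p)) :
    ∃ u v : AnGerm p, (u : Germ (𝓝 p) ℂ) = (f₁ a b b' w : Germ (𝓝 p) ℂ) ∧
      (frame hp).SysE2 a b b' u ∧ (frame hp).θ u - (frame hp).θ' u = v ∧ IsUnit v ∧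
      (1 - (frame hp).X) * (frame hp).θ v = (1 - κ a + κ b * (frame hp).X) * v ∧
      (1 - (frame hp).Y) * (frame hp).θ' v = κ b' * (frame hp).Y * v := by
  have hv := θ_pullXT hp (w.intGerm h (a - b - 1) (-b'))
  rw [x_mul_Dx_intGerm] at hv
  exact ⟨pullXT hp (w.intGerm h (a - b - 1) (-b')), _, rfl, sysE2_pullXT_intGerm h rfl rfl rfl,
    sub_eq_iff_eq_add'.2 hv, (w.isUnit_endGerm _ _ _).map _, θ_pullXT_endGerm rfl rfl rfl⟩

/-- The integral `f₂` is a solution, and `v = (θ - θ') f₂` satisfies the first order equations of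
`Y ^ (1-a) (1-X) ^ (-b) (1-Y) ^ (a-b'-1)`. -/
theorem exists_germ_f₂ (hp : IsRegularPoint p) {a b b' : ℂ} (h : ∀ n : ℕ, b' + n ≠ 0) {ℓ : ℂ}
    (hℓ : Complex.exp ℓ = coordT p) (w : BranchedPath (coordX p) (coordT p)) :
    ∃ u v : AnGerm p, (u : Germ (𝓝 p) ℂ) = (f₂ a b b' ℓ w : Germ (𝓝 p) ℂ) ∧
      (frame hp).SysE2 a b b' u ∧ (frame hp).θ u - (frame hp).θ' u = v ∧ IsUnit v ∧
      (1 - (frame hp).X) * (frame hp).θ v = κ b * (frame hp).X * v ∧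
      (1 - (frame hp).Y) * (frame hp).θ' v = (1 - κ a + κ b' * (frame hp).Y) * v := by
  have h' : ∀ n : ℕ, b' - 1 + n + 1 ≠ 0 := fun n => by
    rw [show b' - 1 + n + 1 = b' + n by ring]; exact h n
  obtain ⟨hm, hm'⟩ := θ_powGerm hp hℓ (1 - a)
  have hv := θ_pullXT hp (w.intGerm h' (-b) (a - b' - 1))
  rw [x_mul_Dx_intGerm] at hv
  -- the integral is the one of `f₁` for the parameters `2 - a`, `b + 1 - a`, `b' + 1 - a`
  have e1 : b' - 1 = b' + 1 - a - (2 - a) := by ring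
  have e2 : -b = 2 - a - (b + 1 - a) - 1 := by ring
  have e3 : a - b' - 1 = -(b' + 1 - a) := by ring
  obtain ⟨hv₁, hv₂⟩ := θ_pullXT_endGerm (hp := hp) (w := w) e1 e2 e3
  have hsys := sysE2_pullXT_intGerm (hp := hp) (w := w) h' e1 e2 e3
  have h2 : (κ (2 : ℂ) : AnGerm p) = 2 := map_ofNat _ 2
  refine ⟨powGerm hp ℓ (1 - a) * pullXT hp (w.intGerm h' (-b) (a - b' - 1)),
    powGerm hp ℓ (1 - a) * pullXT hp (w.endGerm (b' - 1 + 1) (-b) (a - b' - 1)), rfl,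
    hsys.mul hm hm', ?_, (isUnit_powGerm hp _ _).mul ((w.isUnit_endGerm _ _ _).map _), ?_, ?_⟩
  · simp only [Derivation.leibniz, smul_eq_mul, hm, hm', hv]
    ring
  · simp only [Derivation.leibniz, smul_eq_mul, hm]
    simp only [map_add, map_sub, map_one, h2] at hv₁ ⊢
    linear_combination powGerm hp ℓ (1 - a) * hv₁
  · simp only [Derivation.leibniz, smul_eq_mul, hm']
    simp only [map_add, map_sub, map_one] at hv₂ ⊢
    linear_combination powGerm hp ℓ (1 - a) * hv₂

/-- The solutions of the system form a subspace of the space of germs. -/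
def sysE2Submodule (hp : IsRegularPoint p) (a b b' : ℂ) : Submodule ℂ (Germ (𝓝 p) ℂ) where
  carrier := {g | ∃ u : AnGerm p, (frame hp).SysE2 a b b' u ∧ (u : Germ (𝓝 p) ℂ) = g}
  zero_mem' := ⟨0, EulerFrame.SysE2.zero, rfl⟩
  add_mem' := by
    rintro _ _ ⟨u, hu, rfl⟩ ⟨v, hv, rfl⟩
    refine ⟨u + κ 1 * v, hu.add_smul 1 hv, ?_⟩
    rw [coe_add_algebraMap_mul, one_smul]
  smul_mem' := by
    rintro c _ ⟨u, hu, rfl⟩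
    refine ⟨0 + κ c * u, EulerFrame.SysE2.zero.add_smul c hu, ?_⟩
    rw [coe_add_algebraMap_mul]
    exact zero_add _

/-- Every solution is a combination of `f₁`, `f₂` and a solution of the Gauss equation. -/
theorem span_eq_sysE2Submodule (hp : IsRegularPoint p) {a b b' : ℂ} (ha : a ≠ 1)
    (h₁ : ∀ n : ℕ, b' - a + n + 1 ≠ 0) (h₂ : ∀ n : ℕ, b' + n ≠ 0)
    (w₁ w₂ : BranchedPath (coordX p) (coordT p)) {ℓ : ℂ} (hℓ : Complex.exp ℓ = coordT p) :
    Submodule.span ℂ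
        ({((f₁ a b b' w₁ : ℂ × ℂ → ℂ) : Germ (𝓝 p) ℂ),
          ((f₂ a b b' ℓ w₂ : ℂ × ℂ → ℂ) : Germ (𝓝 p) ℂ)} ∪ solGauss b b' a coordT p) =
      sysE2Submodule hp a b b' := by
  obtain ⟨u₁, v₁, hu₁, hs₁, hv₁, hunit₁, hx₁, hy₁⟩ := exists_germ_f₁ hp (b := b) h₁ w₁
  obtain ⟨u₂, v₂, hu₂, hs₂, hv₂, hunit₂, hx₂, hy₂⟩ := exists_germ_f₂ hp (a := a) (b := b) h₂ hℓ w₂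
  rw [← hu₁, ← hu₂]
  refine le_antisymm (Submodule.span_le.2 ?_) ?_
  · rintro g ((rfl | rfl) | hg)
    · exact ⟨u₁, hs₁, rfl⟩
    · exact ⟨u₂, hs₂, rfl⟩
    · obtain ⟨u, hu, rfl⟩ := (mem_solGauss_iff hp a b b').1 hg
      exact ⟨u, hu.sysE1.sysE2, rfl⟩
  · rintro _ ⟨u, hu, rfl⟩
    obtain ⟨c₁, c₂, ⟨hc₁, hc₁'⟩, ⟨hc₂, hc₂'⟩, hc⟩ :=
      hu.exists_coeff hunit₁ hunit₂ hx₁ hy₁ hx₂ hy₂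
    obtain ⟨c₁, rfl⟩ := exists_eq_algebraMap_of_θ hp hc₁ hc₁'
    obtain ⟨c₂, rfl⟩ := exists_eq_algebraMap_of_θ hp hc₂ hc₂'
    set d₁ := c₁ / (1 - a) with hd₁
    set d₂ := c₂ / (1 - a) with hd₂
    have ha' : 1 - a ≠ 0 := sub_ne_zero.2 ha.symm
    have hau : IsUnit (κ (1 - a) : AnGerm p) := (isUnit_iff_ne_zero.2 ha').map _
    have hk₁ : (κ c₁ : AnGerm p) = κ (1 - a) * κ d₁ := by
      rw [← map_mul, hd₁, mul_div_cancel₀ _ ha']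
    have hk₂ : (κ c₂ : AnGerm p) = κ (1 - a) * κ d₂ := by
      rw [← map_mul, hd₂, mul_div_cancel₀ _ ha']
    -- the combination of `u`, `f₁`, `f₂` that is killed by `θ - θ'`
    have hz := (hu.add_smul (-d₁) hs₁).add_smul (-d₂) hs₂
    have hG := hz.sysGauss (by
      rw [← sub_eq_zero, ← hau.mul_right_eq_zero]
      rw [hk₁, hk₂, ← hv₁, ← hv₂] at hc
      simp only [Derivation.map_algebraMap, map_add, map_sub, map_neg, map_one, Derivation.leibniz,
        smul_eq_mul] at hc ⊢
      linear_combination hc)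
    have hmem := (mem_solGauss_iff hp a b b').2 ⟨_, hG, rfl⟩
    rw [coe_add_algebraMap_mul, coe_add_algebraMap_mul] at hmem
    have e : (u : Germ (𝓝 p) ℂ) = ((u : Germ (𝓝 p) ℂ) + (-d₁) • (u₁ : Germ (𝓝 p) ℂ) +
        (-d₂) • (u₂ : Germ (𝓝 p) ℂ)) + d₁ • (u₁ : Germ (𝓝 p) ℂ) +
        d₂ • (u₂ : Germ (𝓝 p) ℂ) := by
      rw [neg_smul, neg_smul]; abel
    rw [e]
    refine Submodule.add_mem _ (Submodule.add_mem _ (Submodule.subset_span (Or.inr hmem))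
      (Submodule.smul_mem _ _ (Submodule.subset_span (Or.inl (Or.inl rfl)))))
      (Submodule.smul_mem _ _ (Submodule.subset_span (Or.inl (Or.inr rfl))))

end Span

end AppellE2

end

open AppellE2
theorem mainTheorem2 (a b b' : ℂ) (p : ℂ × ℂ)
    (hx0 : p.1 ≠ 0) (hx1 : p.1 ≠ 1) (hy0 : p.2 ≠ 0) (hy1 : p.2 ≠ 1) (hxy : p.1 + p.2 ≠ 1)
    (ℓx ℓy : ℂ) (hℓx : Complex.exp ℓx = 1 - p.1) (hℓy : Complex.exp ℓy = 1 - p.2) :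
    (solE1 b 0 b' a (fun q => (coordX q, coordT q)) p
        ⊆ mulSolE2 (factor b b' p ℓx ℓy) a b b' a a p ∧
      solE1 b' b 0 a (fun q => (coordT q, coordY q)) p
        ⊆ mulSolE2 (factor b b' p ℓx ℓy) a b b' a a p ∧
      solGauss b b' a coordT p ⊆ solE1 b 0 b' a (fun q => (coordX q, coordT q)) p ∧
      solGauss b b' a coordT p ⊆ solE1 b' b 0 a (fun q => (coordT q, coordY q)) p) ∧
    (a ≠ 1 →
      solE1 b 0 b' a (fun q => (coordX q, coordT q)) p ∩
          solE1 b' b 0 a (fun q => (coordT q, coordY q)) p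
        = solGauss b b' a coordT p) ∧
    (a ≠ 1 → (∀ n : ℕ, b' - a + n + 1 ≠ 0) → (∀ n : ℕ, b' + n ≠ 0) →
      ∀ (w₁ w₂ : BranchedPath (coordX p) (coordT p)) (ℓ : ℂ), Complex.exp ℓ = coordT p →
        (Submodule.span ℂ
            ({((f₁ a b b' w₁ : ℂ × ℂ → ℂ) : Filter.Germ (nhds p) ℂ),
              ((f₂ a b b' ℓ w₂ : ℂ × ℂ → ℂ) : Filter.Germ (nhds p) ℂ)} ∪
              solGauss b b' a coordT p) : Set (Filter.Germ (nhds p) ℂ))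
          = mulSolE2 (factor b b' p ℓx ℓy) a b b' a a p) := by
  have hp : IsRegularPoint p := ⟨hx0, hx1, hy0, hy1⟩
  have hXT : solGauss b b' a coordT p ⊆ solE1 b 0 b' a mapXT p := fun g hg => by
    obtain ⟨u, hu, rfl⟩ := (mem_solGauss_iff hp a b b').1 hg
    exact (mem_solE1_mapXT_iff hp a b b').2 ⟨u, hu.sysE1, rfl⟩
  have hTY : solGauss b b' a coordT p ⊆ solE1 b' b 0 a mapTY p := fun g hg => by
    obtain ⟨u, hu, rfl⟩ := (mem_solGauss_iff hp a b b').1 hg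
    exact (mem_solE1_mapTY_iff hp a b b').2 ⟨u, hu.swap.sysE1, rfl⟩
  refine ⟨⟨fun g hg => ?_, fun g hg => ?_, hXT, hTY⟩, fun ha => ?_, fun ha h₁ h₂ w₁ w₂ ℓ hℓ => ?_⟩
  · obtain ⟨u, hu, rfl⟩ := (mem_solE1_mapXT_iff hp a b b').1 hg
    exact (mem_mulSolE2_iff b b' hp a hℓx hℓy).2 ⟨u, hu.sysE2, rfl⟩
  · obtain ⟨u, hu, rfl⟩ := (mem_solE1_mapTY_iff hp a b b').1 hg
    exact (mem_mulSolE2_iff b b' hp a hℓx hℓy).2 ⟨u, hu.sysE2.swap, rfl⟩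
  · refine Set.Subset.antisymm ?_ (Set.subset_inter hXT hTY)
    rintro g ⟨hg, hg'⟩
    obtain ⟨u, hu, rfl⟩ := (mem_solE1_mapXT_iff hp a b b').1 hg
    obtain ⟨u', hu', huu⟩ := (mem_solE1_mapTY_iff hp a b b').1 hg'
    obtain rfl : u' = u := Subtype.ext huu
    exact (mem_solGauss_iff hp a b b').2 ⟨u', hu.sysGauss ha hu', rfl⟩
  · rw [span_eq_sysE2Submodule hp ha h₁ h₂ w₁ w₂ hℓ]
    exact Set.ext fun g => (mem_mulSolE2_iff b b' hp a hℓx hℓy).symm
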